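/- Let $d\ge 2$ and let $\mathbf k=(k_1,\dots,k_{d+1})$ be positive integers, not all equal; read indices modulo $d+1$. Notation. Let $M_{\mathbf k}$ be the $(d+1)\times(d+1)$ integer matrix whose $i$th row has $k_i+1$ in column $i$, $-k_{i+1}$ in column $i+1$, and $0$ elsewhere. Let $w_i=(d+1)e_i-(1,\dots,1)$ and $\widetilde w_i=\frac1{d+1}w_i$ for $1\le i\le d+1$. Let $L$ be the lattice generated by the $w_i$, and let $L_{\mathbf k}\subset L$ (resp. $\widetilde L_{\mathbf k}$) be the set of all $\sum_i a_iw_i$ (resp. $\sum_i a_i\widetilde w_i$) with $(a_1,\dots,a_{d+1})$ an integer combination of the rows of $M_{\mathbf k}$. * $G_d$ is the graph of the permutahedral tiling. Its vertices are the $x\in\mathbb Z^{d+1}$ with $\sum_i x_i=1+\dots+(d+1)$ whose entries represent all residues modulo $d+1$; two vertices $x,y$ are adjacent if $y-x=e_j-e_i$ for some $i\ne j$. The generalized Heawood graph $H_{\mathbf k}=G_d/L_{\mathbf k}$ is obtained by identifying vertices and edges up to translation by $L_{\mathbf k}$. * Let $V=\{x\in\mathbb R^{d+1}:\sum_i x_i=0\}$.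 The hyperplanes $x_j-x_i=m$ ($i<j$, $m\in\mathbb Z$) cut $V$ into simplices, which form an infinite simplicial complex with vertex set $\{x\in V: x_j-x_i\in\mathbb Z\ \text{for all}\ i<j\}$. The complex $T_{\mathbf k}$ consists of the classes of its faces up to translation by $\widetilde L_{\mathbf k}$; a face class is contained in another if some representative of the first is contained in some representative of the second. A vertex $v$ of the infinite complex is dual to the tile $\mathrm{Perm}_d+(d+1)v$, where $\mathrm{Perm}_d$ is the convex hull of the permutations of $(1,\dots,d+1)$, and a facet $F$ is dual to the vertex of $G_d$ common to the tiles of its vertices. In this way the facets of $T_{\mathbf k}$ correspond to the vertices of $H_{\mathbf k}$. * Let $C_{d+1}$ be the group of cyclic rotations of the index set, let $C_{\mathbf k}=\{c\in C_{d+1}: k_{c(i)}=k_i \text{ for all } i\}$, and let $\ell=|C_{\mathbf k}|$. **Theorem.** The automorphism group of $H_{\mathbf k}$ coincides with that of $T_{\mathbf k}$: there is a group isomorphism $\operatorname{Aut}(T_{\mathbf k})\to\operatorname{Aut}(H_{\mathbf k})$ sending each $\sigma$ to the automorphism of $H_{\mathbf k}$ that acts on the vertices of $H_{\mathbf k}$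 as $\sigma$ acts on the dual facets of $T_{\mathbf k}$. Moreover $\operatorname{Aut}(H_{\mathbf k})$ is generated by the automorphisms induced by the translations $x\mapsto x+v$ with $v\in L$ (the group $T$), by the map $w_i\mapsto -w_i$, that is $x\mapsto (d+2)(1,\dots,1)-x$ (the element $R$), and by the coordinate permutations $w_i\mapsto w_{c(i)}$ with $c\in C_{\mathbf k}$; and $$|\operatorname{Aut}(H_{\mathbf k})|=2\,\ell\,\det M_{\mathbf k}.$$ In particular this holds for $d=2$ and $\mathbf k=(1,1,n)$ with $n\ge 2$. -/

import Mathlib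

namespace Heawood

/-! ### The permutahedral tiling graph and its quotients -/

/-- The matrix `M_k`: row `i` has `k i + 1` on the diagonal and `-k (i+1)` in the (cyclically)
next column. -/
def M {d : ℕ} (k : Fin (d + 1) → ℕ) : Matrix (Fin (d + 1)) (Fin (d + 1)) ℤ :=
  Matrix.of fun i j =>
    (if j = i then (k j : ℤ) + 1 else 0) - (if j = i + 1 then (k j : ℤ) else 0)

/-- The vectors `w_i = (d+1) e_i - (1,…,1)`. -/
def w (d : ℕ) (i : Fin (d + 1)) : Fin (d + 1) → ℤ :=
  fun j => ((d : ℤ) + 1) * (if j = i then 1 else 0) - 1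

/-- The lattice of all integer combinations of the `w_i`. -/
def lattice (d : ℕ) : Submodule ℤ (Fin (d + 1) → ℤ) :=
  LinearMap.range (Fintype.linearCombination ℤ (w d))

/-- The sublattice of the combinations `a_1 w_1 + … + a_{d+1} w_{d+1}` whose coefficient vector `a`
is an integer combination `b M_k` of the rows of `M_k`. -/
def sublattice {d : ℕ} (k : Fin (d + 1) → ℕ) : Submodule ℤ (Fin (d + 1) → ℤ) :=
  (LinearMap.range (M k).vecMulLinear).map (Fintype.linearCombination ℤ (w d))

/-- The vertices of the graph of the `d`-dimensional permutahedral tiling: integer vectors with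
coordinate sum `1 + … + (d+1)` whose entries hit every residue class mod `d+1`. -/
def TilingVertex (d : ℕ) : Type :=
  {x : Fin (d + 1) → ℤ // ∑ i, x i = ∑ i : Fin (d + 1), ((i : ℤ) + 1) ∧
    Function.Surjective fun i => (x i : ZMod (d + 1))}

/-- The graph of the permutahedral tiling: `x` and `y` are adjacent when `y - x = e_j - e_i`
for some `i ≠ j`. -/
def tilingGraph (d : ℕ) : SimpleGraph (TilingVertex d) where
  Adj x y := ∃ i j : Fin (d + 1), i ≠ j ∧
    y.1 - x.1 = Pi.single j (1 : ℤ) - Pi.single i (1 : ℤ)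
  symm := ⟨by
    rintro x y ⟨i, j, hij, h⟩
    exact ⟨j, i, hij.symm, by rw [← neg_sub, h, neg_sub]⟩⟩
  loopless := ⟨by
    rintro x ⟨i, j, hij, h⟩
    have := congrFun h i
    simp [hij] at this⟩

/-- Two vertices of the tiling are `k`-equivalent when they differ by a vector of the sublattice. -/
def vertexSetoid {d : ℕ} (k : Fin (d + 1) → ℕ) : Setoid (TilingVertex d) where
  r x y := ∃ v ∈ sublattice k, y.1 = x.1 + v
  iseqv :=
    { refl := fun x => ⟨0, zero_mem _, by simp⟩
      symm := by
        rintro x y ⟨v, hv, h⟩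
        exact ⟨-v, neg_mem hv, by rw [h]; abel⟩
      trans := by
        rintro x y z ⟨v, hv, h⟩ ⟨u, hu, h'⟩
        exact ⟨v + u, add_mem hv hu, by rw [h', h]; abel⟩ }

/-- The vertices of the generalized Heawood graph: classes of tiling vertices. -/
abbrev HeawoodVertex {d : ℕ} (k : Fin (d + 1) → ℕ) : Type := Quotient (vertexSetoid k)

/-- The class of a tiling vertex. -/
def cls {d : ℕ} (k : Fin (d + 1) → ℕ) (x : TilingVertex d) : HeawoodVertex k :=
  Quotient.mk (vertexSetoid k) x

/-- The generalized Heawood graph `H_k`: the quotient of the tiling graph by translations in the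
sublattice. -/
def heawoodGraph {d : ℕ} (k : Fin (d + 1) → ℕ) : SimpleGraph (HeawoodVertex k) where
  Adj a b := a ≠ b ∧ ∃ x y, cls k x = a ∧ cls k y = b ∧ (tilingGraph d).Adj x y
  symm := ⟨by
    rintro a b ⟨hab, x, y, hx, hy, h⟩
    exact ⟨hab.symm, y, x, hy, hx, h.symm⟩⟩
  loopless := ⟨fun _ h => h.1 rfl⟩

/-- The automorphism group of `H_k` (composition as multiplication). -/
abbrev HeawoodAut {d : ℕ} (k : Fin (d + 1) → ℕ) : Type := heawoodGraph k ≃g heawoodGraph k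

/-! ### The automorphisms `T`, `R` and `C` -/

/-- An automorphism of the tiling graph that respects `k`-equivalence acts on `H_k`. -/
def descend {d : ℕ} (k : Fin (d + 1) → ℕ) (g : tilingGraph d ≃g tilingGraph d)
    (hg : ∀ x y, vertexSetoid k x y ↔ vertexSetoid k (g x) (g y)) : HeawoodAut k where
  toEquiv := Quotient.congr g.toEquiv hg
  map_rel_iff' := by
    have key : ∀ x, Quotient.congr g.toEquiv hg (cls k x) = cls k (g x) := fun _ => rfl
    intro a b
    constructor
    · rintro ⟨hab, x, y, hx, hy, h⟩
      refine ⟨fun e => hab (by rw [e]), g.symm x, g.symm y, ?_, ?_, ?_⟩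
      · apply (Quotient.congr g.toEquiv hg).injective
        rw [key, ← hx]; simp
      · apply (Quotient.congr g.toEquiv hg).injective
        rw [key, ← hy]; simp
      · exact g.symm.map_rel_iff.2 h
    · rintro ⟨hab, x, y, hx, hy, h⟩
      refine ⟨fun e => hab ((Quotient.congr g.toEquiv hg).injective e), g x, g y, ?_, ?_, ?_⟩
      · rw [← hx]; rfl
      · rw [← hy]; rfl
      · exact g.map_rel_iff.2 h

theorem linComb_w_apply {d : ℕ} (a : Fin (d + 1) → ℤ) (i : Fin (d + 1)) :
    Fintype.linearCombination ℤ (w d) a i = ((d : ℤ) + 1) * a i - ∑ j, a j := by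
  simp [Fintype.linearCombination_apply, w, Finset.sum_apply, mul_sub, Finset.sum_sub_distrib,
    mul_comm]

theorem add_mem_tiling {d : ℕ} {v : Fin (d + 1) → ℤ} (hv : v ∈ lattice d)
    {x : Fin (d + 1) → ℤ}
    (hx : ∑ i, x i = ∑ i : Fin (d + 1), ((i : ℤ) + 1) ∧
      Function.Surjective fun i => (x i : ZMod (d + 1))) :
    ∑ i, (x + v) i = ∑ i : Fin (d + 1), ((i : ℤ) + 1) ∧
      Function.Surjective fun i => ((x + v) i : ZMod (d + 1)) := by
  obtain ⟨a, rfl⟩ := hv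
  refine ⟨?_, fun r => ?_⟩
  · simp only [Pi.add_apply, Finset.sum_add_distrib, hx.1, linComb_w_apply,
      Finset.sum_sub_distrib, ← Finset.mul_sum]
    simp
  · obtain ⟨i, hi⟩ := hx.2 (r + ((∑ j, a j : ℤ) : ZMod (d + 1)))
    refine ⟨i, ?_⟩
    have h0 : ((d : ZMod (d + 1)) + 1) = 0 := by exact_mod_cast ZMod.natCast_self (d + 1)
    simp only [Pi.add_apply, linComb_w_apply] at hi ⊢
    push_cast at hi ⊢
    rw [hi, h0]
    ring

/-- Translation of the tiling graph by a vector of the lattice. -/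
def tilingTranslation {d : ℕ} (v : lattice d) : tilingGraph d ≃g tilingGraph d where
  toFun x := ⟨x.1 + v.1, add_mem_tiling v.2 x.2⟩
  invFun x := ⟨x.1 + -v.1, add_mem_tiling (neg_mem v.2) x.2⟩
  left_inv x := Subtype.ext (by simp)
  right_inv x := Subtype.ext (by simp)
  map_rel_iff' := by
    intro x y
    refine exists_congr fun i => exists_congr fun j => and_congr_right fun _ => ?_
    change y.1 + v.1 - (x.1 + v.1) = _ ↔ _
    rw [add_sub_add_right_eq_sub]

/-- The tiling automorphism `x ↦ (d+2)(1,…,1) - x`, the central symmetry about the centre of the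
permutahedron; it sends each `w_i` to `-w_i`. -/
def tilingRotation (d : ℕ) : tilingGraph d ≃g tilingGraph d where
  toEquiv :=
    have hm : ∀ x : TilingVertex d,
        ∑ i, ((d : ℤ) + 2 - x.1 i) = ∑ i : Fin (d + 1), ((i : ℤ) + 1) ∧
          Function.Surjective fun i => (((d : ℤ) + 2 - x.1 i : ℤ) : ZMod (d + 1)) := by
      intro x
      refine ⟨?_, fun r => ?_⟩
      · have h := Equiv.sum_comp Fin.revPerm fun i : Fin (d + 1) => ((i : ℤ) + 1)
        rw [Finset.sum_sub_distrib, x.2.1, sub_eq_iff_eq_add]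
        nth_rewrite 1 [← h]
        rw [← Finset.sum_add_distrib]
        refine Finset.sum_congr rfl fun i _ => ?_
        have := i.is_lt
        rw [Fin.revPerm_apply, Fin.val_rev, Nat.cast_sub (by omega)]
        push_cast
        ring
      · obtain ⟨i, hi⟩ := x.2.2 (((d : ℤ) + 2 : ℤ) - r)
        refine ⟨i, ?_⟩
        simp only at hi ⊢
        rw [Int.cast_sub, hi]
        ring
    { toFun := fun x => ⟨fun i => (d : ℤ) + 2 - x.1 i, hm x⟩
      invFun := fun x => ⟨fun i => (d : ℤ) + 2 - x.1 i, hm x⟩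
      left_inv := fun x => Subtype.ext (by simp)
      right_inv := fun x => Subtype.ext (by simp) }
  map_rel_iff' := by
    have e : ∀ a b : Fin (d + 1) → ℤ,
        ((fun i => (d : ℤ) + 2 - b i) - fun i => (d : ℤ) + 2 - a i) = -(b - a) := by
      intro a b; funext i; simp
    intro x y
    constructor
    · rintro ⟨i, j, hij, h⟩
      refine ⟨j, i, hij.symm, ?_⟩
      have h' := (e x.1 y.1).symm.trans h
      rw [← neg_neg (y.1 - x.1), h', neg_sub]
    · rintro ⟨i, j, hij, h⟩
      refine ⟨j, i, hij.symm, ?_⟩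
      refine (e x.1 y.1).trans ?_
      rw [h, neg_sub]

/-- The tiling automorphism permuting the coordinates by `c`; it sends `w_i` to `w_{c i}`. -/
def tilingPerm {d : ℕ} (c : Equiv.Perm (Fin (d + 1))) : tilingGraph d ≃g tilingGraph d where
  toEquiv :=
    have hm : ∀ (c : Equiv.Perm (Fin (d + 1))) (x : TilingVertex d),
        ∑ i, x.1 (c i) = ∑ i : Fin (d + 1), ((i : ℤ) + 1) ∧
          Function.Surjective fun i => (x.1 (c i) : ZMod (d + 1)) := fun c x =>
      ⟨(Equiv.sum_comp c x.1).trans x.2.1, x.2.2.comp c.surjective⟩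
    { toFun := fun x => ⟨fun i => x.1 (c.symm i), hm c.symm x⟩
      invFun := fun x => ⟨fun i => x.1 (c i), hm c x⟩
      left_inv := fun x => Subtype.ext (by simp)
      right_inv := fun x => Subtype.ext (by simp) }
  map_rel_iff' := by
    have e : ∀ (c : Equiv.Perm (Fin (d + 1))) (i j : Fin (d + 1)),
        (fun l => (Pi.single j (1 : ℤ) - Pi.single i (1 : ℤ) : Fin (d + 1) → ℤ) (c.symm l)) =
          Pi.single (c j) (1 : ℤ) - Pi.single (c i) (1 : ℤ) := by
      intro c i j
      funext l
      simp [Pi.single_apply, Equiv.symm_apply_eq]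
    intro x y
    constructor
    · rintro ⟨i, j, hij, h⟩
      refine ⟨c.symm i, c.symm j, c.symm.injective.ne hij, ?_⟩
      rw [← e, ← h]
      funext l
      change y.1 l - x.1 l = y.1 (c.symm (c l)) - x.1 (c.symm (c l))
      rw [Equiv.symm_apply_apply]
    · rintro ⟨i, j, hij, h⟩
      refine ⟨c i, c j, c.injective.ne hij, ?_⟩
      rw [← e, ← h]
      rfl

/-- The subgroup of the cyclic group `C_{d+1}` (generated by `i ↦ i+1`) of those rotations of the
index set that leave every value of `k` unchanged. -/
def cyclicStabilizer {d : ℕ} (k : Fin (d + 1) → ℕ) : Subgroup (Equiv.Perm (Fin (d + 1))) where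
  carrier := {c | c ∈ Subgroup.zpowers (finRotate (d + 1)) ∧ ∀ i, k (c i) = k i}
  mul_mem' := by
    rintro a b ⟨ha, ha'⟩ ⟨hb, hb'⟩
    exact ⟨mul_mem ha hb, fun i => by rw [Equiv.Perm.mul_apply, ha', hb']⟩
  one_mem' := ⟨one_mem _, fun _ => rfl⟩
  inv_mem' := by
    rintro a ⟨ha, ha'⟩
    exact ⟨inv_mem ha, fun i => by rw [← ha' (a⁻¹ i)]; simp⟩

theorem perm_mem_sublattice {d : ℕ} {k : Fin (d + 1) → ℕ} {c : Equiv.Perm (Fin (d + 1))}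
    (hc : c ∈ cyclicStabilizer k) {v : Fin (d + 1) → ℤ} (hv : v ∈ sublattice k) :
    (fun i => v (c i)) ∈ sublattice k := by
  obtain ⟨a, ⟨b, rfl⟩, rfl⟩ := hv
  refine ⟨_, ⟨fun i => b (c i), rfl⟩, ?_⟩
  have hadd : ∀ i, c (i + 1) = c i + 1 := by
    obtain ⟨n, rfl⟩ := Subgroup.mem_zpowers_iff.1 hc.1
    intro i
    have := congrArg (fun f : Equiv.Perm (Fin (d + 1)) => f i)
      ((Commute.refl (finRotate (d + 1))).zpow_left n).eq
    simpa [Equiv.Perm.mul_apply, finRotate_apply] using this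
  have hM : ∀ i j, M k (c i) (c j) = M k i j := by
    intro i j
    simp only [M, Matrix.of_apply, hc.2, ← hadd, c.injective.eq_iff]
  have hvec : ∀ j, (M k).vecMulLinear (fun i => b (c i)) j = (M k).vecMulLinear b (c j) := by
    intro j
    simp only [Matrix.vecMulLinear_apply, Matrix.vecMul, dotProduct]
    rw [← Equiv.sum_comp c (fun i => b i * M k i (c j))]
    simp only [hM]
  funext i
  rw [linComb_w_apply, linComb_w_apply, hvec]
  congr 1
  exact (Finset.sum_congr rfl fun j _ => hvec j).trans (Equiv.sum_comp c _)

/-- `T`: the automorphism of `H_k` induced by the translation by `v`. -/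
def translationAut {d : ℕ} (k : Fin (d + 1) → ℕ) (v : lattice d) : HeawoodAut k :=
  descend k (tilingTranslation v) fun x y => by
    refine exists_congr fun u => and_congr_right fun _ => ?_
    change _ ↔ y.1 + v.1 = x.1 + v.1 + u
    rw [add_right_comm, add_left_inj]

/-- `R`: the automorphism of `H_k` induced by `w_i ↦ -w_i`. -/
def rotationAut {d : ℕ} (k : Fin (d + 1) → ℕ) : HeawoodAut k :=
  descend k (tilingRotation d) fun x y => by
    constructor
    · rintro ⟨u, hu, h⟩
      refine ⟨-u, neg_mem hu, ?_⟩
      funext i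
      have := congrFun h i
      change (d : ℤ) + 2 - y.1 i = (d : ℤ) + 2 - x.1 i + -u i
      rw [this, Pi.add_apply]
      ring
    · rintro ⟨u, hu, h⟩
      refine ⟨-u, neg_mem hu, ?_⟩
      funext i
      have : (d : ℤ) + 2 - y.1 i = (d : ℤ) + 2 - x.1 i + u i := congrFun h i
      change y.1 i = x.1 i + -u i
      linarith

/-- `C`: the automorphism of `H_k` induced by `w_i ↦ w_{c i}`, for a cyclic rotation `c` of the
indices that preserves `k`. -/
def cyclicAut {d : ℕ} (k : Fin (d + 1) → ℕ) (c : cyclicStabilizer k) : HeawoodAut k :=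
  descend k (tilingPerm c.1) fun x y => by
    constructor
    · rintro ⟨u, hu, h⟩
      refine ⟨fun i => u (c.1.symm i), perm_mem_sublattice (inv_mem c.2) hu, ?_⟩
      funext i
      exact congrFun h _
    · rintro ⟨u, hu, h⟩
      refine ⟨fun i => u (c.1 i), perm_mem_sublattice c.2 hu, ?_⟩
      funext i
      have : y.1 (c.1.symm (c.1 i)) = x.1 (c.1.symm (c.1 i)) + u (c.1 i) := congrFun h (c.1 i)
      simpa using this

/-! ### The triangulated torus -/

/-- The hyperplane `V` of vectors with coordinate sum zero. -/
def V (d : ℕ) : Set (Fin (d + 1) → ℝ) := {x | ∑ i, x i = 0}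

/-- A point of `V` on none of the hyperplanes `x_j - x_i = m` (`i < j`, `m ∈ ℤ`) of the affine
Coxeter arrangement. -/
def Generic {d : ℕ} (z : Fin (d + 1) → ℝ) : Prop :=
  z ∈ V d ∧ ∀ i j, i < j → ∀ m : ℤ, z j - z i ≠ m

/-- The closed region of the affine Coxeter arrangement containing the generic point `z`: the
points of `V` that no hyperplane of the arrangement strictly separates from `z`. -/
def closedRegion {d : ℕ} (z : Fin (d + 1) → ℝ) : Set (Fin (d + 1) → ℝ) :=
  {x | x ∈ V d ∧ ∀ i j, i < j → ∀ m : ℤ,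
    (z j - z i < m → x j - x i ≤ m) ∧ ((m : ℝ) < z j - z i → (m : ℝ) ≤ x j - x i)}

/-- The weight lattice, the vertex set of the complex of the affine Coxeter arrangement. -/
def weightLattice (d : ℕ) : Set (Fin (d + 1) → ℝ) :=
  {x | x ∈ V d ∧ ∀ i j, i < j → ∃ m : ℤ, x j - x i = m}

/-- The (nonempty) faces of the simplicial complex cut out by the affine Coxeter arrangement:
nonempty sets of vertices of one of its closed regions, which are simplices. -/
def AffineFace (d : ℕ) : Type :=
  {F : Finset (Fin (d + 1) → ℝ) // F.Nonempty ∧ (∀ v ∈ F, v ∈ weightLattice d) ∧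
    ∃ z, Generic z ∧ ∀ v ∈ F, v ∈ closedRegion z}

/-- The vectors `e_i - (1,…,1)/(d+1)`, that is `w_i / (d+1)`. -/
noncomputable def wAff (d : ℕ) (i : Fin (d + 1)) : Fin (d + 1) → ℝ :=
  fun j => (if j = i then 1 else 0) - 1 / ((d : ℝ) + 1)

/-- The sublattice of the weight lattice of the combinations of the `w_i / (d+1)` whose coefficient
vector is an integer combination of the rows of `M_k`. -/
noncomputable def affSublattice {d : ℕ} (k : Fin (d + 1) → ℕ) : Submodule ℤ (Fin (d + 1) → ℝ) :=
  (LinearMap.range (M k).vecMulLinear).map (Fintype.linearCombination ℤ (wAff d))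

/-- Two faces are `k`-equivalent when one is a translate of the other by a vector of the
sublattice. -/
def faceSetoid {d : ℕ} (k : Fin (d + 1) → ℕ) : Setoid (AffineFace d) where
  r F F' := ∃ v ∈ affSublattice k, F'.1 = F.1.map (addRightEmbedding v)
  iseqv :=
    { refl := fun F => ⟨0, zero_mem _, by ext; simp⟩
      symm := by
        rintro F F' ⟨v, hv, h⟩
        refine ⟨-v, neg_mem hv, ?_⟩
        rw [h, Finset.map_map]
        ext; simp
      trans := by
        rintro F F' F'' ⟨v, hv, h⟩ ⟨u, hu, h'⟩
        refine ⟨v + u, add_mem hv hu, ?_⟩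
        rw [h', h, Finset.map_map]
        ext; simp [add_assoc] }

/-- The faces of the triangulated torus `T_k`: `k`-equivalence classes of faces. -/
abbrev TorusFace {d : ℕ} (k : Fin (d + 1) → ℕ) : Type := Quotient (faceSetoid k)

/-- The class of a face. -/
def faceCls {d : ℕ} (k : Fin (d + 1) → ℕ) (F : AffineFace d) : TorusFace k :=
  Quotient.mk (faceSetoid k) F

/-- Containment in `T_k`: a face class is contained in another if some representative of the first
is contained in some representative of the second. -/
def TorusLE {d : ℕ} (k : Fin (d + 1) → ℕ) (a b : TorusFace k) : Prop :=
  ∃ F F' : AffineFace d, faceCls k F = a ∧ faceCls k F' = b ∧ F.1 ⊆ F'.1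

/-- The automorphism group of the complex `T_k`: bijections of the faces preserving containment in
both directions (composition as multiplication). -/
abbrev TorusAut {d : ℕ} (k : Fin (d + 1) → ℕ) : Type := TorusLE k ≃r TorusLE k

/-! ### Duality between the two -/

/-- Facets, that is maximal faces. -/
def IsFacet {d : ℕ} (F : AffineFace d) : Prop := ∀ F' : AffineFace d, F.1 ⊆ F'.1 → F' = F

/-- `x` is the vertex of the permutahedral tiling dual to the facet `F`. The vertex `v` of `F` is
dual to the tile `Perm_d + (d+1) v`, and the vertices of `Perm_d` are the permutations of
`(1,…,d+1)`; so `x` has to be a vertex of the tiles dual to all vertices of `F`. -/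
def IsDual {d : ℕ} (F : AffineFace d) (x : TilingVertex d) : Prop :=
  IsFacet F ∧ ∀ v ∈ F.1, ∃ π : Equiv.Perm (Fin (d + 1)), ∀ i,
    (x.1 i : ℝ) = (((π i : ℕ) : ℝ) + 1) + ((d : ℝ) + 1) * v i

end Heawood

/-! At a tiling vertex `x`, give the label `r ∈ ℤ/(d+1)` to the edge that raises the coordinate of
residue `r` and lowers the one of residue `r + 1`. The labels behave like the simple reflections of
affine type A: non-neighbouring labels commute and span squares, neighbouring ones satisfy the braid
relation and span hexagons. A nonzero vector of the sublattice has two coordinates differing by at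
least `3(d+1)` (`exists_sub_ge`). Hence closed walks of length four in `H_k` come from the tiling,
and so do those of length six when `d ≥ 3`.

An automorphism `φ` matches the labels at `x` with those at a lift `y` of the image by a map `τ`.
Squares show which labels are neighbours on the cycle, so `τ r = ±r + c` (`Local.dihedral`).
Hexagons show that `τ` does not change when an edge is crossed (`Local.const`): a path with labels
`t, r, t'`, where `t` and `t'` are neighbours of `r`, lies on a hexagon only if `t' = t`. For `d =
2` there can be further closed walks of length six, but only if two of the `k_i` are 1. Since `k` is
not constant, the third is then not 1, and the pattern of all hexagons singles out coordinate
directions, which `φ` has to preserve; again `τ` is constant. This is the point where the `k_i` must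
not all be equal.

The maps `x ↦ v + π(±x)` also relabel edges by `±r + c`, and one of them takes a given vertex to a
given vertex with prescribed sign and `c` (`exists_transport`). The tiling graph is connected, so
`φ` is induced by such a map (`exists_lift`). Then `π` preserves the sublattice, and comparing the
images of the rows of `M_k` with the shortest possible two-term combinations shows that `π` is a
rotation preserving `k` (`mem_cyclicStabilizer_of_preserves`). The rotation, the sign and the class
of `v` are determined by `φ`, and there are `det M_k` classes of translations; this gives the
generators and the order.

On the side of `T_k`, the facet dual to `x` has the vertices with coefficients `⌊(x_i + s -
1)/(d+1)⌋`, for `s` modulo `d + 1`. Adjacency in `H_k` means sharing a ridge, a notion of the face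
poset alone (`adj_iff_ridge`), so automorphisms of `T_k` act on `H_k`. The action is faithful
because a face of `T_k` is determined by the facets above it (`eq_of_facets_above`), and every
automorphism of `H_k` arises because the generators come from affine maps carrying facets to facets.
-/

namespace Heawood

/-! ### Edge labels of the tiling graph and its connectedness -/

section Labels

variable {d : ℕ}

/-- The residues modulo `d + 1` of the coordinates of a tiling vertex. -/
noncomputable def res (x : TilingVertex d) : Fin (d + 1) ≃ ZMod (d + 1) :=
  Equiv.ofBijective (fun i => (x.1 i : ZMod (d + 1)))
    ((Fintype.bijective_iff_surjective_and_card _).2 ⟨x.2.2, by simp⟩)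

/-- The index of the coordinate with a given residue. -/
noncomputable def idx (x : TilingVertex d) : ZMod (d + 1) ≃ Fin (d + 1) := (res x).symm

theorem res_apply (x : TilingVertex d) (i : Fin (d + 1)) : res x i = (x.1 i : ZMod (d + 1)) := rfl

theorem coe_idx (x : TilingVertex d) (r : ZMod (d + 1)) :
    (x.1 (idx x r) : ZMod (d + 1)) = r := (res x).apply_symm_apply r

theorem idx_eq_iff (x : TilingVertex d) (r : ZMod (d + 1)) (i : Fin (d + 1)) :
    idx x r = i ↔ (x.1 i : ZMod (d + 1)) = r := by
  rw [← res_apply, idx, Equiv.symm_apply_eq, eq_comm]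

theorem eq_idx_iff (x : TilingVertex d) (r : ZMod (d + 1)) (i : Fin (d + 1)) :
    i = idx x r ↔ (x.1 i : ZMod (d + 1)) = r := by
  rw [eq_comm, idx_eq_iff]

theorem tilingVertex_ext {x y : TilingVertex d} (h : ∀ i, x.1 i = y.1 i) : x = y :=
  Subtype.ext (funext h)

instance nontrivial_zmod_succ [Fact (2 ≤ d)] : Nontrivial (ZMod (d + 1)) :=
  haveI : Fact (1 < d + 1) := ⟨by have := Fact.out (p := 2 ≤ d); omega⟩
  inferInstance

theorem one_add_one_ne [Fact (2 ≤ d)] : (1 + 1 : ZMod (d + 1)) ≠ 0 := by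
  intro h
  have h2 : ((2 : ℕ) : ZMod (d + 1)) = 0 := by push_cast; rw [← h]; norm_num
  rw [ZMod.natCast_eq_zero_iff] at h2
  have := Nat.le_of_dvd (by norm_num) h2
  have := Fact.out (p := 2 ≤ d)
  omega

theorem add_one_ne [Fact (2 ≤ d)] (r : ZMod (d + 1)) : r + 1 ≠ r := by simp

theorem ne_add_one [Fact (2 ≤ d)] (r : ZMod (d + 1)) : r ≠ r + 1 := (add_one_ne r).symm

theorem add_one_add_one_ne [Fact (2 ≤ d)] (r : ZMod (d + 1)) : r + 1 + 1 ≠ r := by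
  rw [add_assoc]; simpa using one_add_one_ne

theorem ne_add_one_add_one [Fact (2 ≤ d)] (r : ZMod (d + 1)) : r ≠ r + 1 + 1 :=
  (add_one_add_one_ne r).symm

theorem step_residue [Fact (2 ≤ d)] (x : TilingVertex d) (r : ZMod (d + 1)) (l : Fin (d + 1)) :
    ((x.1 l + (if l = idx x r then 1 else 0) - (if l = idx x (r + 1) then 1 else 0) : ℤ) :
      ZMod (d + 1)) = Equiv.swap r (r + 1) (x.1 l) := by
  simp only [eq_idx_iff]
  by_cases h : (x.1 l : ZMod (d + 1)) = r
  · simp [h]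
  · by_cases h' : (x.1 l : ZMod (d + 1)) = r + 1
    · simp [h']
    · simp [h, h', Equiv.swap_apply_of_ne_of_ne h h']

/-- The neighbour of `x` obtained by raising the coordinate of residue `r` and lowering the
coordinate of residue `r + 1`. -/
noncomputable def nbr [Fact (2 ≤ d)] (x : TilingVertex d) (r : ZMod (d + 1)) : TilingVertex d :=
  ⟨fun l => x.1 l + (if l = idx x r then 1 else 0) - (if l = idx x (r + 1) then 1 else 0), by
    refine ⟨?_, fun s => ?_⟩
    · refine Eq.trans ?_ x.2.1
      simp [Finset.sum_sub_distrib, Finset.sum_add_distrib]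
    · simp only [step_residue]
      refine ⟨idx x (Equiv.swap r (r + 1) s), ?_⟩
      rw [coe_idx, Equiv.swap_apply_self]⟩

variable [Fact (2 ≤ d)]

theorem nbr_apply (x : TilingVertex d) (r : ZMod (d + 1)) (l : Fin (d + 1)) :
    (nbr x r).1 l =
      x.1 l + (if l = idx x r then 1 else 0) - (if l = idx x (r + 1) then 1 else 0) := rfl

theorem coe_nbr (x : TilingVertex d) (r : ZMod (d + 1)) (l : Fin (d + 1)) :
    ((nbr x r).1 l : ZMod (d + 1)) = Equiv.swap r (r + 1) (x.1 l) := step_residue x r l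

theorem idx_nbr (x : TilingVertex d) (r t : ZMod (d + 1)) :
    idx (nbr x r) t = idx x (Equiv.swap r (r + 1) t) := by
  rw [idx_eq_iff, coe_nbr, coe_idx, Equiv.swap_apply_self]

theorem idx_nbr_left (x : TilingVertex d) (r : ZMod (d + 1)) :
    idx (nbr x r) r = idx x (r + 1) := by rw [idx_nbr, Equiv.swap_apply_left]

theorem idx_nbr_right (x : TilingVertex d) (r : ZMod (d + 1)) :
    idx (nbr x r) (r + 1) = idx x r := by rw [idx_nbr, Equiv.swap_apply_right]

theorem idx_nbr_of_ne (x : TilingVertex d) {r t : ZMod (d + 1)} (h : t ≠ r) (h' : t ≠ r + 1) :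
    idx (nbr x r) t = idx x t := by rw [idx_nbr, Equiv.swap_apply_of_ne_of_ne h h']

theorem nbr_nbr (x : TilingVertex d) (r : ZMod (d + 1)) : nbr (nbr x r) r = x := by
  refine tilingVertex_ext fun l => ?_
  rw [nbr_apply, idx_nbr_left, idx_nbr_right, nbr_apply]
  ring

theorem idx_ne (x : TilingVertex d) (r : ZMod (d + 1)) : idx x r ≠ idx x (r + 1) :=
  (idx x).injective.ne (ne_add_one r)

theorem nbr_ne (x : TilingVertex d) (r : ZMod (d + 1)) : nbr x r ≠ x := by
  intro h
  have := congrArg (fun y : TilingVertex d => y.1 (idx x r)) h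
  simp [nbr_apply] at this

theorem nbr_comm (x : TilingVertex d) {r t : ZMod (d + 1)} (hrt : r ≠ t) (h1 : t ≠ r + 1)
    (h2 : r ≠ t + 1) : nbr (nbr x r) t = nbr (nbr x t) r := by
  have h3 : r + 1 ≠ t + 1 := by simpa using hrt
  refine tilingVertex_ext fun l => ?_
  rw [nbr_apply, nbr_apply, nbr_apply, nbr_apply, idx_nbr_of_ne x hrt.symm h1,
    idx_nbr_of_ne x h2.symm h3.symm, idx_nbr_of_ne x hrt h2, idx_nbr_of_ne x h1.symm h3]
  ring

/-- Both sides raise the coordinate of residue `r` by 2, lower the one of residue `r + 2` by 2 and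
leave the one of residue `r + 1` where it was. -/
theorem nbr_braid (x : TilingVertex d) (r : ZMod (d + 1)) :
    nbr (nbr (nbr x r) (r + 1)) r = nbr (nbr (nbr x (r + 1)) r) (r + 1) := by
  refine tilingVertex_ext fun l => ?_
  have e1 : idx (nbr x r) (r + 1 + 1) = idx x (r + 1 + 1) :=
    idx_nbr_of_ne x (add_one_add_one_ne r) (add_one_ne _)
  have e2 : idx (nbr (nbr x r) (r + 1)) r = idx x (r + 1) := by
    rw [idx_nbr_of_ne _ (ne_add_one r) (ne_add_one_add_one r), idx_nbr_left]
  have e3 : idx (nbr (nbr x r) (r + 1)) (r + 1) = idx x (r + 1 + 1) := by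
    rw [idx_nbr_left, e1]
  have e4 : idx (nbr x (r + 1)) r = idx x r :=
    idx_nbr_of_ne _ (ne_add_one r) (ne_add_one_add_one r)
  have e5 : idx (nbr (nbr x (r + 1)) r) (r + 1) = idx x r := by
    rw [idx_nbr_right, e4]
  have e6 : idx (nbr (nbr x (r + 1)) r) (r + 1 + 1) = idx x (r + 1) := by
    rw [idx_nbr_of_ne _ (add_one_add_one_ne r) (add_one_ne _), idx_nbr_right]
  simp only [nbr_apply, e1, e2, e3, e4, e5, e6, idx_nbr_left, idx_nbr_right]
  ring

/-- All residues must still occur in `y`, so the residue that `j` acquires is given up by another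
coordinate, and `i` is the only other one that moves. -/
theorem tilingGraph_adj_iff (x y : TilingVertex d) :
    (tilingGraph d).Adj x y ↔ ∃ r, y = nbr x r := by
  constructor
  · rintro ⟨i, j, hij, h⟩
    have hy : ∀ l, y.1 l = x.1 l + (if l = j then 1 else 0) - (if l = i then 1 else 0) := by
      intro l
      have := congrFun h l
      simp only [Pi.sub_apply, Pi.single_apply] at this
      linarith
    refine ⟨x.1 j, ?_⟩
    have hj : idx x (x.1 j) = j := by rw [idx_eq_iff]
    have hi : idx x (x.1 j + 1) = i := by
      obtain ⟨l, hl⟩ : ∃ l, idx y (x.1 j + 1) = l := ⟨_, rfl⟩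
      rw [idx_eq_iff] at hl ⊢
      have hj' : idx y (x.1 j + 1) = j := by
        rw [idx_eq_iff, hy]; simp [hij.symm]
      by_contra hne
      obtain ⟨m, hm⟩ : ∃ m, idx x (x.1 j + 1) = m := ⟨_, rfl⟩
      have hm' := (idx_eq_iff _ _ _).1 hm
      have hmi : m ≠ i := by rintro rfl; exact hne hm'
      have hmj : m ≠ j := by
        rintro rfl
        exact (add_one_ne _ hm'.symm)
      have : idx y (x.1 j + 1) = m := by
        rw [idx_eq_iff, hy]; simp [hmi, hmj, hm']
      exact hmj (this.symm.trans hj')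
    refine tilingVertex_ext fun l => ?_
    rw [nbr_apply, hi, hj, hy]
  · rintro ⟨r, rfl⟩
    refine ⟨idx x (r + 1), idx x r, (idx_ne x r).symm, ?_⟩
    funext l
    simp only [Pi.sub_apply, Pi.single_apply, nbr_apply]
    ring

/-- Connectedness, by descent on the squared distance to `x₀`. If no step decreases it, the
displacement `x - x₀` never increases from residue `r` to `r + 1`; around the cycle it is then
constant, and it is zero because the coordinate sums agree. -/
theorem nbr_induction {P : TilingVertex d → Prop} (x₀ : TilingVertex d) (h₀ : P x₀)
    (h : ∀ x r, P x → P (nbr x r)) (x : TilingVertex d) : P x := by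
  obtain ⟨N, hN⟩ : ∃ N : ℕ, ∑ i, (x.1 i - x₀.1 i) ^ 2 ≤ (N : ℤ) :=
    ⟨_, Int.self_le_toNat _⟩
  induction N generalizing x with
  | zero =>
    have hz : ∀ i, x.1 i = x₀.1 i := by
      intro i
      have h1 := Finset.single_le_sum (f := fun i => (x.1 i - x₀.1 i) ^ 2)
        (fun i _ => sq_nonneg _) (Finset.mem_univ i)
      have h2 : (x.1 i - x₀.1 i) ^ 2 = 0 :=
        le_antisymm (by simpa using h1.trans hN) (sq_nonneg _)
      have := pow_eq_zero_iff (two_ne_zero) |>.1 h2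
      linarith
    rwa [tilingVertex_ext hz]
  | succ N ih =>
    by_cases hr : ∃ r, x.1 (idx x r) - x₀.1 (idx x r) + 2 ≤
        x.1 (idx x (r + 1)) - x₀.1 (idx x (r + 1))
    · obtain ⟨r, hr⟩ := hr
      rw [← nbr_nbr x r]
      refine h _ _ (ih _ ?_)
      have key : ∀ l, ((nbr x r).1 l - x₀.1 l) ^ 2 = (x.1 l - x₀.1 l) ^ 2 +
          (if l = idx x r then 2 * (x.1 l - x₀.1 l) + 1 else 0) -
          (if l = idx x (r + 1) then 2 * (x.1 l - x₀.1 l) - 1 else 0) := by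
        intro l
        rw [nbr_apply]
        have := idx_ne x r
        split_ifs with h1 h2
        · exact absurd (h1.symm.trans h2) this
        all_goals ring
      rw [Finset.sum_congr rfl fun l _ => key l, Finset.sum_sub_distrib, Finset.sum_add_distrib]
      simp only [Finset.sum_ite_eq', Finset.mem_univ, if_true]
      push_cast at hN
      linarith
    · push Not at hr
      have hmono : ∀ r, x.1 (idx x (r + 1)) - x₀.1 (idx x (r + 1)) ≤
          x.1 (idx x r) - x₀.1 (idx x r) := by
        intro r
        have h1 := hr r
        -- The only increase left is by exactly 1, and it would make two coordinates of `x₀`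
        -- congruent.
        by_contra hlt
        push Not at hlt
        have h2 : x.1 (idx x (r + 1)) - x₀.1 (idx x (r + 1)) =
          x.1 (idx x r) - x₀.1 (idx x r) + 1 := by omega
        have h3 : x₀.1 (idx x (r + 1)) + 1 = x₀.1 (idx x r) + x.1 (idx x (r + 1)) - x.1 (idx x r) := by
          linarith
        have h4 := congrArg (fun m : ℤ => (m : ZMod (d + 1))) h3
        push_cast at h4
        rw [coe_idx, coe_idx] at h4
        have h5 : (x₀.1 (idx x (r + 1)) : ZMod (d + 1)) = x₀.1 (idx x r) := by
          linear_combination h4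
        exact idx_ne x r ((res x₀).injective h5).symm
      have hnat : ∀ (m : ℕ) (r : ZMod (d + 1)), x.1 (idx x (r + m)) - x₀.1 (idx x (r + m)) ≤
          x.1 (idx x r) - x₀.1 (idx x r) := by
        intro m r
        induction m with
        | zero => simp
        | succ m ihm =>
          have := hmono (r + m)
          push_cast
          rw [← add_assoc]
          exact this.trans ihm
      have hle : ∀ i j, x.1 i - x₀.1 i ≤ x.1 j - x₀.1 j := by
        intro i j
        have := hnat (ZMod.val (res x i - res x j)) (res x j)
        rw [ZMod.natCast_zmod_val] at this
        simpa [idx] using this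
      have hc : ∀ i, x.1 i - x₀.1 i = x.1 0 - x₀.1 0 := fun i => le_antisymm (hle _ _) (hle _ _)
      have hsum : ∑ i, (x.1 i - x₀.1 i) = 0 := by
        rw [Finset.sum_sub_distrib, x.2.1, x₀.2.1, sub_self]
      rw [Finset.sum_congr rfl fun i _ => hc i] at hsum
      simp only [Finset.sum_const, Finset.card_univ, Fintype.card_fin, nsmul_eq_mul,
        mul_eq_zero] at hsum
      have h0 : x.1 0 - x₀.1 0 = 0 := hsum.resolve_left (by positivity)
      rwa [tilingVertex_ext (fun i => by have := hc i; linarith : ∀ i, x.1 i = x₀.1 i)]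

/-- Two consecutive steps change a coordinate difference by at most `3`. -/
theorem nbr_nbr_sub_le (x : TilingVertex d) (r t : ZMod (d + 1)) (i j : Fin (d + 1)) :
    (nbr (nbr x r) t).1 i - (nbr (nbr x r) t).1 j ≤ x.1 i - x.1 j + 3 := by
  -- A change by 4 needs `i` raised twice and `j` lowered twice; the first forces `t = r + 1`, the
  -- second `r = t + 1`.
  by_contra hlt
  push Not at hlt
  simp only [nbr_apply] at hlt
  have h1 : i = idx x r := by by_contra hne; simp only [hne, if_false] at hlt; split_ifs at hlt <;> omega
  have h2 : j = idx x (r + 1) := by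
    by_contra hne; simp only [hne, if_false] at hlt; split_ifs at hlt <;> omega
  have h3 : i = idx (nbr x r) t := by
    by_contra hne; simp only [hne, if_false] at hlt; split_ifs at hlt <;> omega
  have h4 : j = idx (nbr x r) (t + 1) := by
    by_contra hne; simp only [hne, if_false] at hlt; split_ifs at hlt <;> omega
  rw [h1, ← idx_nbr_right] at h3
  rw [h2, ← idx_nbr_left] at h4
  have h3' := (idx (nbr x r)).injective h3
  have h4' := (idx (nbr x r)).injective h4
  rw [← h3'] at h4'
  exact add_one_add_one_ne r h4'.symm

theorem nbr_sub_le (x : TilingVertex d) (r : ZMod (d + 1)) (i j : Fin (d + 1)) :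
    (nbr x r).1 i - (nbr x r).1 j ≤ x.1 i - x.1 j + 2 := by
  simp only [nbr_apply]
  split_ifs <;> omega

end Labels

end Heawood

namespace Heawood

/-! ### Short vectors of the sublattice -/

section Sublattice

variable {d : ℕ}

/-- The coefficient vector `b M_k`. -/
def rowComb (k : Fin (d + 1) → ℕ) (b : Fin (d + 1) → ℤ) (i : Fin (d + 1)) : ℤ :=
  ((k i : ℤ) + 1) * b i - k i * b (i - 1)

theorem vecMul_M (k : Fin (d + 1) → ℕ) (b : Fin (d + 1) → ℤ) :
    (M k).vecMulLinear b = rowComb k b := by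
  funext j
  simp only [Matrix.vecMulLinear_apply, Matrix.vecMul, dotProduct, M, Matrix.of_apply, rowComb,
    mul_sub, Finset.sum_sub_distrib]
  have h : ∀ i, j = i + 1 ↔ j - 1 = i := fun i => by rw [sub_eq_iff_eq_add]
  simp only [h, mul_ite, mul_zero, Finset.sum_ite_eq, Finset.mem_univ, if_true]
  ring

theorem mem_sublattice_iff {k : Fin (d + 1) → ℕ} {v : Fin (d + 1) → ℤ} :
    v ∈ sublattice k ↔
      ∃ b, ∀ i, v i = ((d : ℤ) + 1) * rowComb k b i - ∑ j, rowComb k b j := by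
  constructor
  · rintro ⟨a, ⟨b, rfl⟩, rfl⟩
    exact ⟨b, fun i => by rw [linComb_w_apply, vecMul_M]⟩
  · rintro ⟨b, hb⟩
    refine ⟨_, ⟨b, rfl⟩, ?_⟩
    funext i
    rw [linComb_w_apply, vecMul_M, hb]

theorem sublattice_le_lattice (k : Fin (d + 1) → ℕ) : sublattice k ≤ lattice d := by
  rintro v ⟨a, -, rfl⟩
  exact ⟨a, rfl⟩

/-- The rows of `M_k` add up to `(1,…,1)`, the relation among the `w_i`; so `b` matters only up to a
constant. -/
theorem rowComb_const (k : Fin (d + 1) → ℕ) (c : ℤ) (i : Fin (d + 1)) :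
    rowComb k (fun _ => c) i = c := by
  simp only [rowComb]; ring

theorem rowComb_add (k : Fin (d + 1) → ℕ) (b b' : Fin (d + 1) → ℤ) (i : Fin (d + 1)) :
    rowComb k (fun j => b j + b' j) i = rowComb k b i + rowComb k b' i := by
  simp only [rowComb]; ring

theorem fin_cyclic_induction {P : Fin (d + 1) → Prop} (i : Fin (d + 1)) (h : P i)
    (hs : ∀ j, P j → P (j + 1)) (j : Fin (d + 1)) : P j := by
  have hn : ∀ m, P (i + m) := by
    intro m
    induction m using Fin.induction with
    | zero => simpa using h
    | succ m ih =>
      have := hs _ ih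
      rwa [add_assoc, Fin.coeSucc_eq_succ] at this
  simpa using hn (j - i)

/-- A nonconstant cyclic sequence reaches its maximum by an ascent. -/
theorem exists_ascent_to_max (b : Fin (d + 1) → ℤ) (hb : ∃ i j, b i ≠ b j) :
    ∃ i, (∀ l, b l ≤ b i) ∧ b (i - 1) < b i := by
  obtain ⟨i₀, -, hi₀⟩ := Finset.exists_max_image Finset.univ b Finset.univ_nonempty
  by_contra hcon
  push Not at hcon
  have hstep : ∀ j, b (-j) = b i₀ → b (-(j + 1)) = b i₀ := by
    intro j hj
    have h1 := hcon (-j) (fun l => hj ▸ hi₀ l (Finset.mem_univ _))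
    have h2 := hi₀ (-j - 1) (Finset.mem_univ _)
    rw [neg_add', hj] at *
    exact le_antisymm h2 h1
  have hall := fin_cyclic_induction (P := fun j => b (-j) = b i₀) (-i₀) (by rw [neg_neg]) hstep
  obtain ⟨i, j, hij⟩ := hb
  have h1 := hall (-i)
  have h2 := hall (-j)
  rw [neg_neg] at h1 h2
  exact hij (h1.trans h2.symm)

/-- A nonconstant cyclic sequence reaches its minimum by a descent. -/
theorem exists_descent_to_min (b : Fin (d + 1) → ℤ) (hb : ∃ i j, b i ≠ b j) :
    ∃ i, (∀ l, b i ≤ b l) ∧ b i < b (i - 1) := by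
  obtain ⟨i, h1, h2⟩ := exists_ascent_to_max (fun j => -b j)
    (by obtain ⟨i, j, h⟩ := hb; exact ⟨i, j, fun e => h (neg_injective e)⟩)
  exact ⟨i, fun l => neg_le_neg_iff.1 (h1 l), neg_lt_neg_iff.1 h2⟩

theorem eq_zero_of_const {k : Fin (d + 1) → ℕ} {v : Fin (d + 1) → ℤ} {b : Fin (d + 1) → ℤ}
    (hv : ∀ i, v i = ((d : ℤ) + 1) * rowComb k b i - ∑ j, rowComb k b j)
    (hb : ∀ i j, b i = b j) : v = 0 := by
  have hbc : b = fun _ => b 0 := funext fun i => hb i 0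
  funext i
  rw [hv, hbc]
  simp only [rowComb_const]
  simp

/-- The structure of a nonzero vector of the sublattice. -/
theorem exists_spread {k : Fin (d + 1) → ℕ} {v : Fin (d + 1) → ℤ} (hv : v ∈ sublattice k)
    (h0 : v ≠ 0) :
    ∃ b : Fin (d + 1) → ℤ,
      (∀ i, v i = ((d : ℤ) + 1) * rowComb k b i - ∑ j, rowComb k b j) ∧
      ∃ i j, (∀ l, b l ≤ b i) ∧ b (i - 1) < b i ∧ (∀ l, b j ≤ b l) ∧ b j < b (j - 1) := by
  obtain ⟨b, hb⟩ := mem_sublattice_iff.1 hv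
  have hnc : ∃ i j, b i ≠ b j := by
    by_contra hcon
    push Not at hcon
    exact h0 (eq_zero_of_const hb hcon)
  obtain ⟨i, hi, hi'⟩ := exists_ascent_to_max b hnc
  obtain ⟨j, hj, hj'⟩ := exists_descent_to_min b hnc
  exact ⟨b, hb, i, j, hi, hi', hj, hj'⟩

/-- The entry `b_i + k_i (b_i - b_{i-1})` is at least `b_i + 1` at a maximum reached by an ascent,
and at most `b_j - 1` at a minimum reached by a descent. As `b_i - b_j ≥ 1`, the two entries differ
by at least 3. -/
theorem exists_sub_ge {k : Fin (d + 1) → ℕ} (hk : ∀ i, 1 ≤ k i) {v : Fin (d + 1) → ℤ}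
    (hv : v ∈ sublattice k) (h0 : v ≠ 0) : ∃ i j, 3 * ((d : ℤ) + 1) ≤ v i - v j := by
  obtain ⟨b, hb, i, j, hi, hi', hj, hj'⟩ := exists_spread hv h0
  refine ⟨i, j, ?_⟩
  have h3 : 3 ≤ rowComb k b i - rowComb k b j := by
    have hki : (1 : ℤ) ≤ k i := by exact_mod_cast hk i
    have hkj : (1 : ℤ) ≤ k j := by exact_mod_cast hk j
    have := hj i
    have := hi (j - 1)
    simp only [rowComb]
    nlinarith
  rw [hb, hb]
  nlinarith

theorem mem_sublattice_eq_zero {k : Fin (d + 1) → ℕ} (hk : ∀ i, 1 ≤ k i) {v : Fin (d + 1) → ℤ}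
    (hv : v ∈ sublattice k) (h : ∀ i j, v i - v j < 3 * ((d : ℤ) + 1)) : v = 0 := by
  by_contra h0
  obtain ⟨i, j, hij⟩ := exists_sub_ge hk hv h0
  exact absurd (h i j) (not_lt.2 hij)

theorem lattice_cast_eq {v : Fin (d + 1) → ℤ} (hv : v ∈ lattice d) (i j : Fin (d + 1)) :
    (v i : ZMod (d + 1)) = v j := by
  obtain ⟨a, rfl⟩ := hv
  have h0 : ((d : ZMod (d + 1)) + 1) = 0 := by exact_mod_cast ZMod.natCast_self (d + 1)
  rw [linComb_w_apply, linComb_w_apply]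
  push_cast
  rw [h0]
  ring

theorem lattice_sum_eq_zero {v : Fin (d + 1) → ℤ} (hv : v ∈ lattice d) : ∑ i, v i = 0 := by
  obtain ⟨a, rfl⟩ := hv
  simp only [linComb_w_apply, Finset.sum_sub_distrib, ← Finset.mul_sum]
  simp

theorem mem_lattice_iff {v : Fin (d + 1) → ℤ} :
    v ∈ lattice d ↔ ∑ i, v i = 0 ∧ ∀ i, (v i : ZMod (d + 1)) = v 0 := by
  refine ⟨fun hv => ⟨lattice_sum_eq_zero hv, fun i => lattice_cast_eq hv i 0⟩, ?_⟩
  rintro ⟨hs, hc⟩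
  have hdvd : ∀ i, ∃ u, v i - v 0 = ((d : ℤ) + 1) * u := by
    intro i
    have := (ZMod.intCast_eq_intCast_iff_dvd_sub _ _ (d + 1)).1 (hc i).symm
    obtain ⟨u, hu⟩ := this
    exact ⟨u, by rw [hu]; push_cast; ring⟩
  choose u hu using hdvd
  have h1 : ((d : ℤ) + 1) * (v 0 + ∑ i, u i) = 0 := by
    rw [mul_add, Finset.mul_sum, ← Finset.sum_congr rfl fun i _ => hu i, Finset.sum_sub_distrib, hs]
    simp
  have h2 : v 0 + ∑ i, u i = 0 := (mul_eq_zero.1 h1).resolve_left (by positivity)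
  refine ⟨u, ?_⟩
  funext i
  rw [linComb_w_apply]
  linarith [hu i]

end Sublattice

/-! ### Lifting short walks from the quotient -/

section Quotient

variable {d : ℕ} {k : Fin (d + 1) → ℕ}

theorem cls_eq_iff {x y : TilingVertex d} :
    cls k x = cls k y ↔ ∃ v ∈ sublattice k, y.1 = x.1 + v := Quotient.eq

theorem cls_surjective (a : HeawoodVertex k) : ∃ x, cls k x = a := Quotient.exists_rep a

theorem cls_eq_iff_sub {x y : TilingVertex d} :
    cls k x = cls k y ↔ y.1 - x.1 ∈ sublattice k := by
  rw [cls_eq_iff]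
  constructor
  · rintro ⟨v, hv, h⟩
    rwa [h, add_sub_cancel_left]
  · intro h
    exact ⟨_, h, by rw [add_sub_cancel]⟩

variable [Fact (2 ≤ d)]

/-- All coordinates of a lattice vector are congruent, so translation shifts all labels by the same
residue `v 0`. -/
theorem nbr_add {x y : TilingVertex d} {v : Fin (d + 1) → ℤ} (hv : v ∈ lattice d)
    (h : y.1 = x.1 + v) (r : ZMod (d + 1)) : (nbr y (r + v 0)).1 = (nbr x r).1 + v := by
  have hi : ∀ s : ZMod (d + 1), idx y (s + v 0) = idx x s := by
    intro s
    rw [idx_eq_iff, h, Pi.add_apply, Int.cast_add, coe_idx, lattice_cast_eq hv _ 0]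
  funext l
  rw [nbr_apply, Pi.add_apply, nbr_apply, add_right_comm r, hi, hi, h, Pi.add_apply]
  ring

theorem cls_nbr_of_cls_eq {x y : TilingVertex d} (h : cls k x = cls k y) :
    ∃ c : ZMod (d + 1), ∀ r, cls k (nbr x r) = cls k (nbr y (r + c)) := by
  obtain ⟨v, hv, h⟩ := cls_eq_iff.1 h
  exact ⟨v 0, fun r => cls_eq_iff.2 ⟨v, hv, nbr_add (sublattice_le_lattice k hv) h r⟩⟩

/-- The bound 8 is the largest one below `3(d+1) ≥ 9`. It covers closed walks of length four, where
differences change by at most 6. -/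
theorem eq_of_cls_eq (hk : ∀ i, 1 ≤ k i) {x y : TilingVertex d} (h : cls k x = cls k y)
    (hr : ∀ i j, y.1 i - y.1 j ≤ x.1 i - x.1 j + 8) : x = y := by
  have h0 := mem_sublattice_eq_zero hk (cls_eq_iff_sub.1 h) (by
    intro i j
    have h1 := hr i j
    have h2 : (2 : ℤ) ≤ d := by exact_mod_cast Fact.out (p := 2 ≤ d)
    simp only [Pi.sub_apply]
    linarith)
  exact Subtype.ext (sub_eq_zero.1 h0).symm

theorem cls_nbr_ne (hk : ∀ i, 1 ≤ k i) (x : TilingVertex d) (r : ZMod (d + 1)) :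
    cls k (nbr x r) ≠ cls k x := by
  intro h
  refine nbr_ne x r (eq_of_cls_eq hk h.symm fun i j => ?_).symm
  linarith [nbr_sub_le x r i j]

theorem nbr_injective (x : TilingVertex d) : Function.Injective (nbr x) := by
  intro r t h
  by_contra hne
  have := congrArg (fun y : TilingVertex d => y.1 (idx x r)) h
  simp only [nbr_apply, if_true, (idx x).injective.eq_iff, ne_add_one r, if_false, hne] at this
  split_ifs at this <;> omega

theorem cls_nbr_injective (hk : ∀ i, 1 ≤ k i) (x : TilingVertex d) :
    Function.Injective fun r => cls k (nbr x r) := by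
  intro r t h
  refine nbr_injective x (eq_of_cls_eq hk h fun i j => ?_)
  have h1 := nbr_sub_le x t i j
  have h2 := nbr_sub_le (nbr x r) r i j
  rw [nbr_nbr] at h2
  linarith

theorem heawoodGraph_adj_iff (hk : ∀ i, 1 ≤ k i) (x : TilingVertex d) (a : HeawoodVertex k) :
    (heawoodGraph k).Adj (cls k x) a ↔ ∃ r, a = cls k (nbr x r) := by
  constructor
  · rintro ⟨-, y, z, hy, rfl, h⟩
    obtain ⟨r, rfl⟩ := (tilingGraph_adj_iff _ _).1 h
    obtain ⟨c, hc⟩ := cls_nbr_of_cls_eq hy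
    exact ⟨_, hc r⟩
  · rintro ⟨r, rfl⟩
    exact ⟨(cls_nbr_ne hk x r).symm, x, _, rfl, rfl, (tilingGraph_adj_iff _ _).2 ⟨r, rfl⟩⟩

end Quotient

end Heawood

namespace Heawood

/-! ### Squares, hexagons and the relabelling at a vertex -/

section Local

variable {d : ℕ} {k : Fin (d + 1) → ℕ}

/-- The path `a, b, c, e` extends to a closed walk of length six that does not turn back at its
two ends. -/
def Hex (k : Fin (d + 1) → ℕ) (a b c e : HeawoodVertex k) : Prop :=
  ∃ f g, (heawoodGraph k).Adj e f ∧ (heawoodGraph k).Adj f g ∧ (heawoodGraph k).Adj g a ∧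
    f ≠ c ∧ g ≠ b

/-- The neighbours `b`, `c` of `a` have another common neighbour. -/
def Square (k : Fin (d + 1) → ℕ) (a b c : HeawoodVertex k) : Prop :=
  ∃ e, e ≠ a ∧ (heawoodGraph k).Adj b e ∧ (heawoodGraph k).Adj c e

theorem Hex.symm {a b c e : HeawoodVertex k} (h : Hex k a b c e) : Hex k e c b a := by
  obtain ⟨f, g, h1, h2, h3, h4, h5⟩ := h
  exact ⟨g, f, h3.symm, h2.symm, h1.symm, h5, h4⟩

theorem Hex.map (φ : HeawoodAut k) {a b c e : HeawoodVertex k} (h : Hex k a b c e) :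
    Hex k (φ a) (φ b) (φ c) (φ e) := by
  obtain ⟨f, g, h1, h2, h3, h4, h5⟩ := h
  exact ⟨φ f, φ g, φ.map_rel_iff.2 h1, φ.map_rel_iff.2 h2, φ.map_rel_iff.2 h3,
    φ.injective.ne h4, φ.injective.ne h5⟩

theorem hex_map_iff (φ : HeawoodAut k) {a b c e : HeawoodVertex k} :
    Hex k (φ a) (φ b) (φ c) (φ e) ↔ Hex k a b c e :=
  ⟨fun h => by simpa using h.map φ.symm, Hex.map φ⟩

theorem Square.symm {a b c : HeawoodVertex k} (h : Square k a b c) : Square k a c b := by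
  obtain ⟨e, h1, h2, h3⟩ := h
  exact ⟨e, h1, h3, h2⟩

theorem Square.map (φ : HeawoodAut k) {a b c : HeawoodVertex k} (h : Square k a b c) :
    Square k (φ a) (φ b) (φ c) := by
  obtain ⟨e, h1, h2, h3⟩ := h
  exact ⟨φ e, φ.injective.ne h1, φ.map_rel_iff.2 h2, φ.map_rel_iff.2 h3⟩

theorem square_map_iff (φ : HeawoodAut k) {a b c : HeawoodVertex k} :
    Square k (φ a) (φ b) (φ c) ↔ Square k a b c :=
  ⟨fun h => by simpa using h.map φ.symm, Square.map φ⟩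

variable [Fact (2 ≤ d)]

theorem nbr_apply_le (x : TilingVertex d) (r : ZMod (d + 1)) (l : Fin (d + 1)) :
    (nbr x r).1 l ≤ x.1 l + 1 := by
  rw [nbr_apply]; split_ifs <;> omega

theorem le_nbr_apply (x : TilingVertex d) (r : ZMod (d + 1)) (l : Fin (d + 1)) :
    x.1 l - 1 ≤ (nbr x r).1 l := by
  rw [nbr_apply]; split_ifs <;> omega

theorem eq_idx_of_lt (x : TilingVertex d) (r : ZMod (d + 1)) (l : Fin (d + 1))
    (h : x.1 l < (nbr x r).1 l) : l = idx x r := by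
  by_contra hne
  rw [nbr_apply, if_neg hne] at h
  split_ifs at h <;> omega

theorem nbr_apply_idx (x : TilingVertex d) (r : ZMod (d + 1)) :
    (nbr x r).1 (idx x r) = x.1 (idx x r) + 1 := by
  rw [nbr_apply, if_pos rfl, if_neg (idx_ne x r)]; ring

theorem nbr_apply_idx_add_one (x : TilingVertex d) (r : ZMod (d + 1)) :
    (nbr x r).1 (idx x (r + 1)) = x.1 (idx x (r + 1)) - 1 := by
  rw [nbr_apply, if_pos rfl, if_neg (idx_ne x r).symm]; ring

/-- A walk of three steps. -/
noncomputable def walk₃ (x : TilingVertex d) (a b c : ZMod (d + 1)) : TilingVertex d :=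
  nbr (nbr (nbr x a) b) c

/-- Six steps lead from one end to the other; they fall into three pairs, each contributing at most
3 by `nbr_nbr_sub_le`. -/
theorem walk₃_sub_le (x : TilingVertex d) (a b c r s t : ZMod (d + 1)) (i j : Fin (d + 1)) :
    (walk₃ x a b c).1 i - (walk₃ x a b c).1 j ≤ (walk₃ x r s t).1 i - (walk₃ x r s t).1 j + 9 := by
  have h1 := nbr_nbr_sub_le (nbr x a) b c i j
  have h2 := nbr_nbr_sub_le (nbr x r) r a i j
  have h3 := nbr_nbr_sub_le (walk₃ x r s t) t s i j
  rw [nbr_nbr] at h2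
  rw [walk₃, nbr_nbr, nbr_nbr] at h3
  rw [walk₃, walk₃]
  linarith

theorem idx_rise₁ (z : TilingVertex d) (s : ZMod (d + 1)) :
    idx (nbr z s) (s + 1) = idx z s := idx_nbr_right z s

theorem idx_rise₂ (z : TilingVertex d) (s : ZMod (d + 1)) :
    idx (nbr (nbr z s) (s + 1)) (s + 1 + 1) = idx z s := by
  rw [idx_nbr_right, idx_nbr_right]

theorem walk₃_rise (z : TilingVertex d) (s : ZMod (d + 1)) :
    (walk₃ z s (s + 1) (s + 1 + 1)).1 (idx z s) = z.1 (idx z s) + 3 := by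
  have h1 := nbr_apply_idx (nbr (nbr z s) (s + 1)) (s + 1 + 1)
  have h2 := nbr_apply_idx (nbr z s) (s + 1)
  have h3 := nbr_apply_idx z s
  rw [idx_rise₂] at h1
  rw [idx_rise₁] at h2
  rw [walk₃]
  linarith

/-- The labels `s, s + 1, s + 2` raise one coordinate three times. A walk of three steps with the
same end must raise it at every step, in particular at the first. -/
theorem walk₃_unique {z : TilingVertex d} {s a b c : ZMod (d + 1)}
    (h : walk₃ z a b c = walk₃ z s (s + 1) (s + 1 + 1)) : a = s := by
  have h0 := walk₃_rise z s
  rw [← h, walk₃] at h0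
  have h1 := nbr_apply_le (nbr (nbr z a) b) c (idx z s)
  have h2 := nbr_apply_le (nbr z a) b (idx z s)
  exact ((idx z).injective (eq_idx_of_lt z a (idx z s) (by linarith))).symm

/-- Each increment is `1` or `-1`, and a change of sign would give `τ (r + 2) = τ r`. -/
theorem zmod_dihedral {τ : ZMod (d + 1) → ZMod (d + 1)} (hτ : Function.Injective τ)
    (h : ∀ r, τ (r + 1) = τ r + 1 ∨ τ r = τ (r + 1) + 1) :
    ∃ ε c, (ε = 1 ∨ ε = -1) ∧ ∀ r, τ r = ε * r + c := by
  have hstep : ∀ r, τ (r + 1 + 1) - τ (r + 1) = τ (r + 1) - τ r := by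
    intro r
    have hne := hτ.ne (add_one_add_one_ne r)
    rcases h r with h1 | h1 <;> rcases h (r + 1) with h2 | h2
    · rw [h2, h1]; ring
    · exact absurd (add_right_cancel (h2.symm.trans h1)) hne
    · exact absurd (h2.trans h1.symm) hne
    · rw [h1, h2]; ring
  have hnat : ∀ m : ℕ, τ ((m : ZMod (d + 1)) + 1) - τ m = τ 1 - τ 0 := by
    intro m
    induction m with
    | zero => simp
    | succ m ih => push_cast; rw [hstep, ih]
  have hlin : ∀ m : ℕ, τ m = (τ 1 - τ 0) * m + τ 0 := by
    intro m
    induction m with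
    | zero => simp
    | succ m ih => push_cast; linear_combination hnat m + ih
  refine ⟨τ 1 - τ 0, τ 0, ?_, fun r => ?_⟩
  · have := h 0
    rw [zero_add] at this
    rcases this with h1 | h1
    · left; rw [h1]; ring
    · right; rw [h1]; ring
  · have := hlin (ZMod.val r)
    rwa [ZMod.natCast_zmod_val] at this

omit [Fact (2 ≤ d)] in
theorem zmod_dihedral_eq {τ τ' : ZMod (d + 1) → ZMod (d + 1)}
    (h : ∃ ε c, (ε = 1 ∨ ε = -1) ∧ ∀ r, τ r = ε * r + c)
    (h' : ∃ ε c, (ε = 1 ∨ ε = -1) ∧ ∀ r, τ' r = ε * r + c) {r : ZMod (d + 1)} (h0 : τ' r = τ r)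
    (h1 : τ' (r + 1) = τ (r + 1)) : τ' = τ := by
  obtain ⟨ε, c, -, hτ⟩ := h
  obtain ⟨ε', c', -, hτ'⟩ := h'
  rw [hτ, hτ'] at h0 h1
  have he : ε' = ε := by linear_combination h1 - h0
  subst he
  have hc : c' = c := by linear_combination h0
  funext t
  rw [hτ, hτ', hc]

variable (hk : ∀ i, 1 ≤ k i)
include hk

theorem exists_walk₃_of_hex {z : TilingVertex d} {b c e : HeawoodVertex k}
    (h : Hex k (cls k z) b c e) :
    ∃ r s t, cls k (walk₃ z r s t) = e ∧ cls k (nbr z r) ≠ b := by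
  obtain ⟨f, g, h1, h2, h3, -, h5⟩ := h
  obtain ⟨r, rfl⟩ := (heawoodGraph_adj_iff hk z g).1 h3.symm
  obtain ⟨s, rfl⟩ := (heawoodGraph_adj_iff hk _ f).1 h2.symm
  obtain ⟨t, rfl⟩ := (heawoodGraph_adj_iff hk _ e).1 h1.symm
  exact ⟨r, s, t, rfl, h5⟩

/-- A closed walk of length six gives a second three-step walk with the same end class. If it ends
at the same tiling vertex, `walk₃_unique` makes it start with `s`, that is, turn back. -/
theorem not_hex_of_lift {z : TilingVertex d} {s : ZMod (d + 1)}
    (H : ∀ a b c, cls k (walk₃ z a b c) = cls k (walk₃ z s (s + 1) (s + 1 + 1)) →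
      walk₃ z a b c = walk₃ z s (s + 1) (s + 1 + 1)) :
    ¬ Hex k (cls k z) (cls k (nbr z s)) (cls k (nbr (nbr z s) (s + 1)))
      (cls k (walk₃ z s (s + 1) (s + 1 + 1))) := by
  intro h
  obtain ⟨a, b, c, h1, h2⟩ := exists_walk₃_of_hex hk h
  rw [walk₃_unique (H a b c h1)] at h2
  exact h2 rfl

theorem adj_cls_nbr (x : TilingVertex d) (r : ZMod (d + 1)) :
    (heawoodGraph k).Adj (cls k x) (cls k (nbr x r)) :=
  (heawoodGraph_adj_iff hk x _).2 ⟨r, rfl⟩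

theorem adj_nbr_cls (x : TilingVertex d) (r : ZMod (d + 1)) :
    (heawoodGraph k).Adj (cls k (nbr x r)) (cls k x) := (adj_cls_nbr hk x r).symm

theorem cls_nbr_nbr_ne (x : TilingVertex d) {r t : ZMod (d + 1)} (h : t ≠ r) :
    cls k (nbr (nbr x r) t) ≠ cls k x := by
  intro e
  have := cls_nbr_injective hk (nbr x r) (a₁ := t) (a₂ := r) (by simpa only [nbr_nbr] using e)
  exact h this

theorem hex_braid (x : TilingVertex d) {r t : ZMod (d + 1)} (h : t = r + 1 ∨ r = t + 1) :
    Hex k (cls k (nbr x t)) (cls k x) (cls k (nbr x r)) (cls k (nbr (nbr x r) t)) := by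
  have hb : nbr (nbr (nbr x r) t) r = nbr (nbr (nbr x t) r) t := by
    rcases h with rfl | rfl
    · exact nbr_braid x r
    · exact (nbr_braid x t).symm
  have hne : r ≠ t := by
    rcases h with rfl | rfl
    · exact ne_add_one r
    · exact add_one_ne t
  refine ⟨cls k (nbr (nbr (nbr x r) t) r), cls k (nbr (nbr x t) r), adj_cls_nbr hk _ _, ?_,
    adj_nbr_cls hk _ _, cls_nbr_nbr_ne hk _ hne, cls_nbr_nbr_ne hk _ hne⟩
  rw [hb]
  exact adj_nbr_cls hk _ _

/-- Commuting labels span a square. The step `r` lowers the coordinate of residue `r + 1` and the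
step `r + 1` raises it. To reach a common vertex, the step after `r` has to raise it again, and this
leads back to `x`. -/
theorem square_iff (x : TilingVertex d) {r t : ZMod (d + 1)} (hrt : r ≠ t) :
    Square k (cls k x) (cls k (nbr x r)) (cls k (nbr x t)) ↔ t ≠ r + 1 ∧ r ≠ t + 1 := by
  have key : ∀ r : ZMod (d + 1),
      ¬ Square k (cls k x) (cls k (nbr x r)) (cls k (nbr x (r + 1))) := by
    rintro r ⟨e, h1, h2, h3⟩
    obtain ⟨a, rfl⟩ := (heawoodGraph_adj_iff hk _ _).1 h2
    obtain ⟨b, hb⟩ := (heawoodGraph_adj_iff hk _ _).1 h3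
    have heq : nbr (nbr x r) a = nbr (nbr x (r + 1)) b := by
      refine eq_of_cls_eq hk hb fun i j => ?_
      have h4 := nbr_nbr_sub_le x (r + 1) b i j
      have h5 := nbr_nbr_sub_le (nbr (nbr x r) a) a r i j
      rw [nbr_nbr, nbr_nbr] at h5
      linarith
    have h4 := nbr_apply_idx_add_one x r
    have h5 := nbr_apply_idx x (r + 1)
    have h6 := le_nbr_apply (nbr x (r + 1)) b (idx x (r + 1))
    rw [← heq] at h6
    have h7 := eq_idx_of_lt (nbr x r) a (idx x (r + 1)) (by linarith)
    rw [← idx_nbr_left] at h7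
    rw [← (idx (nbr x r)).injective h7, nbr_nbr] at h1
    exact h1 rfl
  constructor
  · intro h
    constructor
    · rintro rfl
      exact key r h
    · rintro rfl
      exact key t h.symm
  · rintro ⟨h1, h2⟩
    refine ⟨cls k (nbr (nbr x r) t), cls_nbr_nbr_ne hk x hrt.symm, adj_cls_nbr hk _ _, ?_⟩
    rw [nbr_comm x hrt h1 h2]
    exact adj_cls_nbr hk _ _

omit hk

/-- `φ` maps the class of `x` to that of `y`, and the neighbours of `x` to those of `y` according to
the relabelling `τ`. -/
def Local (φ : HeawoodAut k) (x y : TilingVertex d) (τ : ZMod (d + 1) → ZMod (d + 1)) : Prop :=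
  φ (cls k x) = cls k y ∧ ∀ r, φ (cls k (nbr x r)) = cls k (nbr y (τ r))

variable {φ : HeawoodAut k} {x y : TilingVertex d} {τ τ' : ZMod (d + 1) → ZMod (d + 1)}

include hk

theorem exists_local (h : φ (cls k x) = cls k y) : ∃ τ, Local φ x y τ := by
  have : ∀ r, ∃ t, φ (cls k (nbr x r)) = cls k (nbr y t) := fun r =>
    (heawoodGraph_adj_iff hk y _).1 (h ▸ φ.map_rel_iff.2 (adj_cls_nbr hk x r))
  choose τ hτ using this
  exact ⟨τ, h, hτ⟩

theorem Local.injective (h : Local φ x y τ) : Function.Injective τ := by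
  intro r t hrt
  refine cls_nbr_injective hk x (φ.injective ?_)
  change φ _ = φ _
  rw [h.2, h.2, hrt]

theorem Local.exists_nbr (h : Local φ x y τ) (r : ZMod (d + 1)) :
    ∃ τ', Local φ (nbr x r) (nbr y (τ r)) τ' := exists_local hk (h.2 r)

theorem Local.nbr_apply (h : Local φ x y τ) {r : ZMod (d + 1)}
    (h' : Local φ (nbr x r) (nbr y (τ r)) τ') : τ' r = τ r := by
  have h1 := h'.2 r
  rw [nbr_nbr, h.1] at h1
  refine cls_nbr_injective hk (nbr y (τ r)) ?_
  change cls k _ = cls k _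
  rw [← h1, nbr_nbr]

/-- For `d ≥ 3`, `Square` tells neighbouring labels from commuting ones. For `d = 2` any two
distinct labels are neighbours, so injectivity suffices. -/
theorem Local.dihedral (h : Local φ x y τ) :
    ∃ ε c, (ε = 1 ∨ ε = -1) ∧ ∀ r, τ r = ε * r + c := by
  refine zmod_dihedral (h.injective hk) fun r => ?_
  by_cases hd : d = 2
  · subst hd
    have := (h.injective hk).ne (add_one_ne r)
    revert this
    generalize τ (r + 1) = a
    generalize τ r = b
    revert a b
    decide
  · have h1 := square_iff hk x (ne_add_one r)
    have h2 := square_iff hk y ((h.injective hk).ne (ne_add_one r))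
    rw [← square_map_iff φ, h.1, h.2, h.2, h2] at h1
    tauto

omit hk

/-- No nonzero vector of the sublattice is as short as a closed walk of length six. -/
def SixRigid (k : Fin (d + 1) → ℕ) : Prop :=
  ∀ v ∈ sublattice k, (∀ i j, v i - v j ≤ 9) → v = 0

include hk

theorem not_hex_of_sixRigid (H : SixRigid k) (z : TilingVertex d) (s : ZMod (d + 1)) :
    ¬ Hex k (cls k z) (cls k (nbr z s)) (cls k (nbr (nbr z s) (s + 1)))
      (cls k (walk₃ z s (s + 1) (s + 1 + 1))) := by
  refine not_hex_of_lift hk fun a b c h => ?_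
  have h0 := H _ (cls_eq_iff_sub.1 h) fun i j => by
    have := walk₃_sub_le z s (s + 1) (s + 1 + 1) a b c i j
    simp only [Pi.sub_apply]
    linarith
  exact Subtype.ext (sub_eq_zero.1 h0).symm

/-- If `t' ≠ t`, then `t, r, t'` are three successive labels in increasing or decreasing order, and
such a path lies on no hexagon. -/
theorem eq_of_hex_of_sixRigid (H : SixRigid k) (x : TilingVertex d) {r t t' : ZMod (d + 1)}
    (ht : t = r + 1 ∨ r = t + 1) (ht' : t' = r + 1 ∨ r = t' + 1)
    (h : Hex k (cls k (nbr x t)) (cls k x) (cls k (nbr x r)) (cls k (nbr (nbr x r) t'))) :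
    t' = t := by
  by_contra hne
  rcases ht with rfl | rfl <;> rcases ht' with rfl | h2
  · exact hne rfl
  · subst h2
    have := not_hex_of_sixRigid hk H (nbr (nbr x (t' + 1)) t') t'
    rw [walk₃, nbr_nbr, nbr_nbr] at this
    exact this h.symm
  · have := not_hex_of_sixRigid hk H (nbr x t) t
    rw [walk₃, nbr_nbr] at this
    exact this h
  · exact hne (add_right_cancel h2.symm)

/-- The edge has the same label from both ends, so the two relabellings agree at `r`. The image of
the braid hexagon of `r` and `r + 1` makes them agree at `r + 1`, which suffices for maps `±r + c`.
-/
theorem Local.const_of_sixRigid (H : SixRigid k) (h : Local φ x y τ) {r : ZMod (d + 1)}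
    (h' : Local φ (nbr x r) (nbr y (τ r)) τ') : τ' = τ := by
  have h0 := h.nbr_apply hk h'
  refine zmod_dihedral_eq (h.dihedral hk) (h'.dihedral hk) h0 ?_
  have hx := (hex_braid hk x (r := r) (t := r + 1) (Or.inl rfl)).map φ
  rw [h.1, h.2, h.2, h'.2] at hx
  have hadj : ∀ {σ : ZMod (d + 1) → ZMod (d + 1)},
      (∃ ε c, (ε = 1 ∨ ε = -1) ∧ ∀ r, σ r = ε * r + c) →
      σ (r + 1) = σ r + 1 ∨ σ r = σ (r + 1) + 1 := by
    rintro σ ⟨ε, c, rfl | rfl, hσ⟩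
    · left; rw [hσ, hσ]; ring
    · right; rw [hσ, hσ]; ring
  refine eq_of_hex_of_sixRigid hk H y (hadj (h.dihedral hk)) ?_ hx
  rw [← h0]
  exact hadj (h'.dihedral hk)

end Local

end Heawood

namespace Heawood

/-! ### The exceptional case: dimension two with two of the `k_i` equal to 1 -/

section Planar

instance fact_two_le_two : Fact (2 ≤ 2) := ⟨le_rfl⟩

variable {k : Fin (2 + 1) → ℕ}

theorem fin_three_cases (A i : Fin (2 + 1)) : i = A ∨ i = A + 1 ∨ i = A + 1 + 1 := by
  revert A i; decide

/-- The translation vector of the relation `2 w_A = w_{A+1}`, which holds when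
`k_A = k_{A+1} = 1`. -/
def shortVec (A : Fin (2 + 1)) : Fin (2 + 1) → ℤ :=
  fun i => if i = A then 5 else if i = A + 1 then -4 else -1

/-- Here `b` is a constant plus the indicator of `A`, so the coefficient vector is row `A` of `M_k`,
namely `2` at `A` and `-1` at `A + 1`, up to a constant. -/
theorem shortVec_eq_of_ascent {A : Fin (2 + 1)} (h0 : k A = 1) (h1 : k (A + 1) = 1)
    {b : Fin (2 + 1) → ℤ} (hb1 : b (A + 1) = b A - 1) (hb2 : b (A + 1 + 1) = b A - 1)
    (i : Fin (2 + 1)) :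
    (((2 : ℕ) : ℤ) + 1) * rowComb k b i - ∑ j, rowComb k b j = shortVec A i := by
  have e0 : A - 1 = A + 1 + 1 := by clear * - A; revert A; decide
  have e2 : A + 1 + 1 + 1 = A := by clear * - A; revert A; decide
  have hs : ∑ j, rowComb k b j =
      rowComb k b A + rowComb k b (A + 1) + rowComb k b (A + 1 + 1) := by
    rw [Fin.sum_univ_three]
    rcases fin_three_cases 0 A with rfl | rfl | rfl <;> simp only [Fin.isValue, zero_add]
    · rw [show (1 + 1 : Fin 3) = 2 from rfl]
    · rw [show (1 + 1 : Fin 3) = 2 from rfl, show (2 + 1 : Fin 3) = 0 from rfl]; ring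
    · rw [show (1 + 1 : Fin 3) = 2 from rfl, show (2 + 1 : Fin 3) = 0 from rfl,
        show (0 + 1 : Fin 3) = 1 from rfl]; ring
  have hA : rowComb k b A = b A + 1 := by
    simp only [rowComb, e0, hb2, h0]; push_cast; ring
  have hB : rowComb k b (A + 1) = b A - 2 := by
    simp only [rowComb, add_sub_cancel_right, hb1, h1]; push_cast; ring
  have hC : rowComb k b (A + 1 + 1) = b A - 1 := by
    simp only [rowComb, add_sub_cancel_right, hb1, hb2]; ring
  have d1 : A + 1 ≠ A := by clear * - A; revert A; decide
  have d2 : A + 1 + 1 ≠ A := by clear * - A; revert A; decide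
  have d3 : A + 1 + 1 ≠ A + 1 := by clear * - A; revert A; decide
  rw [hs, hA, hB, hC]
  rcases fin_three_cases A i with rfl | rfl | rfl
  · rw [hA, shortVec, if_pos rfl]; push_cast; ring
  · rw [hB, shortVec, if_neg d1, if_pos rfl]; push_cast; ring
  · rw [hC, shortVec, if_neg d2, if_neg d3]; push_cast; ring

theorem shortVec_mem {A : Fin (2 + 1)} (h0 : k A = 1) (h1 : k (A + 1) = 1) :
    shortVec A ∈ sublattice k := by
  have d1 : A + 1 ≠ A := by clear * - A; revert A; decide
  have d2 : A + 1 + 1 ≠ A := by clear * - A; revert A; decide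
  exact mem_sublattice_iff.2 ⟨Pi.single A 1, fun i =>
    (shortVec_eq_of_ascent h0 h1 (by simp [d1]) (by simp [d2]) i).symm⟩

/-- This is the equality case `9 = 3(d+1)` of `exists_sub_ge`: all jumps are 1 and `k` is 1 at both
extrema. On three indices, `b` then has a single peak or a single dip, which gives the two signs. -/
theorem eq_shortVec_of_short (hk : ∀ i, 1 ≤ k i) {v : Fin (2 + 1) → ℤ} (hv : v ∈ sublattice k)
    (hs : ∀ i j, v i - v j ≤ 9) (h0 : v ≠ 0) :
    ∃ A, k A = 1 ∧ k (A + 1) = 1 ∧ (v = shortVec A ∨ v = -shortVec A) := by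
  obtain ⟨b, hb, i, j, hi, hi', hj, hj'⟩ := exists_spread hv h0
  have h1 := hs i j
  rw [hb, hb] at h1
  simp only [rowComb] at h1
  have hki : (1 : ℤ) ≤ k i := by exact_mod_cast hk i
  have hkj : (1 : ℤ) ≤ k j := by exact_mod_cast hk j
  have hM := hi (j - 1)
  have hp1 : 0 ≤ ((k i : ℤ) - 1) * (b i - b (i - 1)) :=
    mul_nonneg (by linarith) (by linarith)
  have hp2 : 0 ≤ ((k j : ℤ) - 1) * (b (j - 1) - b j) :=
    mul_nonneg (by linarith) (by linarith)
  push_cast at h1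
  have e1 : b i - b (i - 1) = 1 := by nlinarith
  have e2 : b (j - 1) - b j = 1 := by nlinarith
  have e3 : b i - b j = 1 := by nlinarith
  have e4 : (k i : ℤ) = 1 := by nlinarith
  have e5 : (k j : ℤ) = 1 := by nlinarith
  have e4' : k i = 1 := by exact_mod_cast e4
  have e5' : k j = 1 := by exact_mod_cast e5
  have a0 : ∀ A : Fin (2 + 1), A - 1 = A + 1 + 1 := by decide
  have a1 : ∀ A : Fin (2 + 1), A + 1 + 1 - 1 = A + 1 := by decide
  have a2 : ∀ A : Fin (2 + 1), A + 1 + 1 + 1 = A := by decide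
  rcases fin_three_cases i j with rfl | rfl | rfl
  · omega
  · refine ⟨i, e4', e5', Or.inl (funext fun l => ?_)⟩
    rw [hb]
    rw [a0] at e1
    exact shortVec_eq_of_ascent e4' e5' (by linarith) (by linarith) l
  · refine ⟨i + 1 + 1, e5', by rw [a2]; exact e4', Or.inr (funext fun l => ?_)⟩
    have hneg := shortVec_eq_of_ascent (b := fun l => -b l) e5' (by rw [a2]; exact e4')
      (by rw [a2]; linarith) (by rw [a2]; rw [a1] at e2; linarith) l
    have hrow : ∀ l, rowComb k (fun l => -b l) l = -rowComb k b l := by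
      intro l; simp only [rowComb]; ring
    simp only [hrow, Finset.sum_neg_distrib] at hneg
    rw [hb, Pi.neg_apply, ← hneg]
    ring

theorem eq_shortVec_of_exceptional (hk : ∀ i, 1 ≤ k i) {A : Fin (2 + 1)} (h2 : k (A + 1 + 1) ≠ 1)
    {v : Fin (2 + 1) → ℤ} (hv : v ∈ sublattice k) (hs : ∀ i j, v i - v j ≤ 9) :
    v = 0 ∨ v = shortVec A ∨ v = -shortVec A := by
  by_cases h0 : v = 0
  · exact Or.inl h0
  · obtain ⟨B, hB, hB', h⟩ := eq_shortVec_of_short hk hv hs h0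
    right
    rcases fin_three_cases A B with rfl | rfl | rfl
    · exact h
    · exact absurd hB' h2
    · exact absurd hB h2

/-- The change of the coordinate `idx z t` along the walk from `z` with labels `a`, `b`, `c`. -/
def walkChange (a b c t : ZMod (2 + 1)) : ℤ :=
  (if t = a then 1 else 0) - (if t = a + 1 then 1 else 0) +
  ((if t = Equiv.swap a (a + 1) b then 1 else 0) -
    (if t = Equiv.swap a (a + 1) (b + 1) then 1 else 0)) +
  ((if t = Equiv.swap a (a + 1) (Equiv.swap b (b + 1) c) then 1 else 0) -
    (if t = Equiv.swap a (a + 1) (Equiv.swap b (b + 1) (c + 1)) then 1 else 0))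

theorem walk₃_apply_idx (z : TilingVertex 2) (a b c t : ZMod (2 + 1)) :
    (walk₃ z a b c).1 (idx z t) = z.1 (idx z t) + walkChange a b c t := by
  simp only [walk₃, nbr_apply, idx_nbr, (idx z).injective.eq_iff, walkChange]
  ring

theorem walk₃_sub (z : TilingVertex 2) (a b c a' b' c' : ZMod (2 + 1)) (t : ZMod (2 + 1)) :
    (walk₃ z a' b' c').1 (idx z t) - (walk₃ z a b c).1 (idx z t) =
      walkChange a' b' c' t - walkChange a b c t := by
  rw [walk₃_apply_idx, walk₃_apply_idx]; ring

/-- A second walk from `z` whose end is a translate of the first end closes up in the quotient. The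
shift by `v 0` in the last condition appears because translation by `v` shifts labels. -/
theorem hex_of_walk (hk : ∀ i, 1 ≤ k i) {z : TilingVertex 2} {s a b c : ZMod (2 + 1)}
    {v : Fin (2 + 1) → ℤ} (hv : v ∈ sublattice k)
    (h : ∀ t, walkChange s (s + 1) (s + 1 + 1) t - walkChange a b c t = v (idx z t))
    (ha : a ≠ s) (hc : c + v 0 ≠ s + 1 + 1) :
    Hex k (cls k z) (cls k (nbr z s)) (cls k (nbr (nbr z s) (s + 1)))
      (cls k (walk₃ z s (s + 1) (s + 1 + 1))) := by
  have hw : (walk₃ z s (s + 1) (s + 1 + 1)).1 = (walk₃ z a b c).1 + v := by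
    funext i
    obtain ⟨t, rfl⟩ := (idx z).surjective i
    rw [Pi.add_apply, ← h, ← walk₃_sub]
    ring
  have hcls : cls k (walk₃ z s (s + 1) (s + 1 + 1)) = cls k (walk₃ z a b c) :=
    (cls_eq_iff.2 ⟨v, hv, hw⟩).symm
  refine ⟨cls k (nbr (nbr z a) b), cls k (nbr z a), ?_, adj_nbr_cls hk _ _, adj_nbr_cls hk _ _, ?_,
    fun e => ha (cls_nbr_injective hk z e)⟩
  · rw [hcls]
    exact adj_nbr_cls hk _ _
  · intro e
    have h1 : cls k (nbr (walk₃ z a b c) c) = cls k (nbr (walk₃ z s (s + 1) (s + 1 + 1)) (c + v 0)) :=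
      cls_eq_iff.2 ⟨v, hv, nbr_add (sublattice_le_lattice k hv) hw c⟩
    rw [walk₃, nbr_nbr, e] at h1
    refine hc (cls_nbr_injective hk (walk₃ z s (s + 1) (s + 1 + 1)) ?_)
    change cls k _ = cls k _
    rw [← h1, walk₃, nbr_nbr]

/-- For `k_A = k_{A+1} = 1`: the third index of the edges closing up with an edge of third index
`q` at both ends to a path on no closed walk of length six. -/
def wing (A q : Fin (2 + 1)) : Fin (2 + 1) := if q = A then A + 1 else A

theorem zmod_three_cases (s t : ZMod (2 + 1)) : t = s ∨ t = s + 1 ∨ t = s + 1 + 1 := by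
  revert s t; decide

/-- The walk `s, s + 1, s + 2` changes the coordinates `P, Q, S` of residues `s, s + 1, s + 2` by
`3, -2, -1`. A competing walk moves each coordinate by at most 3, and its end has to differ by `5,
-4, -1` at `A, A + 1, A + 2` or by the negative. This fits exactly three of the six arrangements of
`P, Q, S`. -/
theorem hex_iff_of_exceptional (hk : ∀ i, 1 ≤ k i) {A : Fin (2 + 1)} (h0 : k A = 1)
    (h1 : k (A + 1) = 1) (h2 : k (A + 1 + 1) ≠ 1) (z : TilingVertex 2) (s : ZMod (2 + 1)) :
    Hex k (cls k z) (cls k (nbr z s)) (cls k (nbr (nbr z s) (s + 1)))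
      (cls k (walk₃ z s (s + 1) (s + 1 + 1))) ↔ idx z (s + 1 + 1) ≠ wing A (idx z (s + 1)) := by
  have hv := shortVec_mem h0 h1
  have hPQ : idx z s ≠ idx z (s + 1) := (idx z).injective.ne (by clear * - s; revert s; decide)
  have hQS : idx z (s + 1) ≠ idx z (s + 1 + 1) := (idx z).injective.ne (by clear * - s; revert s; decide)
  have hPS : idx z s ≠ idx z (s + 1 + 1) := (idx z).injective.ne (by clear * - s; revert s; decide)
  have htbl : ∀ A P Q S : Fin (2 + 1), P ≠ Q → Q ≠ S → P ≠ S → S ≠ wing A Q →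
      (P = A ∧ Q = A + 1 ∧ S = A + 1 + 1) ∨ (P = A ∧ Q = A + 1 + 1 ∧ S = A + 1) ∨
        (P = A + 1 ∧ Q = A ∧ S = A + 1 + 1) := by decide
  have htbl' : ∀ A P Q S : Fin (2 + 1), P ≠ Q → Q ≠ S → P ≠ S → S = wing A Q →
      (P = A + 1 ∧ Q = A + 1 + 1 ∧ S = A) ∨ (P = A + 1 + 1 ∧ Q = A ∧ S = A + 1) ∨
        (P = A + 1 + 1 ∧ Q = A + 1 ∧ S = A) := by decide
  have sA : ∀ A, shortVec A A = 5 := by decide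
  have sB : ∀ A, shortVec A (A + 1) = -4 := by decide
  have sC : ∀ A, shortVec A (A + 1 + 1) = -1 := by decide
  have s0 : ∀ A, ((shortVec A 0 : ℤ) : ZMod (2 + 1)) = 2 := by decide
  constructor
  · intro h hS
    refine not_hex_of_lift hk (fun a b c hc => ?_) h
    have hw : ∀ l, (walk₃ z a b c).1 l ≤ z.1 l + 3 ∧ z.1 l - 3 ≤ (walk₃ z a b c).1 l := by
      intro l
      have b1 := nbr_apply_le z a l
      have b2 := nbr_apply_le (nbr z a) b l
      have b3 := nbr_apply_le (nbr (nbr z a) b) c l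
      have c1 := le_nbr_apply z a l
      have c2 := le_nbr_apply (nbr z a) b l
      have c3 := le_nbr_apply (nbr (nbr z a) b) c l
      rw [walk₃]
      constructor <;> linarith
    have eP := walk₃_apply_idx z s (s + 1) (s + 1 + 1) s
    have eQ := walk₃_apply_idx z s (s + 1) (s + 1 + 1) (s + 1)
    have eS := walk₃_apply_idx z s (s + 1) (s + 1 + 1) (s + 1 + 1)
    rw [show walkChange s (s + 1) (s + 1 + 1) s = 3 by clear * - s; revert s; decide] at eP
    rw [show walkChange s (s + 1) (s + 1 + 1) (s + 1) = -2 by clear * - s; revert s; decide] at eQ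
    rw [show walkChange s (s + 1) (s + 1 + 1) (s + 1 + 1) = -1 by clear * - s; revert s; decide] at eS
    have hwP := hw (idx z s)
    have hwQ := hw (idx z (s + 1))
    have hwS := hw (idx z (s + 1 + 1))
    rcases eq_shortVec_of_exceptional hk h2 (cls_eq_iff_sub.1 hc) (fun i j => by
      have := walk₃_sub_le z s (s + 1) (s + 1 + 1) a b c i j
      simp only [Pi.sub_apply]
      linarith) with hz | hz | hz
    · exact Subtype.ext (sub_eq_zero.1 hz).symm
    all_goals
      exfalso
      have kP := congrFun hz (idx z s)
      have kQ := congrFun hz (idx z (s + 1))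
      have kS := congrFun hz (idx z (s + 1 + 1))
      simp only [Pi.sub_apply, Pi.neg_apply] at kP kQ kS
      rcases htbl' A _ _ _ hPQ hQS hPS hS with ⟨p1, p2, p3⟩ | ⟨p1, p2, p3⟩ | ⟨p1, p2, p3⟩ <;>
      · rw [p1] at kP hwP eP
        rw [p2] at kQ hwQ eQ
        rw [p3] at kS hwS eS
        simp only [sA, sB, sC] at kP kQ kS
        omega
  · intro hS
    -- The competing walks change `P, Q, S` by `(3, -2, -1)` minus the translation, that is by `(-2,
    -- 2, 0)`, `(-2, -1, 3)` and `(-1, 3, -2)`.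
    rcases htbl A _ _ _ hPQ hQS hPS hS with ⟨p1, p2, p3⟩ | ⟨p1, p2, p3⟩ | ⟨p1, p2, p3⟩
    · refine hex_of_walk hk (a := s + 1 + 1) (b := s + 1) (c := s + 1 + 1) hv ?_
        (by clear * - s; revert s; decide) (by rw [s0]; clear * - s; revert s; decide)
      intro t
      rcases zmod_three_cases s t with rfl | rfl | rfl
      · rw [p1, sA]; clear * - t; revert t; decide
      · rw [p2, sB]; clear * - s; revert s; decide
      · rw [p3, sC]; clear * - s; revert s; decide
    · refine hex_of_walk hk (a := s + 1 + 1) (b := s) (c := s + 1) hv ?_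
        (by clear * - s; revert s; decide) (by rw [s0]; clear * - s; revert s; decide)
      intro t
      rcases zmod_three_cases s t with rfl | rfl | rfl
      · rw [p1, sA]; clear * - t; revert t; decide
      · rw [p2, sC]; clear * - s; revert s; decide
      · rw [p3, sB]; clear * - s; revert s; decide
    · refine hex_of_walk hk (a := s + 1) (b := s + 1 + 1) (c := s) (neg_mem hv) ?_
        (by clear * - s; revert s; decide) (by
          rw [Pi.neg_apply, Int.cast_neg, s0]; clear * - s; revert s; decide)
      intro t
      rw [Pi.neg_apply]
      rcases zmod_three_cases s t with rfl | rfl | rfl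
      · rw [p1, sB]; change _ = (4 : ℤ); clear * - t; revert t; decide
      · rw [p2, sA]; change _ = (-5 : ℤ); clear * - s; revert s; decide
      · rw [p3, sC]; change _ = (1 : ℤ); clear * - s; revert s; decide

/-- The path `a, b, c` has an extension which is not on a closed walk of length six. -/
def Bad (k : Fin (2 + 1) → ℕ) (a b c : HeawoodVertex k) : Prop :=
  ∃ e, (heawoodGraph k).Adj c e ∧ e ≠ b ∧ ¬ Hex k a b c e

theorem Bad.map (φ : HeawoodAut k) {a b c : HeawoodVertex k} (h : Bad k a b c) :
    Bad k (φ a) (φ b) (φ c) := by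
  obtain ⟨e, h1, h2, h3⟩ := h
  exact ⟨φ e, φ.map_rel_iff.2 h1, φ.injective.ne h2, by rwa [hex_map_iff]⟩

theorem bad_map_iff (φ : HeawoodAut k) {a b c : HeawoodVertex k} :
    Bad k (φ a) (φ b) (φ c) ↔ Bad k a b c :=
  ⟨fun h => by simpa using h.map φ.symm, Bad.map φ⟩

/-- Going on by `t` closes a braid hexagon and going on by `r` turns back, so only the third label
`u` matters. The labels `t, r, u` are successive, and the coordinates fixed by the edges `t` and `r`
are those of residues `t + 2` and `r + 2`. -/
theorem bad_iff_of_exceptional (hk : ∀ i, 1 ≤ k i) {A : Fin (2 + 1)} (h0 : k A = 1)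
    (h1 : k (A + 1) = 1) (h2 : k (A + 1 + 1) ≠ 1) (x : TilingVertex 2) {r t : ZMod (2 + 1)}
    (hrt : r ≠ t) :
    Bad k (cls k (nbr x t)) (cls k x) (cls k (nbr x r)) ↔
      idx x (t + 1 + 1) = wing A (idx x (r + 1 + 1)) := by
  obtain ⟨u, hur, hut⟩ : ∃ u : ZMod (2 + 1), u ≠ r ∧ u ≠ t := by clear * - hrt; revert r t; decide
  have key : ¬ Hex k (cls k (nbr x t)) (cls k x) (cls k (nbr x r)) (cls k (nbr (nbr x r) u)) ↔
      idx x (t + 1 + 1) = wing A (idx x (r + 1 + 1)) := by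
    have c3 : ∀ s : ZMod (2 + 1), s + 1 + 1 + 1 = s := by decide
    have htr : (r = t + 1 ∧ u = t + 1 + 1) ∨ (t = r + 1 ∧ u = r + 1 + 1) := by
      clear * - hrt hur hut; revert r t u; decide
    rcases htr with ⟨rfl, rfl⟩ | ⟨rfl, rfl⟩
    · have := hex_iff_of_exceptional hk h0 h1 h2 (nbr x t) t
      rw [walk₃, nbr_nbr, idx_nbr_right, idx_nbr_of_ne x (add_one_add_one_ne t) (add_one_ne _)]
        at this
      rw [this, not_not, c3]
    · have := hex_iff_of_exceptional hk h0 h1 h2 (nbr (nbr x r) (r + 1 + 1)) (r + 1 + 1)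
      have h4 : r ≠ r + 1 + 1 := ne_add_one_add_one r
      rw [walk₃, nbr_nbr, c3, nbr_nbr] at this
      have e1 : idx (nbr (nbr x r) (r + 1 + 1)) r = idx x (r + 1 + 1) := by
        have := idx_nbr_right (nbr x r) (r + 1 + 1)
        rw [c3] at this
        rw [this, idx_nbr_of_ne x (add_one_add_one_ne r) (add_one_ne _)]
      have e2 : idx (nbr (nbr x r) (r + 1 + 1)) (r + 1) = idx x r := by
        rw [idx_nbr_of_ne (nbr x r) (ne_add_one (r + 1)) (by rw [c3]; exact add_one_ne r),
          idx_nbr_right]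
      rw [e1, e2] at this
      have hs : ∀ {a b c e : HeawoodVertex k}, Hex k a b c e ↔ Hex k e c b a :=
        ⟨Hex.symm, Hex.symm⟩
      rw [c3, hs, this, not_not]
  rw [← key]
  constructor
  · rintro ⟨e, he1, he2, he3⟩
    obtain ⟨u', rfl⟩ := (heawoodGraph_adj_iff hk _ e).1 he1
    by_cases hu : u' = t
    · subst hu
      exact absurd (hex_braid hk x (by clear * - hrt; revert r u'; decide)) he3
    · have hur' : u' ≠ r := by
        rintro rfl
        exact he2 (by rw [nbr_nbr])
      have : u' = u := by clear * - hrt hur hut hu hur'; revert u u' r t; decide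
      rwa [← this]
  · intro h
    exact ⟨_, adj_cls_nbr hk _ _, cls_nbr_nbr_ne hk x hur, h⟩

/-- `Bad` compares the coordinates left fixed by two edges through `wing A`. This map has no
symmetry: `A` is its only value taken twice, and `A + 1` is its value at `A`. So `φ` keeps the
coordinate fixed by each edge, and `τ` can be read off from the residues at `x` and `y`. -/
theorem Local.const_of_exceptional (hk : ∀ i, 1 ≤ k i) {A : Fin (2 + 1)} (h0 : k A = 1)
    (h1 : k (A + 1) = 1) (h2 : k (A + 1 + 1) ≠ 1) {φ : HeawoodAut k} {x y : TilingVertex 2}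
    {τ τ' : ZMod (2 + 1) → ZMod (2 + 1)} (h : Local φ x y τ) {r : ZMod (2 + 1)}
    (h' : Local φ (nbr x r) (nbr y (τ r)) τ') : τ' = τ := by
  have third : ∀ {x y : TilingVertex 2} {τ : ZMod (2 + 1) → ZMod (2 + 1)}, Local φ x y τ →
      ∀ t, τ t = res y (idx x (t + 1 + 1)) + 1 := by
    intro x y τ h t
    have hrig : ∀ (A : Fin (2 + 1)) (f : Fin (2 + 1) → Fin (2 + 1)), Function.Injective f →
        (∀ Q S, Q ≠ S → (S = wing A Q ↔ f S = wing A (f Q))) → ∀ i, f i = i := by decide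
    have c3 : ∀ s : ZMod (2 + 1), s + 1 + 1 + 1 = s := by decide
    have hf := hrig A (fun i => idx y (τ (res x i + 1) + 1 + 1)) (by
      intro i j hij
      have := (h.injective hk) (add_right_cancel (add_right_cancel ((idx y).injective hij)))
      exact (res x).injective (add_right_cancel this)) (by
      intro Q S hQS
      obtain ⟨q, rfl⟩ := (idx x).surjective Q
      obtain ⟨s, rfl⟩ := (idx x).surjective S
      have hqs : q ≠ s := fun e => hQS (by rw [e])
      have e1 := bad_iff_of_exceptional hk h0 h1 h2 x (r := q + 1) (t := s + 1) (by simpa using hqs)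
      have e2 := bad_iff_of_exceptional hk h0 h1 h2 y
        ((h.injective hk).ne (a₁ := q + 1) (a₂ := s + 1) (by simpa using hqs))
      rw [← bad_map_iff φ, h.1, h.2, h.2, e2, c3, c3] at e1
      simp only [idx, Equiv.apply_symm_apply] at e1 ⊢
      exact e1.symm) (idx x (t + 1 + 1))
    simp only [idx, Equiv.apply_symm_apply, c3] at hf ⊢
    rw [← hf, Equiv.apply_symm_apply, c3]
  -- `β` sends the residue of a coordinate at `x` to its residue at `y`. Crossing the edge swaps `r,
  -- r + 1` on one side and `τ r, τ r + 1` on the other, and the formula for `τ` survives.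
  have hβ : ∀ β : ZMod (2 + 1) → ZMod (2 + 1), Function.Injective β → ∀ r t,
      Equiv.swap (β (r + 1 + 1) + 1) (β (r + 1 + 1) + 1 + 1) (β (Equiv.swap r (r + 1) t)) = β t := by
    decide
  funext t
  rw [third h' t, third h t]
  congr 1
  rw [res_apply, coe_nbr, idx_nbr, third h r]
  exact hβ (fun t => res y (idx x t)) ((res y).injective.comp (idx x).injective) r (t + 1 + 1)

end Planar

/-! ### The relabelling does not depend on the vertex -/

section Const

variable {d : ℕ} [Fact (2 ≤ d)] {k : Fin (d + 1) → ℕ}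

theorem sixRigid_of_ne_two (hk : ∀ i, 1 ≤ k i) (hd : d ≠ 2) : SixRigid k := by
  intro v hv h
  refine mem_sublattice_eq_zero hk hv fun i j => ?_
  have h3 : (3 : ℤ) ≤ d := by
    have := Fact.out (p := 2 ≤ d)
    exact_mod_cast (show 3 ≤ d by omega)
  linarith [h i j]

/-- Without rigidity `d = 2` and two of the `k_i` are 1; the third is not 1 because `k` is not
constant. -/
theorem Local.const (hk : ∀ i, 1 ≤ k i) (hne : ∃ i j, k i ≠ k j) {φ : HeawoodAut k}
    {x y : TilingVertex d} {τ τ' : ZMod (d + 1) → ZMod (d + 1)} (h : Local φ x y τ)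
    {r : ZMod (d + 1)} (h' : Local φ (nbr x r) (nbr y (τ r)) τ') : τ' = τ := by
  by_cases H : SixRigid k
  · exact h.const_of_sixRigid hk H h'
  · have hd : d = 2 := by
      by_contra hd
      exact H (sixRigid_of_ne_two hk hd)
    subst hd
    simp only [SixRigid, not_forall] at H
    obtain ⟨v, hv, hs, hv0⟩ := H
    obtain ⟨A, hA, hA', -⟩ := eq_shortVec_of_short hk hv hs hv0
    refine h.const_of_exceptional hk hA hA' (fun hC => ?_) h'
    have hall : ∀ i, k i = 1 := by
      intro i
      rcases fin_three_cases A i with rfl | rfl | rfl <;> assumption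
    obtain ⟨i, j, hij⟩ := hne
    exact hij ((hall i).trans (hall j).symm)

end Const

end Heawood

namespace Heawood

/-! ### Coordinate permutations preserving the sublattice -/

section Stabilizer

variable {d : ℕ} {k : Fin (d + 1) → ℕ}

theorem rowComb_eq (k : Fin (d + 1) → ℕ) (b : Fin (d + 1) → ℤ) (l : Fin (d + 1)) :
    rowComb k b l = b l + k l * (b l - b (l - 1)) := by
  simp only [rowComb]; ring

/-- A combination of the rows of `M_k` supported on two indices. -/
theorem rowComb_two_support [Fact (2 ≤ d)] (hk : ∀ i, 1 ≤ k i) {b : Fin (d + 1) → ℤ}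
    {p q : Fin (d + 1)} {α β : ℤ} (hα : 0 < α) (hβ : 0 < β) (hp : rowComb k b p = α)
    (hq : rowComb k b q = -β) (h0 : ∀ l, l ≠ p → l ≠ q → rowComb k b l = 0) :
    (1 + k p + k q ≤ α + β) ∧ (α + β = 1 + k p + k q →
      (q = p + 1 ∧ k p + 1 ≤ α ∧ β ≤ k q) ∨ (p = q + 1 ∧ k q + 1 ≤ β ∧ α ≤ k p)) := by
  have hk' : ∀ l, (1 : ℤ) ≤ k l := fun l => by exact_mod_cast hk l
  have hnc : ∃ i j, b i ≠ b j := by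
    by_contra hcon
    push Not at hcon
    rw [rowComb_eq, hcon (p - 1) p] at hp
    rw [rowComb_eq, hcon (q - 1) p, hcon q p] at hq
    simp only [sub_self, mul_zero, add_zero] at hp hq
    linarith
  obtain ⟨i, hi, hi'⟩ := exists_ascent_to_max b hnc
  obtain ⟨j, hj, hj'⟩ := exists_descent_to_min b hnc
  -- A positive maximum reached by an ascent produces a positive entry, and `p` carries the only
  -- one; `hjq` is the mirror image.
  have hip : 0 < b i → i = p := by
    intro hpos
    have h1 : 0 < rowComb k b i := by
      rw [rowComb_eq]; nlinarith [hk' i]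
    by_contra hne
    by_cases hiq : i = q
    · rw [hiq, hq] at h1; linarith
    · rw [h0 i hne hiq] at h1; exact lt_irrefl _ h1
  have hjq : b j < 0 → j = q := by
    intro hneg
    have h1 : rowComb k b j < 0 := by
      rw [rowComb_eq]; nlinarith [hk' j]
    by_contra hne
    by_cases hjp : j = p
    · rw [hjp, hp] at h1; linarith
    · rw [h0 j hjp hne] at h1; exact lt_irrefl _ h1
  have F1 : b (p - 1) < b p := by
    by_cases hbp : 0 < b p
    · have := hip (hbp.trans_le (hi p))
      rwa [this] at hi'
    · rw [rowComb_eq] at hp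
      by_contra hcon
      nlinarith [hk' p]
  have F2 : b q < b (q - 1) := by
    by_cases hbq : b q < 0
    · have := hjq ((hj q).trans_lt hbq)
      rwa [this] at hj'
    · rw [rowComb_eq] at hq
      by_contra hcon
      nlinarith [hk' q]
  have F3 : b q < b p := by
    by_cases hbi : 0 < b i
    · have := hip hbi
      rw [this] at hi
      exact F2.trans_le (hi _)
    · have hneg : b j < 0 := by linarith [hi (j - 1)]
      have := hjq hneg
      rw [this] at hj
      exact (hj _).trans_lt F1
  -- All three differences are at least 1, whence the bound; equality makes each of them 1.
  have hsum : α + β = (b p - b q) + k p * (b p - b (p - 1)) + k q * (b (q - 1) - b q) := by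
    have e : β = -rowComb k b q := by rw [hq, neg_neg]
    rw [e, ← hp, rowComb_eq, rowComb_eq]; ring
  have n1 : 0 ≤ (k p : ℤ) * (b p - b (p - 1) - 1) :=
    mul_nonneg (by positivity) (by linarith)
  have n2 : 0 ≤ (k q : ℤ) * (b (q - 1) - b q - 1) :=
    mul_nonneg (by positivity) (by linarith)
  refine ⟨by linarith, fun heq => ?_⟩
  have z1 : (k p : ℤ) * (b p - b (p - 1) - 1) = 0 := by linarith
  have z2 : (k q : ℤ) * (b (q - 1) - b q - 1) = 0 := by linarith
  have z3 : b p - b q = 1 := by linarith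
  have z1' := (mul_eq_zero.1 z1).resolve_left (by linarith [hk' p])
  have z2' := (mul_eq_zero.1 z2).resolve_left (by linarith [hk' q])
  have hne1 : ∀ l : Fin (d + 1), l - 1 ≠ l := by
    intro l h
    have h1 : (1 : Fin (d + 1)) = 0 := by simpa using h
    have := Fact.out (p := 2 ≤ d)
    rw [Fin.one_eq_zero_iff] at h1
    omega
  rw [rowComb_eq] at hp hq
  by_cases hbi : 0 < b i
  · left
    have hpi := hip hbi
    subst hpi
    -- Now `b (q - 1) = b q + 1 = b p` is again the positive maximum, so the entry at `q - 1` is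
    -- positive.
    have hqp : q - 1 = i := by
      by_contra hne
      have h2 := h0 (q - 1) hne (hne1 q)
      rw [rowComb_eq] at h2
      have := mul_nonneg (by positivity : (0 : ℤ) ≤ k (q - 1))
        (by linarith [hi (q - 1 - 1)] : 0 ≤ b (q - 1) - b (q - 1 - 1))
      linarith
    refine ⟨by rw [← hqp, sub_add_cancel], ?_, ?_⟩
    · have : b i - b (i - 1) = 1 := by linarith
      rw [this] at hp
      linarith
    · have : b q - b (q - 1) = -1 := by linarith
      rw [this] at hq
      linarith
  · right
    have hneg : b j < 0 := by linarith [hi (j - 1)]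
    have hqj := hjq hneg
    subst hqj
    have hpq : p - 1 = j := by
      by_contra hne
      have h2 := h0 (p - 1) (hne1 p) hne
      rw [rowComb_eq] at h2
      have := mul_nonneg (by positivity : (0 : ℤ) ≤ k (p - 1))
        (by linarith [hj (p - 1 - 1)] : 0 ≤ b (p - 1 - 1) - b (p - 1))
      linarith
    have hp0 : b p ≤ 0 := by linarith [hi p]
    refine ⟨by rw [← hpq, sub_add_cancel], ?_, ?_⟩
    · have : b j - b (j - 1) = -1 := by linarith
      rw [this] at hq
      linarith
    · have : b p - b (p - 1) = 1 := by linarith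
      rw [this] at hp
      linarith

theorem addRight_mem_zpowers (c : Fin (d + 1)) :
    Equiv.addRight c ∈ Subgroup.zpowers (finRotate (d + 1)) := by
  refine fin_cyclic_induction (P := fun c => Equiv.addRight c ∈ _) 0 ?_ (fun c hc => ?_) c
  · have : Equiv.addRight (0 : Fin (d + 1)) = 1 := by ext i; simp
    rw [this]
    exact one_mem _
  · have : Equiv.addRight (c + 1) = finRotate (d + 1) * Equiv.addRight c := by
      ext i
      simp [finRotate_apply, add_assoc]
    rw [this]
    exact mul_mem (Subgroup.mem_zpowers _) hc

/-- A vector of the sublattice determines its coefficients only up to a constant, which can be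
absorbed into `b'`. -/
theorem exists_rowComb_perm {π : Equiv.Perm (Fin (d + 1))}
    (h : ∀ u ∈ sublattice k, (fun i => u (π.symm i)) ∈ sublattice k) (b : Fin (d + 1) → ℤ) :
    ∃ b', ∀ l, rowComb k b' (π l) = rowComb k b l := by
  obtain ⟨b', hb'⟩ := mem_sublattice_iff.1 (h _ (mem_sublattice_iff.2 ⟨b, fun i => rfl⟩))
  have hn : ((d : ℤ) + 1) ≠ 0 := by positivity
  have hc : ∀ l, rowComb k b' (π l) - rowComb k b l = rowComb k b' (π 0) - rowComb k b 0 := by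
    intro l
    have h1 := hb' (π l)
    have h2 := hb' (π 0)
    rw [Equiv.symm_apply_apply] at h1 h2
    refine mul_left_cancel₀ hn ?_
    linarith
  refine ⟨fun l => b' l + -(rowComb k b' (π 0) - rowComb k b 0), fun l => ?_⟩
  rw [rowComb_add, rowComb_const, ← hc l]
  ring

/-- The permutations preserving the sublattice are the rotations preserving `k`. -/
theorem mem_cyclicStabilizer_of_preserves [Fact (2 ≤ d)] (hk : ∀ i, 1 ≤ k i)
    {π : Equiv.Perm (Fin (d + 1))}
    (h : ∀ u ∈ sublattice k, (fun i => u (π.symm i)) ∈ sublattice k) :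
    π ∈ cyclicStabilizer k := by
  have hne1 : ∀ l : Fin (d + 1), l + 1 ≠ l := by
    intro l h
    have h1 : (1 : Fin (d + 1)) = 0 := by simpa using h
    have := Fact.out (p := 2 ≤ d)
    rw [Fin.one_eq_zero_iff] at h1
    omega
  -- The image of row `i` has its two entries `k_i + 1` and `-k_{i+1}` at `π i` and `π (i + 1)`.
  have hrow : ∀ i, ((1 : ℤ) + k (π i) + k (π (i + 1)) ≤ ((k i : ℤ) + 1) + k (i + 1)) ∧
      (((k i : ℤ) + 1) + k (i + 1) = 1 + k (π i) + k (π (i + 1)) →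
        (π (i + 1) = π i + 1 ∧ (k (π i) : ℤ) + 1 ≤ (k i : ℤ) + 1 ∧
          (k (i + 1) : ℤ) ≤ k (π (i + 1))) ∨
        (π i = π (i + 1) + 1 ∧ (k (π (i + 1)) : ℤ) + 1 ≤ k (i + 1) ∧
          (k i : ℤ) + 1 ≤ k (π i))) := by
    intro i
    obtain ⟨b, hb⟩ := exists_rowComb_perm h (Pi.single i 1)
    refine rowComb_two_support hk (b := b) (by positivity)
      (by exact_mod_cast hk (i + 1)) ?_ ?_ ?_
    · rw [hb, rowComb_eq, Pi.single_eq_same, Pi.single_eq_of_ne]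
      · ring
      · intro h; exact hne1 i (by nth_rewrite 1 [← h]; rw [sub_add_cancel])
    · rw [hb, rowComb_eq, add_sub_cancel_right, Pi.single_eq_same, Pi.single_eq_of_ne (hne1 i)]
      ring
    · intro l hl hl'
      obtain ⟨l, rfl⟩ := π.surjective l
      rw [hb, rowComb_eq, Pi.single_eq_of_ne (fun h => hl (by rw [h])), Pi.single_eq_of_ne]
      · ring
      · intro h; exact hl' (by rw [← h, sub_add_cancel])
  have hshift : ∀ f : Fin (d + 1) → ℤ, ∑ i, f (i + 1) = ∑ i, f i := fun f =>
    Equiv.sum_comp (Equiv.addRight 1) f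
  have hperm : ∑ i, (k (π i) : ℤ) = ∑ i, (k i : ℤ) := Equiv.sum_comp π fun i => (k i : ℤ)
  -- The two sides of the inequalities have the same total, so every inequality is an equality.
  have hsum : ∑ i, ((1 : ℤ) + k (π i) + k (π (i + 1))) = ∑ i, (((k i : ℤ) + 1) + k (i + 1)) := by
    simp only [Finset.sum_add_distrib]
    rw [hshift fun i => (k (π i) : ℤ), hshift fun i => (k i : ℤ), hperm]
    ring
  have heq := (Finset.sum_eq_sum_iff_of_le fun i _ => (hrow i).1).1 hsum
  have hcase := fun i => (hrow i).2 (heq i (Finset.mem_univ i)).symm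
  have hplus : ∀ i, π (i + 1) = π i + 1 ∧ (k (π i) : ℤ) + 1 ≤ (k i : ℤ) + 1 ∧
      (k (i + 1) : ℤ) ≤ k (π (i + 1)) := by
    intro i
    rcases hcase i with h1 | ⟨h1, h2, h3⟩
    · exact h1
    -- A reversed pair `i, i + 1` followed by a preserved one gives `π (i + 2) = π i`; two reversed
    -- pairs give opposite strict inequalities between `k` at `i + 1` and at `π (i + 1)`.
    · exfalso
      rcases hcase (i + 1) with ⟨g1, -, -⟩ | ⟨-, -, g3⟩
      · have := π.injective (h1.trans g1.symm)
        have h2 : (1 + 1 : Fin (d + 1)) = 0 := by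
          rw [add_assoc] at this; simpa using this
        have h3 := congrArg Fin.val h2
        have := Fact.out (p := 2 ≤ d)
        rw [Fin.val_add, Fin.val_one', Nat.mod_eq_of_lt (by omega : 1 < d + 1),
          Nat.mod_eq_of_lt (by omega : 1 + 1 < d + 1)] at h3
        simp at h3
      · linarith
  refine ⟨?_, fun i => ?_⟩
  · have : π = Equiv.addRight (π 0) := by
      ext i
      congr 1
      refine fin_cyclic_induction (P := fun i => π i = Equiv.addRight (π 0) i) 0 (by simp)
        (fun j hj => ?_) i
      rw [(hplus j).1, hj]
      simp only [Equiv.coe_addRight]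
      abel
    rw [this]
    exact addRight_mem_zpowers _
  · have h1 := (hplus i).2.1
    have h2 := (hplus (i - 1)).2.2
    rw [sub_add_cancel] at h2
    omega

end Stabilizer

/-! ### Automorphisms of `H_k` lift to affine symmetries of the tiling -/

section Lift

variable {d : ℕ} {k : Fin (d + 1) → ℕ}

theorem tilingTranslation_val (v : lattice d) (x : TilingVertex d) :
    (tilingTranslation v x).1 = x.1 + v.1 := rfl

theorem tilingPerm_val (c : Equiv.Perm (Fin (d + 1))) (x : TilingVertex d) (i : Fin (d + 1)) :
    (tilingPerm c x).1 i = x.1 (c.symm i) := rfl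

theorem tilingRotation_val (x : TilingVertex d) (i : Fin (d + 1)) :
    (tilingRotation d x).1 i = (d : ℤ) + 2 - x.1 i := rfl

theorem idx_tilingPerm (c : Equiv.Perm (Fin (d + 1))) (x : TilingVertex d) (r : ZMod (d + 1)) :
    idx (tilingPerm c x) r = c (idx x r) := by
  rw [idx_eq_iff, tilingPerm_val, Equiv.symm_apply_apply, coe_idx]

theorem idx_tilingRotation (x : TilingVertex d) (r : ZMod (d + 1)) :
    idx (tilingRotation d x) r = idx x (1 - r) := by
  have h0 : ((d : ZMod (d + 1)) + 1) = 0 := by exact_mod_cast ZMod.natCast_self (d + 1)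
  rw [idx_eq_iff, tilingRotation_val]
  push_cast
  rw [coe_idx]
  linear_combination h0

instance : Nonempty (TilingVertex d) :=
  ⟨⟨fun i => (i : ℤ) + 1, rfl, fun r => by
    refine ⟨⟨ZMod.val (r - 1), ZMod.val_lt _⟩, ?_⟩
    push_cast
    rw [ZMod.natCast_zmod_val]
    ring⟩⟩

variable [Fact (2 ≤ d)]

theorem tilingTranslation_nbr (v : lattice d) (x : TilingVertex d) (r : ZMod (d + 1)) :
    tilingTranslation v (nbr x r) = nbr (tilingTranslation v x) (r + (v.1 0 : ZMod (d + 1))) :=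
  Subtype.ext (nbr_add v.2 (tilingTranslation_val v x) r).symm

theorem tilingPerm_nbr (c : Equiv.Perm (Fin (d + 1))) (x : TilingVertex d) (r : ZMod (d + 1)) :
    tilingPerm c (nbr x r) = nbr (tilingPerm c x) r := by
  refine tilingVertex_ext fun i => ?_
  rw [tilingPerm_val, nbr_apply, nbr_apply, idx_tilingPerm, idx_tilingPerm, tilingPerm_val]
  simp only [Equiv.symm_apply_eq]

theorem tilingRotation_nbr (x : TilingVertex d) (r : ZMod (d + 1)) :
    tilingRotation d (nbr x r) = nbr (tilingRotation d x) (-r) := by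
  refine tilingVertex_ext fun i => ?_
  rw [tilingRotation_val, nbr_apply, nbr_apply, idx_tilingRotation, idx_tilingRotation,
    tilingRotation_val, show (1 : ZMod (d + 1)) - -r = r + 1 by ring,
    show (1 : ZMod (d + 1)) - (-r + 1) = r by ring]
  ring

omit [Fact (2 ≤ d)] in
/-- Translations and coordinate permutations act transitively with prescribed label shift. -/
theorem exists_transport (x y : TilingVertex d) (c : ZMod (d + 1)) :
    ∃ (π : Equiv.Perm (Fin (d + 1))) (v : lattice d), (v.1 0 : ZMod (d + 1)) = c ∧
      y = tilingTranslation v (tilingPerm π x) := by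
  -- `π` takes the coordinate of residue `r` in `x` to that of residue `r + c` in `y`. Then `y - π
  -- x` has all coordinates congruent to `c` and sum zero, so it lies in the lattice.
  let π : Equiv.Perm (Fin (d + 1)) := ((res x).trans (Equiv.addRight c)).trans (idx y)
  have hv : ∀ i, ((y.1 i - (tilingPerm π x).1 i : ℤ) : ZMod (d + 1)) = c := by
    intro i
    obtain ⟨l, rfl⟩ := π.surjective i
    rw [tilingPerm_val, Equiv.symm_apply_apply, Int.cast_sub]
    have : π l = idx y (res x l + c) := rfl
    rw [this, coe_idx, res_apply]
    ring
  have hmem : y.1 - (tilingPerm π x).1 ∈ lattice d := by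
    rw [mem_lattice_iff]
    refine ⟨?_, fun i => by rw [Pi.sub_apply, hv, Pi.sub_apply, hv]⟩
    simp only [Pi.sub_apply]
    rw [Finset.sum_sub_distrib, y.2.1, (tilingPerm π x).2.1, sub_self]
  refine ⟨π, ⟨_, hmem⟩, hv 0, Subtype.ext ?_⟩
  rw [tilingTranslation_val]
  exact (add_sub_cancel _ _).symm

/-- Both `φ` and `g` relabel edges by the same `τ` everywhere, so agreement at one vertex spreads
along edges. -/
theorem Local.follow (hk : ∀ i, 1 ≤ k i) (hne : ∃ i j, k i ≠ k j) {φ : HeawoodAut k}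
    {g : TilingVertex d → TilingVertex d} {τ : ZMod (d + 1) → ZMod (d + 1)}
    (hg : ∀ x r, g (nbr x r) = nbr (g x) (τ r)) {x₀ : TilingVertex d}
    (h₀ : Local φ x₀ (g x₀) τ) (x : TilingVertex d) : Local φ x (g x) τ := by
  refine nbr_induction (P := fun x => Local φ x (g x) τ) x₀ h₀ (fun x r h => ?_) x
  obtain ⟨τ', h'⟩ := h.exists_nbr hk r
  have := h.const hk hne h'
  subst this
  rwa [hg]

/-- Every automorphism of `H_k` lifts to an affine symmetry of the tiling. -/
theorem exists_lift (hk : ∀ i, 1 ≤ k i) (hne : ∃ i j, k i ≠ k j) (φ : HeawoodAut k) :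
    ∃ (π : Equiv.Perm (Fin (d + 1))) (v : lattice d),
      (∀ x, φ (cls k x) = cls k (tilingTranslation v (tilingPerm π x))) ∨
      (∀ x, φ (cls k x) = cls k (tilingTranslation v (tilingPerm π (tilingRotation d x)))) := by
  obtain ⟨x₀⟩ : Nonempty (TilingVertex d) := inferInstance
  obtain ⟨y₀, hy₀⟩ := cls_surjective (φ (cls k x₀))
  obtain ⟨τ, hτ⟩ := exists_local hk hy₀.symm
  obtain ⟨ε, c, rfl | rfl, hεc⟩ := hτ.dihedral hk
  · obtain ⟨π, v, hv, hy⟩ := exists_transport x₀ y₀ c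
    refine ⟨π, v, Or.inl fun x => ?_⟩
    rw [hy] at hτ
    refine (Local.follow hk hne (g := fun x => tilingTranslation v (tilingPerm π x))
      (fun x r => ?_) hτ x).1
    rw [tilingPerm_nbr, tilingTranslation_nbr, hεc, hv, one_mul]
  · obtain ⟨π, v, hv, hy⟩ := exists_transport (tilingRotation d x₀) y₀ c
    refine ⟨π, v, Or.inr fun x => ?_⟩
    rw [hy] at hτ
    refine (Local.follow hk hne
      (g := fun x => tilingTranslation v (tilingPerm π (tilingRotation d x)))
      (fun x r => ?_) hτ x).1
    rw [tilingRotation_nbr, tilingPerm_nbr, tilingTranslation_nbr, hεc, hv, neg_one_mul]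

omit [Fact (2 ≤ d)] in
theorem translationAut_cls (v : lattice d) (x : TilingVertex d) :
    translationAut k v (cls k x) = cls k (tilingTranslation v x) := rfl

omit [Fact (2 ≤ d)] in
theorem rotationAut_cls (x : TilingVertex d) :
    rotationAut k (cls k x) = cls k (tilingRotation d x) := rfl

omit [Fact (2 ≤ d)] in
theorem cyclicAut_cls (c : cyclicStabilizer k) (x : TilingVertex d) :
    cyclicAut k c (cls k x) = cls k (tilingPerm c.1 x) := rfl

omit [Fact (2 ≤ d)] in
theorem heawoodAut_ext {φ ψ : HeawoodAut k} (h : ∀ x, φ (cls k x) = ψ (cls k x)) : φ = ψ := by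
  refine RelIso.ext fun a => ?_
  obtain ⟨x, rfl⟩ := cls_surjective a
  exact h x

/-- Every automorphism is the product of a translation, a rotation of the indices and possibly the
central symmetry. -/
theorem heawoodAut_eq (hk : ∀ i, 1 ≤ k i) (hne : ∃ i j, k i ≠ k j) (φ : HeawoodAut k) :
    ∃ (v : lattice d) (c : cyclicStabilizer k),
      φ = translationAut k v * cyclicAut k c ∨
      φ = translationAut k v * cyclicAut k c * rotationAut k := by
  obtain ⟨π, v, h⟩ := exists_lift hk hne φ
  have hπ : π ∈ cyclicStabilizer k := by
    -- `x` and `x + u` have the same class, and the lifts of its image differ by `±π u`.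
    refine mem_cyclicStabilizer_of_preserves hk fun u hu => ?_
    obtain ⟨x⟩ : Nonempty (TilingVertex d) := inferInstance
    have hx : cls k x = cls k (tilingTranslation ⟨u, sublattice_le_lattice k hu⟩ x) :=
      cls_eq_iff.2 ⟨u, hu, rfl⟩
    have h1 := congrArg φ hx
    rcases h with h | h
    · rw [h, h, cls_eq_iff_sub] at h1
      convert h1 using 1
      funext i
      simp [tilingTranslation_val, tilingPerm_val]
    · rw [h, h, cls_eq_iff_sub] at h1
      convert neg_mem h1 using 1
      funext i
      simp [tilingTranslation_val, tilingPerm_val, tilingRotation_val]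
  refine ⟨v, ⟨π, hπ⟩, ?_⟩
  rcases h with h | h
  · left
    exact heawoodAut_ext fun x => h x
  · right
    exact heawoodAut_ext fun x => h x

theorem heawoodAut_closure (hk : ∀ i, 1 ≤ k i) (hne : ∃ i j, k i ≠ k j) :
    Subgroup.closure (Set.range (translationAut k) ∪ {rotationAut k} ∪
      Set.range (cyclicAut k)) = (⊤ : Subgroup (HeawoodAut k)) := by
  rw [eq_top_iff]
  intro φ _
  obtain ⟨v, c, h⟩ := heawoodAut_eq hk hne φ
  have hv : translationAut k v ∈ Subgroup.closure (Set.range (translationAut k) ∪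
      {rotationAut k} ∪ Set.range (cyclicAut k)) :=
    Subgroup.subset_closure (Or.inl (Or.inl ⟨v, rfl⟩))
  have hc : cyclicAut k c ∈ Subgroup.closure (Set.range (translationAut k) ∪
      {rotationAut k} ∪ Set.range (cyclicAut k)) :=
    Subgroup.subset_closure (Or.inr ⟨c, rfl⟩)
  have hr : rotationAut k ∈ Subgroup.closure (Set.range (translationAut k) ∪
      {rotationAut k} ∪ Set.range (cyclicAut k)) :=
    Subgroup.subset_closure (Or.inl (Or.inr rfl))
  rcases h with rfl | rfl
  · exact mul_mem hv hc
  · exact mul_mem (mul_mem hv hc) hr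

end Lift

end Heawood

namespace Heawood

/-! ### The determinant counts translations modulo the sublattice -/

section Determinant

variable {d : ℕ} [Fact (2 ≤ d)]

theorem fin_add_one_ne (j : Fin (d + 1)) : j ≠ j + 1 := by
  intro h
  have h1 : (1 : Fin (d + 1)) = 0 := by simpa using h.symm
  have := Fact.out (p := 2 ≤ d)
  rw [Fin.one_eq_zero_iff] at h1
  omega

/-- For `0 ≤ t ≤ 1` the matrix `I + t (M_k - I)` is strictly diagonally dominant by columns, so its
determinant, which is 1 at `t = 0`, never vanishes. -/
theorem det_M_pos (k : Fin (d + 1) → ℕ) : 0 < (M k).det := by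
  let A : ℝ → Matrix (Fin (d + 1)) (Fin (d + 1)) ℝ := fun t => Matrix.of fun i j =>
    (if j = i then t * k j + 1 else 0) - (if j = i + 1 then t * k j else 0)
  have hne : ∀ t : ℝ, 0 ≤ t → (A t).det ≠ 0 := by
    intro t ht
    refine det_ne_zero_of_sum_col_lt_diag fun j => ?_
    have hdiag : ‖A t j j‖ = t * k j + 1 := by
      have : A t j j = t * k j + 1 := by simp [A, fin_add_one_ne j]
      rw [this, Real.norm_of_nonneg (by positivity)]
    rw [hdiag]
    have hoff : ∀ i ∈ Finset.univ.erase j, ‖A t i j‖ = if j - 1 = i then t * k j else 0 := by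
      intro i hi
      have hij : j ≠ i := (Finset.ne_of_mem_erase hi).symm
      simp only [A, Matrix.of_apply, if_neg hij, zero_sub, norm_neg, sub_eq_iff_eq_add]
      split_ifs
      · rw [Real.norm_of_nonneg (by positivity)]
      · simp
    rw [Finset.sum_congr rfl hoff]
    calc ∑ i ∈ Finset.univ.erase j, (if j - 1 = i then t * (k j : ℝ) else 0)
        ≤ ∑ i, (if j - 1 = i then t * (k j : ℝ) else 0) :=
          Finset.sum_le_sum_of_subset_of_nonneg (Finset.erase_subset _ _) fun i _ _ => by
            split_ifs <;> positivity
      _ = t * k j := by simp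
      _ < t * k j + 1 := by linarith
  have hcont : Continuous fun t => (A t).det := by
    refine Continuous.matrix_det (continuous_matrix fun i j => ?_)
    simp only [A, Matrix.of_apply]
    split_ifs <;> fun_prop
  have h0 : (A 0).det = 1 := by
    have : A 0 = 1 := by
      ext i j
      simp [A, Matrix.one_apply, eq_comm]
    rw [this, Matrix.det_one]
  have h1 : (A 1).det = ((M k).det : ℝ) := by
    have : A 1 = (Int.castRingHom ℝ).mapMatrix (M k) := by
      ext i j
      simp [A, M]
    rw [this, ← RingHom.map_det]
    simp
  have hpos : 0 < (A 1).det := by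
    by_contra hcon
    push Not at hcon
    obtain ⟨t, ht, ht'⟩ := intermediate_value_Icc' zero_le_one hcont.continuousOn
      (⟨hcon, by rw [h0]; exact zero_le_one⟩ : (0 : ℝ) ∈ Set.Icc (A 1).det (A 0).det)
    exact hne t ht.1 ht'
  rw [h1] at hpos
  exact_mod_cast hpos

theorem card_quotient_range (k : Fin (d + 1) → ℕ) :
    (Nat.card ((Fin (d + 1) → ℤ) ⧸ LinearMap.range (M k).vecMulLinear) : ℤ) = (M k).det := by
  have hdet : LinearMap.det (M k).vecMulLinear = (M k).det := by
    rw [← Matrix.mulVecLin_transpose, ← Matrix.toLin'_apply', LinearMap.det_toLin',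
      Matrix.det_transpose]
  have hinj : Function.Injective (M k).vecMulLinear := by
    rw [← LinearMap.ker_eq_bot]
    by_contra hker
    exact (det_M_pos k).ne' (hdet ▸ LinearMap.det_eq_zero_iff_ker_ne_bot.2 hker)
  have h := Submodule.natAbs_det_equiv (LinearMap.range (M k).vecMulLinear)
    (LinearEquiv.ofInjective _ hinj)
  have hc : (LinearMap.range (M k).vecMulLinear).subtype ∘ₗ
      ((LinearEquiv.ofInjective _ hinj : _ ≃ₗ[ℤ] _) : _ →ₗ[ℤ] _) = (M k).vecMulLinear := by
    ext; rfl
  have h' : (LinearMap.det ((LinearMap.range (M k).vecMulLinear).subtype ∘ₗ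
      ((LinearEquiv.ofInjective _ hinj : _ ≃ₗ[ℤ] _) : _ →ₗ[ℤ] _))).natAbs =
      Nat.card ((Fin (d + 1) → ℤ) ⧸ LinearMap.range (M k).vecMulLinear) := h
  rw [← h', hc, hdet, Int.natAbs_of_nonneg (det_M_pos k).le]

-- The relation `(1,…,1)` among the `w_i` is itself a combination of rows of `M_k`, so nothing is
-- lost in passing from coefficients to vectors.
omit [Fact (2 ≤ d)] in
theorem linComb_mem_sublattice_iff {k : Fin (d + 1) → ℕ} {a : Fin (d + 1) → ℤ} :
    Fintype.linearCombination ℤ (w d) a ∈ sublattice k ↔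
      a ∈ LinearMap.range (M k).vecMulLinear := by
  refine ⟨fun h => ?_, fun h => ⟨a, h, rfl⟩⟩
  obtain ⟨b, hb⟩ := mem_sublattice_iff.1 h
  simp only [linComb_w_apply] at hb
  refine ⟨fun l => b l + (a 0 - rowComb k b 0), ?_⟩
  rw [vecMul_M]
  funext l
  rw [rowComb_add, rowComb_const]
  have hn : ((d : ℤ) + 1) ≠ 0 := by positivity
  refine mul_left_cancel₀ hn ?_
  linarith [hb l, hb 0]

/-- The group of translations modulo the sublattice. -/
abbrev LatticeQuotient (k : Fin (d + 1) → ℕ) : Type :=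
  lattice d ⧸ (sublattice k).comap (lattice d).subtype

theorem card_latticeQuotient (k : Fin (d + 1) → ℕ) :
    (Nat.card (LatticeQuotient k) : ℤ) = (M k).det := by
  let f : (Fin (d + 1) → ℤ) →ₗ[ℤ] LatticeQuotient k :=
    ((sublattice k).comap (lattice d).subtype).mkQ ∘ₗ
      (Fintype.linearCombination ℤ (w d)).rangeRestrict
  have hf : Function.Surjective f :=
    (Submodule.mkQ_surjective _).comp (LinearMap.surjective_rangeRestrict _)
  have hker : LinearMap.ker f = LinearMap.range (M k).vecMulLinear := by
    ext a
    rw [← linComb_mem_sublattice_iff, LinearMap.mem_ker]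
    exact Submodule.Quotient.mk_eq_zero _
  rw [← card_quotient_range, ← hker,
    Nat.card_congr (LinearMap.quotKerEquivOfSurjective f hf).toEquiv]

end Determinant

/-! ### The order of the automorphism group -/

section Card

variable {d : ℕ} [Fact (2 ≤ d)] {k : Fin (d + 1) → ℕ}

/-- The affine symmetry `x ↦ v + c(±x)` of the tiling. -/
def affineSymm (v : lattice d) (c : Equiv.Perm (Fin (d + 1))) (ε : Bool) (x : TilingVertex d) :
    TilingVertex d :=
  tilingTranslation v (tilingPerm c (if ε then tilingRotation d x else x))

theorem affineSymm_nbr_sub (v : lattice d) (c : Equiv.Perm (Fin (d + 1))) (ε : Bool)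
    (x : TilingVertex d) (r : ZMod (d + 1)) (l : Fin (d + 1)) :
    (affineSymm v c ε (nbr x r)).1 l - (affineSymm v c ε x).1 l =
      (if ε then -1 else 1) *
        ((if l = c (idx x r) then 1 else 0) - (if l = c (idx x (r + 1)) then 1 else 0)) := by
  cases ε <;>
    simp [affineSymm, tilingTranslation_val, tilingPerm_val, tilingRotation_val, nbr_apply,
      Equiv.symm_apply_eq] <;> ring

/-- The images of an edge vector under the two linear parts differ by too little to be distinct
modulo the sublattice, so they coincide. With opposite signs, `c` and `c'` would exchange the two
ends of every edge at `x`, giving `0 = 2` in `ZMod (d + 1)`. -/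
theorem affineSymm_linear_unique (hk : ∀ i, 1 ≤ k i) {v v' : lattice d}
    {c c' : Equiv.Perm (Fin (d + 1))} {ε ε' : Bool}
    (h : ∀ x, cls k (affineSymm v c ε x) = cls k (affineSymm v' c' ε' x)) : c = c' ∧ ε = ε' := by
  obtain ⟨x⟩ : Nonempty (TilingVertex d) := inferInstance
  have key : ∀ r l, (affineSymm v' c' ε' (nbr x r)).1 l - (affineSymm v' c' ε' x).1 l =
      (affineSymm v c ε (nbr x r)).1 l - (affineSymm v c ε x).1 l := by
    intro r l
    have h1 := sub_mem (cls_eq_iff_sub.1 (h (nbr x r))) (cls_eq_iff_sub.1 (h x))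
    have h2 := mem_sublattice_eq_zero hk h1 (fun i j => by
      have hd : (2 : ℤ) ≤ d := by exact_mod_cast Fact.out (p := 2 ≤ d)
      have e1 := affineSymm_nbr_sub v c ε x r i
      have e2 := affineSymm_nbr_sub v c ε x r j
      have e3 := affineSymm_nbr_sub v' c' ε' x r i
      have e4 := affineSymm_nbr_sub v' c' ε' x r j
      simp only [Pi.sub_apply]
      have b : ∀ (ε : Bool) (P Q : Prop) [Decidable P] [Decidable Q],
          (if ε then (-1 : ℤ) else 1) * ((if P then 1 else 0) - (if Q then 1 else 0)) ≤ 1 ∧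
          -1 ≤ (if ε then (-1 : ℤ) else 1) * ((if P then 1 else 0) - (if Q then 1 else 0)) := by
        intro ε P Q _ _
        cases ε <;> split_ifs <;> simp
      have b1 := b ε (i = c (idx x r)) (i = c (idx x (r + 1)))
      have b2 := b ε (j = c (idx x r)) (j = c (idx x (r + 1)))
      have b3 := b ε' (i = c' (idx x r)) (i = c' (idx x (r + 1)))
      have b4 := b ε' (j = c' (idx x r)) (j = c' (idx x (r + 1)))
      rw [← e1] at b1
      rw [← e2] at b2
      rw [← e3] at b3
      rw [← e4] at b4
      linarith [b1.1, b2.1, b3.1, b4.1, b1.2, b2.2, b3.2, b4.2])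
    have h3 := congrFun h2 l
    simp only [Pi.sub_apply, Pi.zero_apply] at h3
    linarith
  simp only [affineSymm_nbr_sub] at key
  have hne : ∀ r, c (idx x r) ≠ c (idx x (r + 1)) := fun r => c.injective.ne (idx_ne x r)
  by_cases hε : ε = ε'
  · subst hε
    refine ⟨Equiv.ext fun i => ?_, rfl⟩
    obtain ⟨r, rfl⟩ := (idx x).surjective i
    have h1 := key r (c (idx x r))
    have h2 := mul_left_cancel₀ (by cases ε <;> simp) h1
    rw [if_pos rfl, if_neg (hne r)] at h2
    by_contra h3
    rw [if_neg h3] at h2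
    split_ifs at h2 <;> omega
  · exfalso
    have hε' : ∀ z : ℤ, (if ε' then -1 else 1) * z = (if ε then -1 else 1) * -z := by
      intro z
      revert hε
      cases ε <;> cases ε' <;> simp
    simp only [hε'] at key
    have key' : ∀ r l, -((if l = c' (idx x r) then (1 : ℤ) else 0) -
        (if l = c' (idx x (r + 1)) then 1 else 0)) =
        (if l = c (idx x r) then 1 else 0) - (if l = c (idx x (r + 1)) then 1 else 0) :=
      fun r l => mul_left_cancel₀ (by cases ε <;> simp) (key r l)
    have k1 : ∀ r, c (idx x r) = c' (idx x (r + 1)) := by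
      intro r
      have h1 := key' r (c (idx x r))
      rw [if_pos (rfl : c (idx x r) = _), if_neg (hne r)] at h1
      by_contra h3
      rw [if_neg h3] at h1
      split_ifs at h1 <;> omega
    have k2 : ∀ r, c (idx x (r + 1)) = c' (idx x r) := by
      intro r
      have h1 := key' r (c (idx x (r + 1)))
      rw [if_pos (rfl : c (idx x (r + 1)) = _), if_neg (hne r).symm] at h1
      by_contra h3
      rw [if_neg h3] at h1
      split_ifs at h1 <;> omega
    have h1 := (k2 0).symm.trans (k1 (0 + 1))
    exact ne_add_one_add_one 0 ((idx x).injective (c'.injective h1))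

/-- The automorphism of `H_k` induced by an affine symmetry. -/
noncomputable def affineAut (p : LatticeQuotient k × cyclicStabilizer k × Bool) : HeawoodAut k :=
  translationAut k p.1.out * cyclicAut k p.2.1 * (if p.2.2 then rotationAut k else 1)

omit [Fact (2 ≤ d)] in
theorem affineAut_cls (p : LatticeQuotient k × cyclicStabilizer k × Bool) (x : TilingVertex d) :
    affineAut p (cls k x) = cls k (affineSymm p.1.out p.2.1.1 p.2.2 x) := by
  obtain ⟨q, c, ε⟩ := p
  cases ε <;> rfl

omit [Fact (2 ≤ d)] in
theorem translation_cls_eq_iff {v v' : lattice d} (x : TilingVertex d) :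
    cls k (tilingTranslation v x) = cls k (tilingTranslation v' x) ↔
      (Submodule.Quotient.mk v : LatticeQuotient k) = Submodule.Quotient.mk v' := by
  rw [cls_eq_iff_sub, tilingTranslation_val, tilingTranslation_val, add_sub_add_left_eq_sub,
    eq_comm, Submodule.Quotient.eq]
  rfl

theorem affineAut_bijective (hk : ∀ i, 1 ≤ k i) (hne : ∃ i j, k i ≠ k j) :
    Function.Bijective (affineAut (k := k)) := by
  constructor
  · rintro ⟨q, c, ε⟩ ⟨q', c', ε'⟩ h
    have h1 : ∀ x, cls k (affineSymm q.out c.1 ε x) = cls k (affineSymm q'.out c'.1 ε' x) := by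
      intro x
      have := congrArg (fun φ : HeawoodAut k => φ (cls k x)) h
      simpa only [affineAut_cls] using this
    obtain ⟨hc, rfl⟩ := affineSymm_linear_unique hk h1
    obtain rfl : c = c' := Subtype.ext hc
    obtain ⟨x⟩ : Nonempty (TilingVertex d) := inferInstance
    have h2 := (translation_cls_eq_iff _).1 (h1 x)
    have h3 : q = q' := by
      simpa using h2
    rw [h3]
  · intro φ
    obtain ⟨v, c, h⟩ := heawoodAut_eq hk hne φ
    have ht : translationAut k v =
        translationAut k (Submodule.Quotient.mk v : LatticeQuotient k).out := by
      refine heawoodAut_ext fun x => ?_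
      rw [translationAut_cls, translationAut_cls, translation_cls_eq_iff]
      simp
    rcases h with rfl | rfl
    · exact ⟨⟨Submodule.Quotient.mk v, c, false⟩, by rw [ht]; rfl⟩
    · exact ⟨⟨Submodule.Quotient.mk v, c, true⟩, by rw [ht]; rfl⟩

theorem card_heawoodAut (hk : ∀ i, 1 ≤ k i) (hne : ∃ i j, k i ≠ k j) :
    (Nat.card (HeawoodAut k) : ℤ) = 2 * (Nat.card (cyclicStabilizer k) : ℤ) * (M k).det := by
  rw [← Nat.card_congr (Equiv.ofBijective _ (affineAut_bijective hk hne)), Nat.card_prod,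
    Nat.card_prod, ← card_latticeQuotient]
  simp only [Nat.card_eq_fintype_card (α := Bool), Fintype.card_bool]
  push_cast
  ring

end Card

end Heawood

namespace Heawood

/-! ### Facets of the affine arrangement in terms of tiling vertices -/

section Faces

variable {d : ℕ}

/-- The weight vector with integer coefficient vector `a`. -/
noncomputable def weightVec (a : Fin (d + 1) → ℤ) : Fin (d + 1) → ℝ :=
  fun i => a i - (∑ j, a j : ℤ) / ((d : ℝ) + 1)

theorem linComb_wAff (a : Fin (d + 1) → ℤ) :
    Fintype.linearCombination ℤ (wAff d) a = weightVec a := by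
  funext i
  rw [Fintype.linearCombination_apply, Finset.sum_apply]
  simp only [Pi.smul_apply]
  simp only [wAff, weightVec, zsmul_eq_mul, mul_sub, Finset.sum_sub_distrib, ← Finset.sum_mul]
  simp
  ring

theorem weightVec_add (a b : Fin (d + 1) → ℤ) :
    weightVec (fun i => a i + b i) = weightVec a + weightVec b := by
  funext i
  simp only [weightVec, Pi.add_apply, Finset.sum_add_distrib]
  push_cast
  ring

theorem weightVec_sub_apply (a : Fin (d + 1) → ℤ) (i j : Fin (d + 1)) :
    weightVec a i - weightVec a j = ((a i - a j : ℤ) : ℝ) := by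
  simp only [weightVec]; push_cast; ring

theorem sum_weightVec (a : Fin (d + 1) → ℤ) : ∑ i, weightVec a i = 0 := by
  have : (d : ℝ) + 1 ≠ 0 := by positivity
  simp only [weightVec, Finset.sum_sub_distrib, Finset.sum_const, Finset.card_univ,
    Fintype.card_fin, nsmul_eq_mul]
  push_cast
  field_simp
  ring

theorem weightVec_eq_iff {a b : Fin (d + 1) → ℤ} :
    weightVec a = weightVec b ↔ ∃ c, ∀ i, b i = a i + c := by
  constructor
  · intro h
    refine ⟨b 0 - a 0, fun i => ?_⟩
    have h1 := weightVec_sub_apply a i 0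
    rw [h, weightVec_sub_apply] at h1
    have h2 : b i - b 0 = a i - a 0 := by exact_mod_cast h1
    linarith
  · rintro ⟨c, hc⟩
    have hd : (d : ℝ) + 1 ≠ 0 := by positivity
    funext i
    simp only [weightVec, hc, Finset.sum_add_distrib, Finset.sum_const, Finset.card_univ,
      Fintype.card_fin, nsmul_eq_mul]
    push_cast
    field_simp
    ring

theorem mem_weightLattice_iff {v : Fin (d + 1) → ℝ} :
    v ∈ weightLattice d ↔ ∃ a, v = weightVec a := by
  constructor
  · rintro ⟨hv, h⟩
    have h' : ∀ i, ∃ m : ℤ, v i - v 0 = m := by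
      intro i
      by_cases hi : i = 0
      · exact ⟨0, by simp [hi]⟩
      · exact h 0 i (Fin.pos_of_ne_zero hi)
    choose a ha using h'
    refine ⟨a, funext fun i => ?_⟩
    have hs : ∑ i, v i = 0 := hv
    rw [Finset.sum_congr rfl fun i _ => (sub_eq_iff_eq_add.1 (ha i)), Finset.sum_add_distrib] at hs
    simp only [Finset.sum_const, Finset.card_univ, Fintype.card_fin, nsmul_eq_mul] at hs
    have hd : (d : ℝ) + 1 ≠ 0 := by positivity
    rw [weightVec, sub_eq_iff_eq_add.1 (ha i)]
    push_cast at hs ⊢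
    field_simp
    linarith
  · rintro ⟨a, rfl⟩
    exact ⟨sum_weightVec a, fun i j _ => ⟨_, weightVec_sub_apply a j i⟩⟩

theorem int_ediv_eq_iff {m q : ℤ} :
    m / ((d : ℤ) + 1) = q ↔ ((d : ℤ) + 1) * q ≤ m ∧ m < ((d : ℤ) + 1) * q + ((d : ℤ) + 1) := by
  have hd : (0 : ℤ) < (d : ℤ) + 1 := by positivity
  rw [le_antisymm_iff, ← Int.lt_add_one_iff, Int.ediv_lt_iff_lt_mul hd, Int.le_ediv_iff_mul_le hd]
  constructor <;> rintro ⟨h1, h2⟩ <;> constructor <;> linarith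

/-- The coefficient vector of the vertex number `s` of the facet dual to `x`. -/
def corner (x : TilingVertex d) (s : ℤ) : Fin (d + 1) → ℤ :=
  fun i => (x.1 i + s - 1) / ((d : ℤ) + 1)

theorem corner_spec (x : TilingVertex d) (s : ℤ) (i : Fin (d + 1)) :
    ((d : ℤ) + 1) * corner x s i ≤ x.1 i + s - 1 ∧
      x.1 i + s - 1 < ((d : ℤ) + 1) * corner x s i + ((d : ℤ) + 1) := int_ediv_eq_iff.1 rfl

theorem corner_eq_iff {x : TilingVertex d} {s : ℤ} {i : Fin (d + 1)} {q : ℤ} :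
    corner x s i = q ↔ ((d : ℤ) + 1) * q ≤ x.1 i + s - 1 ∧
      x.1 i + s - 1 < ((d : ℤ) + 1) * q + ((d : ℤ) + 1) := int_ediv_eq_iff

/-- The numbers `x_i + s - 1` have all residues, so their remainders add up to `0 + … + d`; the
given sum of `x` leaves `(d+1) s`. -/
theorem sum_corner (x : TilingVertex d) (s : ℤ) : ∑ i, corner x s i = s := by
  have hd : ((d : ℤ) + 1) ≠ 0 := by positivity
  have h1 : ∀ i, ((d : ℤ) + 1) * corner x s i =
      x.1 i + s - 1 - (ZMod.val (res x i + ((s - 1 : ℤ) : ZMod (d + 1))) : ℤ) := by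
    intro i
    rw [res_apply, ← Int.cast_add, ZMod.val_intCast, ← add_sub_assoc]
    have := Int.mul_ediv_add_emod (x.1 i + s - 1) ((d : ℤ) + 1)
    rw [corner]
    push_cast
    linarith
  have h2 : ∑ i, (ZMod.val (res x i + ((s - 1 : ℤ) : ZMod (d + 1))) : ℤ) =
      ∑ j : Fin (d + 1), (j : ℤ) :=
    Equiv.sum_comp ((res x).trans (Equiv.addRight ((s - 1 : ℤ) : ZMod (d + 1))))
      fun z : ZMod (d + 1) => (ZMod.val z : ℤ)
  refine mul_left_cancel₀ hd ?_
  rw [Finset.mul_sum, Finset.sum_congr rfl fun i _ => h1 i, Finset.sum_sub_distrib, h2]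
  simp only [add_sub_assoc, Finset.sum_add_distrib]
  rw [x.2.1, Finset.sum_add_distrib]
  simp only [Finset.sum_const, Finset.card_univ, Fintype.card_fin, nsmul_eq_mul]
  push_cast
  ring

theorem corner_add_mul (x : TilingVertex d) (s c : ℤ) (i : Fin (d + 1)) :
    corner x (s + ((d : ℤ) + 1) * c) i = corner x s i + c := by
  have := corner_spec x s i
  rw [corner_eq_iff]
  constructor <;> linarith

/-- The vertex number `s` of the facet dual to `x`; it depends on `s` modulo `d + 1`. -/
noncomputable def vert (x : TilingVertex d) (s : ℤ) : Fin (d + 1) → ℝ := weightVec (corner x s)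

theorem vert_add_mul (x : TilingVertex d) (s c : ℤ) :
    vert x (s + ((d : ℤ) + 1) * c) = vert x s :=
  (weightVec_eq_iff.2 ⟨c, corner_add_mul x s c⟩).symm

/-- The coefficient sum modulo `d + 1` is an invariant of a weight vector, so a vertex carries the
same number in all facets containing it. -/
theorem vert_eq_vert {x y : TilingVertex d} {s t : ℤ} (h : vert x s = vert y t) :
    (∃ c, t = s + ((d : ℤ) + 1) * c) ∧ corner y s = corner x s := by
  obtain ⟨c, hc⟩ := weightVec_eq_iff.1 h
  have h1 := sum_corner y t
  rw [Finset.sum_congr rfl fun i _ => hc i, Finset.sum_add_distrib, sum_corner] at h1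
  simp only [Finset.sum_const, Finset.card_univ, Fintype.card_fin, nsmul_eq_mul] at h1
  push_cast at h1
  refine ⟨⟨c, h1.symm⟩, funext fun i => ?_⟩
  have h2 := hc i
  rw [← h1, corner_add_mul] at h2
  linarith

/-- The vertex set of the facet dual to `x`. -/
noncomputable def facet (x : TilingVertex d) : Finset (Fin (d + 1) → ℝ) :=
  (Finset.range (d + 1)).image fun s : ℕ => vert x s

theorem mem_facet_iff {x : TilingVertex d} {v : Fin (d + 1) → ℝ} :
    v ∈ facet x ↔ ∃ s : ℤ, v = vert x s := by
  simp only [facet, Finset.mem_image, Finset.mem_range]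
  constructor
  · rintro ⟨s, -, rfl⟩
    exact ⟨s, rfl⟩
  · rintro ⟨s, rfl⟩
    have hd : (0 : ℤ) < (d : ℤ) + 1 := by positivity
    have h1 := Int.emod_nonneg s hd.ne'
    have h2 := Int.emod_lt_of_pos s hd
    refine ⟨(s % ((d : ℤ) + 1)).toNat, by omega, ?_⟩
    rw [Int.toNat_of_nonneg h1]
    nth_rewrite 2 [← Int.emod_add_mul_ediv s ((d : ℤ) + 1)]
    rw [vert_add_mul]

theorem vert_mem_facet (x : TilingVertex d) (s : ℤ) : vert x s ∈ facet x :=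
  mem_facet_iff.2 ⟨s, rfl⟩

theorem card_facet (x : TilingVertex d) : (facet x).card = d + 1 := by
  rw [facet, Finset.card_image_of_injOn, Finset.card_range]
  intro s hs t ht h
  obtain ⟨⟨c, hc⟩, -⟩ := vert_eq_vert h
  simp only [Finset.coe_range, Set.mem_Iio] at hs ht
  have hc0 : c = 0 := by
    have h1 : c < 1 := by
      by_contra hcon
      push Not at hcon
      have : ((d : ℤ) + 1) * 1 ≤ ((d : ℤ) + 1) * c :=
        mul_le_mul_of_nonneg_left hcon (by positivity)
      omega
    have h2 : -1 < c := by
      by_contra hcon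
      push Not at hcon
      have : ((d : ℤ) + 1) * c ≤ ((d : ℤ) + 1) * (-1) :=
        mul_le_mul_of_nonneg_left hcon (by positivity)
      omega
    omega
  rw [hc0] at hc
  omega

/-- The floor in coordinate `i` first reaches 0 at `s = 1 - x_i`, which recovers `x_i`. -/
theorem eq_of_corner_eq {x y : TilingVertex d} (h : ∀ s, corner y s = corner x s) : x = y := by
  have key : ∀ {x y : TilingVertex d}, (∀ s, corner y s = corner x s) → ∀ i, x.1 i ≤ y.1 i := by
    intro x y h i
    have h1 : corner x (1 - x.1 i) i = 0 := by
      rw [corner_eq_iff]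
      have : (0 : ℤ) < (d : ℤ) + 1 := by positivity
      constructor <;> linarith
    rw [← h, corner_eq_iff] at h1
    linarith [h1.1]
  exact tilingVertex_ext fun i => le_antisymm (key h i) (key (fun s => (h s).symm) i)

theorem eq_of_facet_subset {x y : TilingVertex d} (h : facet x ⊆ facet y) : x = y := by
  refine eq_of_corner_eq fun s => ?_
  obtain ⟨t, ht⟩ := mem_facet_iff.1 (h (vert_mem_facet x s))
  exact (vert_eq_vert ht).2

/-- A weight vector close to `x` is a vertex of the facet dual to `x`. -/
theorem weightVec_mem_facet {x : TilingVertex d} {a : Fin (d + 1) → ℤ}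
    (h : ∀ i j, ((d : ℤ) + 1) * (a j - a i - 1) ≤ x.1 j - x.1 i) : weightVec a ∈ facet x := by
  have hs := sum_corner x (∑ i, a i)
  set s := ∑ i, a i with hsdef
  have hd : (0 : ℤ) < (d : ℤ) + 1 := by positivity
  have hle : ∀ i ∈ Finset.univ, corner x s i ≤ a i := by
    by_contra hcon
    push Not at hcon
    obtain ⟨i, -, hi⟩ := hcon
    -- Both vectors have sum `s`, so an excess at `i` forces a deficit at some `j`; together they
    -- violate the closeness hypothesis.
    obtain ⟨j, hj⟩ : ∃ j, corner x s j < a j := by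
      by_contra hcon
      push Not at hcon
      have := Finset.sum_lt_sum (fun j _ => hcon j) ⟨i, Finset.mem_univ i, hi⟩
      rw [hs, ← hsdef] at this
      exact lt_irrefl _ this
    have h1 := (corner_spec x s i).1
    have h2 := (corner_spec x s j).2
    have h3 := h i j
    have h4 : ((d : ℤ) + 1) * (a i + 1) ≤ ((d : ℤ) + 1) * corner x s i :=
      mul_le_mul_of_nonneg_left hi hd.le
    have h5 : ((d : ℤ) + 1) * (corner x s j + 1) ≤ ((d : ℤ) + 1) * a j :=
      mul_le_mul_of_nonneg_left hj hd.le
    linarith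
  have heq := (Finset.sum_eq_sum_iff_of_le hle).1 (hs.trans hsdef)
  have : a = corner x s := funext fun i => (heq i (Finset.mem_univ i)).symm
  rw [this]
  exact vert_mem_facet x s

theorem facet_isFace (x : TilingVertex d) :
    (facet x).Nonempty ∧ (∀ v ∈ facet x, v ∈ weightLattice d) ∧
      ∃ z, Generic z ∧ ∀ v ∈ facet x, v ∈ closedRegion z := by
  have hd : (0 : ℝ) < (d : ℝ) + 1 := by positivity
  have hd' : (0 : ℤ) < (d : ℤ) + 1 := by positivity
  -- The interior point is the projection of `x` to `V`, divided by `d + 1`; it is generic because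
  -- the coordinates of `x` are pairwise incongruent.
  refine ⟨⟨_, vert_mem_facet x 0⟩, fun v hv => ?_,
    fun i => (weightVec x.1 i) / ((d : ℝ) + 1), ⟨?_, ?_⟩, ?_⟩
  · obtain ⟨s, rfl⟩ := mem_facet_iff.1 hv
    exact mem_weightLattice_iff.2 ⟨_, rfl⟩
  · change ∑ i, _ = _
    rw [← Finset.sum_div, sum_weightVec, zero_div]
  · intro i j hij m hm
    rw [← sub_div, weightVec_sub_apply, div_eq_iff hd.ne'] at hm
    have h1 : x.1 j - x.1 i = m * ((d : ℤ) + 1) := by exact_mod_cast hm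
    have h2 := congrArg (fun m : ℤ => (m : ZMod (d + 1))) h1
    have h0 : ((d : ZMod (d + 1)) + 1) = 0 := by exact_mod_cast ZMod.natCast_self (d + 1)
    push_cast at h2
    rw [h0, mul_zero, sub_eq_zero] at h2
    exact hij.ne ((res x).injective h2.symm)
  · intro v hv
    obtain ⟨s, rfl⟩ := mem_facet_iff.1 hv
    refine ⟨sum_weightVec _, fun i j _ m => ?_⟩
    have e1 : weightVec x.1 j / ((d : ℝ) + 1) - weightVec x.1 i / ((d : ℝ) + 1) =
        ((x.1 j - x.1 i : ℤ) : ℝ) / ((d : ℝ) + 1) := by rw [← sub_div, weightVec_sub_apply]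
    have e2 : vert x s j - vert x s i = ((corner x s j - corner x s i : ℤ) : ℝ) :=
      weightVec_sub_apply _ j i
    have hi := corner_spec x s i
    have hj := corner_spec x s j
    simp only [e1, e2, div_lt_iff₀ hd, lt_div_iff₀ hd]
    constructor
    · intro h
      have h1 : x.1 j - x.1 i < m * ((d : ℤ) + 1) := by exact_mod_cast h
      have h2 : ((d : ℤ) + 1) * (corner x s j - corner x s i) < ((d : ℤ) + 1) * (m + 1) := by
        linarith
      have h3 := lt_of_mul_lt_mul_left h2 hd'.le
      exact_mod_cast Int.lt_add_one_iff.1 h3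
    · intro h
      have h1 : m * ((d : ℤ) + 1) < x.1 j - x.1 i := by exact_mod_cast h
      have h2 : ((d : ℤ) + 1) * (m - 1) < ((d : ℤ) + 1) * (corner x s j - corner x s i) := by
        linarith
      have h3 := lt_of_mul_lt_mul_left h2 hd'.le
      exact_mod_cast Int.sub_one_lt_iff.1 h3

/-- Each region of the arrangement is the region of a tiling vertex. -/
theorem exists_tilingVertex_of_generic {z : Fin (d + 1) → ℝ} (hz : Generic z) :
    ∃ x : TilingVertex d, ∀ i j (m : ℤ), (m : ℝ) ≤ z j - z i →
      ((d : ℤ) + 1) * m ≤ x.1 j - x.1 i := by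
  classical
  have hfr : Function.Injective fun i => Int.fract (z i) := by
    have key : ∀ i j, i < j → Int.fract (z i) ≠ Int.fract (z j) := by
      intro i j hij h
      refine hz.2 i j hij (⌊z j⌋ - ⌊z i⌋) ?_
      have h1 := Int.floor_add_fract (z i)
      have h2 := Int.floor_add_fract (z j)
      rw [h] at h1
      push_cast
      linarith
    intro i j h
    rcases lt_trichotomy i j with hij | hij | hij
    · exact absurd h (key i j hij)
    · exact hij
    · exact absurd h.symm (key j i hij)
  let ρ : Fin (d + 1) → ℕ := fun i =>
    (Finset.univ.filter fun j => Int.fract (z j) < Int.fract (z i)).card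
  have hρmono : ∀ i j, Int.fract (z i) ≤ Int.fract (z j) → ρ i ≤ ρ j := by
    intro i j h
    refine Finset.card_le_card fun l hl => ?_
    simp only [Finset.mem_filter, Finset.mem_univ, true_and] at hl ⊢
    exact hl.trans_le h
  have hρstrict : ∀ i j, Int.fract (z i) < Int.fract (z j) → ρ i < ρ j := by
    intro i j h
    refine Finset.card_lt_card ⟨fun l hl => ?_, fun hsub => ?_⟩
    · simp only [Finset.mem_filter, Finset.mem_univ, true_and] at hl ⊢
      exact hl.trans h
    · have := hsub (Finset.mem_filter.2 ⟨Finset.mem_univ i, h⟩)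
      simp at this
  have hρlt : ∀ i, ρ i < d + 1 := by
    intro i
    have : ρ i < (Finset.univ : Finset (Fin (d + 1))).card := by
      refine Finset.card_lt_card ⟨Finset.filter_subset _ _, fun hsub => ?_⟩
      have := hsub (Finset.mem_univ i)
      simp at this
    simpa using this
  have hρinj : Function.Injective ρ := by
    intro i j h
    by_contra hne
    rcases lt_or_gt_of_ne (hfr.ne hne) with h1 | h1
    · exact (hρstrict i j h1).ne h
    · exact (hρstrict j i h1).ne h.symm
  let e : Fin (d + 1) ≃ Fin (d + 1) := Equiv.ofBijective (fun i => ⟨ρ i, hρlt i⟩)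
    (Finite.injective_iff_bijective.1 fun i j h => hρinj (congrArg Fin.val h))
  have he : ∀ i, ((e i : ℕ) : ℤ) = ρ i := fun i => rfl
  -- The region depends only on the floors and the order of the fractional parts, which their ranks
  -- `ρ` record. Subtracting the sum of the floors normalizes the coordinate sum.
  refine ⟨⟨fun i => ((d : ℤ) + 1) * ⌊z i⌋ + ρ i + 1 - ∑ j, ⌊z j⌋, ?_, ?_⟩, ?_⟩
  · have := Equiv.sum_comp e fun j : Fin (d + 1) => ((j : ℕ) : ℤ)
    simp only [he] at this
    simp only [Finset.sum_sub_distrib, Finset.sum_add_distrib, ← Finset.mul_sum, this]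
    simp only [Finset.sum_const, Finset.card_univ, Fintype.card_fin, nsmul_eq_mul]
    push_cast
    ring
  · intro r
    obtain ⟨i, hi⟩ := e.surjective (r + ((∑ j, ⌊z j⌋ : ℤ) : ZMod (d + 1)) - 1 : ZMod (d + 1))
    refine ⟨i, ?_⟩
    have hv : (ρ i : ZMod (d + 1)) = r + ((∑ j, ⌊z j⌋ : ℤ) : ZMod (d + 1)) - 1 := by
      rw [← ZMod.natCast_zmod_val (r + ((∑ j, ⌊z j⌋ : ℤ) : ZMod (d + 1)) - 1)]
      congr 1
      exact congrArg Fin.val hi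
    have h0 : ((d : ZMod (d + 1)) + 1) = 0 := by exact_mod_cast ZMod.natCast_self (d + 1)
    push_cast at hv ⊢
    rw [h0, hv]
    ring
  · intro i j m hm
    have h1 := Int.floor_add_fract (z i)
    have h2 := Int.floor_add_fract (z j)
    have hfi := Int.fract_nonneg (z i)
    have hfi' := Int.fract_lt_one (z i)
    have hfj' := Int.fract_lt_one (z j)
    have hri : (ρ i : ℤ) ≤ d := by exact_mod_cast Nat.lt_succ_iff.1 (hρlt i)
    change _ ≤ (((d : ℤ) + 1) * ⌊z j⌋ + ρ j + 1 - ∑ j, ⌊z j⌋) -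
      (((d : ℤ) + 1) * ⌊z i⌋ + ρ i + 1 - ∑ j, ⌊z j⌋)
    have hfl : m ≤ ⌊z j⌋ - ⌊z i⌋ := by
      have : ((m - 1 : ℤ) : ℝ) < ((⌊z j⌋ - ⌊z i⌋ : ℤ) : ℝ) := by push_cast; linarith
      have := Int.cast_lt.1 this
      omega
    rcases hfl.lt_or_eq with hlt | heq
    · have : ((d : ℤ) + 1) * (m + 1) ≤ ((d : ℤ) + 1) * (⌊z j⌋ - ⌊z i⌋) :=
        mul_le_mul_of_nonneg_left hlt (by positivity)
      linarith
    · have : Int.fract (z i) ≤ Int.fract (z j) := by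
        have : (m : ℝ) = ⌊z j⌋ - ⌊z i⌋ := by exact_mod_cast heq
        linarith
      have := hρmono i j this
      rw [heq]
      have h3 : (ρ i : ℤ) ≤ ρ j := by exact_mod_cast this
      linarith

theorem exists_facet_superset (F : AffineFace d) : ∃ x, F.1 ⊆ facet x := by
  obtain ⟨-, hw, z, hz, hr⟩ := F.2
  obtain ⟨x, hx⟩ := exists_tilingVertex_of_generic hz
  refine ⟨x, fun v hv => ?_⟩
  obtain ⟨a, rfl⟩ := mem_weightLattice_iff.1 (hw v hv)
  refine weightVec_mem_facet fun i j => ?_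
  by_cases hij : i = j
  · subst hij
    have : (0 : ℤ) < (d : ℤ) + 1 := by positivity
    simp only [sub_self]
    linarith
  refine hx i j _ ?_
  by_contra hcon
  push Not at hcon
  rcases lt_or_gt_of_ne hij with h | h
  · have h1 := ((hr _ hv).2 i j h (a j - a i - 1)).1 hcon
    rw [weightVec_sub_apply] at h1
    have := Int.cast_le.1 h1
    omega
  · have h1 := ((hr _ hv).2 j i h (-(a j - a i - 1))).2 (by push_cast at hcon ⊢; linarith)
    rw [weightVec_sub_apply] at h1
    have := Int.cast_le.1 h1
    omega

end Faces

end Heawood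

namespace Heawood

/-! ### Duality between `H_k` and the face poset of `T_k` -/

section Poset

variable {d : ℕ} {k : Fin (d + 1) → ℕ}

/-- A nonempty set of vertices of a facet is a face. -/
noncomputable def mkFace (F : Finset (Fin (d + 1) → ℝ)) (hF : F.Nonempty) (x : TilingVertex d)
    (h : F ⊆ facet x) : AffineFace d :=
  ⟨F, hF, fun v hv => (facet_isFace x).2.1 v (h hv),
    (facet_isFace x).2.2.imp fun _ hz => ⟨hz.1, fun v hv => hz.2 v (h hv)⟩⟩

/-- The facet dual to `x`. -/
noncomputable def facetFace (x : TilingVertex d) : AffineFace d := ⟨facet x, facet_isFace x⟩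

theorem affineFace_ext {F G : AffineFace d} (h : F.1 = G.1) : F = G := Subtype.ext h

theorem eq_facetFace_of_isFacet {F : AffineFace d} (h : IsFacet F) {x : TilingVertex d}
    (hx : F.1 ⊆ facet x) : F = facetFace x := (h (facetFace x) hx).symm

theorem eq_facetFace_of_superset {F : AffineFace d} {x : TilingVertex d} (h : facet x ⊆ F.1) :
    F = facetFace x := by
  obtain ⟨y, hy⟩ := exists_facet_superset F
  have := eq_of_facet_subset (h.trans hy)
  subst this
  exact affineFace_ext (hy.antisymm h)

/-- Values of a permutation differ by at most `d`, so every vertex of `F` meets the closeness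
criterion `weightVec_mem_facet`. -/
theorem eq_facetFace_of_isDual {F : AffineFace d} {x : TilingVertex d} (h : IsDual F x) :
    F = facetFace x := by
  refine eq_facetFace_of_isFacet h.1 fun v hv => ?_
  obtain ⟨π, hπ⟩ := h.2 v hv
  obtain ⟨a, rfl⟩ := mem_weightLattice_iff.1 (F.2.2.1 v hv)
  refine weightVec_mem_facet fun i j => ?_
  have e : ((x.1 j - x.1 i : ℤ) : ℝ) =
      ((((π j : ℕ) : ℤ) - ((π i : ℕ) : ℤ) + ((d : ℤ) + 1) * (a j - a i) : ℤ) : ℝ) := by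
    have := weightVec_sub_apply a j i
    push_cast at this ⊢
    rw [hπ i, hπ j, ← this]
    ring
  have e' := Int.cast_injective e
  have h1 : ((π i : ℕ) : ℤ) ≤ d := by exact_mod_cast Nat.lt_succ_iff.1 (π i).is_lt
  rw [e']
  linarith [Int.natCast_nonneg (π j : ℕ)]

theorem mem_affSublattice_iff {t : Fin (d + 1) → ℝ} :
    t ∈ affSublattice k ↔
      ∃ a, Fintype.linearCombination ℤ (w d) a ∈ sublattice k ∧ t = weightVec a := by
  constructor
  · rintro ⟨a, ha, rfl⟩
    exact ⟨a, linComb_mem_sublattice_iff.2 ha, linComb_wAff a⟩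
  · rintro ⟨a, ha, rfl⟩
    exact ⟨a, linComb_mem_sublattice_iff.1 ha, linComb_wAff a⟩

theorem corner_translate {x y : TilingVertex d} {a : Fin (d + 1) → ℤ}
    (h : y.1 = x.1 + Fintype.linearCombination ℤ (w d) a) (s : ℤ) (i : Fin (d + 1)) :
    corner y s i = corner x (s - ∑ j, a j) i + a i := by
  have h1 := corner_spec x (s - ∑ j, a j) i
  have h2 : y.1 i = x.1 i + (((d : ℤ) + 1) * a i - ∑ j, a j) := by
    rw [h, Pi.add_apply, linComb_w_apply]
  rw [corner_eq_iff, h2]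
  constructor <;> linarith

theorem facet_translate {x y : TilingVertex d} {a : Fin (d + 1) → ℤ}
    (h : y.1 = x.1 + Fintype.linearCombination ℤ (w d) a) :
    facet y = (facet x).map (addRightEmbedding (weightVec a)) := by
  have hv : ∀ s, vert y s = vert x (s - ∑ j, a j) + weightVec a := by
    intro s
    rw [vert, vert, ← weightVec_add]
    exact congrArg weightVec (funext fun i => corner_translate h s i)
  ext v
  simp only [Finset.mem_map, mem_facet_iff, addRightEmbedding_apply]
  constructor
  · rintro ⟨s, rfl⟩
    exact ⟨_, ⟨_, rfl⟩, (hv s).symm⟩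
  · rintro ⟨-, ⟨s, rfl⟩, rfl⟩
    refine ⟨s + ∑ j, a j, ?_⟩
    rw [hv, add_sub_cancel_right]

/-- Translates of facets by the sublattice are dual to equivalent vertices. -/
theorem exists_translate (x : TilingVertex d) {t : Fin (d + 1) → ℝ} (ht : t ∈ affSublattice k) :
    ∃ y, cls k x = cls k y ∧ facet y = (facet x).map (addRightEmbedding t) := by
  obtain ⟨a, ha, rfl⟩ := mem_affSublattice_iff.1 ht
  exact ⟨tilingTranslation ⟨_, sublattice_le_lattice k ha⟩ x, cls_eq_iff.2 ⟨_, ha, rfl⟩,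
    facet_translate rfl⟩

theorem faceCls_eq_iff {F G : AffineFace d} :
    faceCls k F = faceCls k G ↔
      ∃ t ∈ affSublattice k, G.1 = F.1.map (addRightEmbedding t) := Quotient.eq

theorem faceCls_surjective (c : TorusFace k) : ∃ F, faceCls k F = c := Quotient.exists_rep c

theorem faceCls_facetFace_eq_iff {x y : TilingVertex d} :
    faceCls k (facetFace x) = faceCls k (facetFace y) ↔ cls k x = cls k y := by
  constructor
  · intro h
    obtain ⟨t, ht, h⟩ := faceCls_eq_iff.1 h
    obtain ⟨z, hz, hz'⟩ := exists_translate x ht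
    have : z = y := eq_of_facet_subset (hz'.trans h.symm).subset
    rwa [← this]
  · intro h
    obtain ⟨v, hv, h⟩ := cls_eq_iff.1 h
    obtain ⟨a, rfl⟩ := sublattice_le_lattice k hv
    exact faceCls_eq_iff.2 ⟨_, mem_affSublattice_iff.2 ⟨a, hv, rfl⟩, facet_translate h⟩

/-- The facet class of `T_k` dual to a vertex of `H_k`. -/
noncomputable def dualFacet (a : HeawoodVertex k) : TorusFace k :=
  Quotient.lift (fun x => faceCls k (facetFace x))
    (fun _ _ h => faceCls_facetFace_eq_iff.2 (Quotient.sound h)) a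

theorem dualFacet_cls (x : TilingVertex d) :
    dualFacet (cls k x) = faceCls k (facetFace x) := rfl

theorem dualFacet_injective : Function.Injective (dualFacet (k := k)) := by
  intro a b h
  obtain ⟨x, rfl⟩ := cls_surjective a
  obtain ⟨y, rfl⟩ := cls_surjective b
  exact faceCls_facetFace_eq_iff.1 h

/-- The translate of a face by a vector of the sublattice. -/
noncomputable def translateFace (F : AffineFace d) {t : Fin (d + 1) → ℝ}
    (ht : t ∈ affSublattice k) : AffineFace d :=
  ⟨F.1.map (addRightEmbedding t), by
    obtain ⟨x, hx⟩ := exists_facet_superset F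
    obtain ⟨y, -, hy⟩ := exists_translate x ht
    exact (mkFace _ (F.2.1.map) y (hy ▸ Finset.map_subset_map.2 hx)).2⟩

theorem faceCls_translateFace (F : AffineFace d) {t : Fin (d + 1) → ℝ}
    (ht : t ∈ affSublattice k) : faceCls k (translateFace F ht) = faceCls k F :=
  (faceCls_eq_iff.2 ⟨t, ht, rfl⟩).symm

/-- A face class below the class of `G` has a representative in `G`. -/
theorem exists_rep_of_torusLE {c : TorusFace k} {G : AffineFace d}
    (h : TorusLE k c (faceCls k G)) : ∃ F, faceCls k F = c ∧ F.1 ⊆ G.1 := by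
  obtain ⟨F, G', rfl, hG, hs⟩ := h
  obtain ⟨t, ht, hG⟩ := faceCls_eq_iff.1 hG
  refine ⟨translateFace F ht, faceCls_translateFace F ht, ?_⟩
  rw [hG]
  exact Finset.map_subset_map.2 hs

/-- A face class above the class of `F` has a representative containing `F`. -/
theorem exists_rep_of_torusLE' {c : TorusFace k} {F : AffineFace d}
    (h : TorusLE k (faceCls k F) c) : ∃ G, faceCls k G = c ∧ F.1 ⊆ G.1 := by
  obtain ⟨F', G, hF, rfl, hs⟩ := h
  obtain ⟨t, ht, hF⟩ := faceCls_eq_iff.1 hF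
  refine ⟨translateFace G ht, faceCls_translateFace G ht, ?_⟩
  rw [hF]
  exact Finset.map_subset_map.2 hs

theorem torusLE_of_subset {F G : AffineFace d} (h : F.1 ⊆ G.1) :
    TorusLE k (faceCls k F) (faceCls k G) := ⟨F, G, rfl, rfl, h⟩

theorem card_eq_of_faceCls_eq {F G : AffineFace d} (h : faceCls k F = faceCls k G) :
    F.1.card = G.1.card := by
  obtain ⟨t, -, h⟩ := faceCls_eq_iff.1 h
  rw [h, Finset.card_map]

/-- Maximal elements of the face poset of `T_k`. -/
def IsMaxFace (c : TorusFace k) : Prop := ∀ c', TorusLE k c c' → c' = c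

theorem isMaxFace_dualFacet (a : HeawoodVertex k) : IsMaxFace (dualFacet a) := by
  intro c hc
  obtain ⟨x, rfl⟩ := cls_surjective a
  obtain ⟨G, rfl, hG⟩ := exists_rep_of_torusLE' hc
  rw [eq_facetFace_of_superset hG]
  rfl

theorem exists_dualFacet_of_isMaxFace {c : TorusFace k} (hc : IsMaxFace c) :
    ∃ a, dualFacet a = c := by
  obtain ⟨F, rfl⟩ := faceCls_surjective c
  obtain ⟨x, hx⟩ := exists_facet_superset F
  exact ⟨cls k x, hc _ (torusLE_of_subset (G := facetFace x) hx)⟩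

theorem not_isMaxFace_of_card_ne {F : AffineFace d} (h : F.1.card ≠ d + 1) :
    ¬ IsMaxFace (faceCls k F) := by
  intro hm
  obtain ⟨a, ha⟩ := exists_dualFacet_of_isMaxFace hm
  obtain ⟨x, rfl⟩ := cls_surjective a
  exact h ((card_eq_of_faceCls_eq ha).symm.trans (card_facet x))

/-- Ridges: faces that are not facets, but all of whose proper superfaces are. -/
def IsRidge (c : TorusFace k) : Prop :=
  ¬ IsMaxFace c ∧ ∀ c', TorusLE k c c' → c' = c ∨ IsMaxFace c'

variable [Fact (2 ≤ d)]

omit [Fact (2 ≤ d)] in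
theorem cast_eq_neg_iff {s : ℤ} {r : ZMod (d + 1)} {m : ℤ} (hm : (m : ZMod (d + 1)) = r) :
    (s : ZMod (d + 1)) = -r ↔ ∃ q, m + s = ((d : ℤ) + 1) * q := by
  rw [← hm, eq_neg_iff_add_eq_zero, ← Int.cast_add, ZMod.intCast_zmod_eq_zero_iff_dvd, add_comm s]
  push_cast
  rfl

/-- The step `r` moves `x_i + s - 1` across a multiple of `d + 1` only if `r + s = 0`. So the label
`r` crosses the ridge opposite the vertex number `-r`. -/
theorem corner_nbr {x : TilingVertex d} {r : ZMod (d + 1)} {s : ℤ}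
    (hs : (s : ZMod (d + 1)) ≠ -r) : corner (nbr x r) s = corner x s := by
  funext i
  have h := corner_spec x s i
  rw [corner_eq_iff, nbr_apply]
  have hd : (0 : ℤ) < (d : ℤ) + 1 := by positivity
  have h1 : i = idx x r → x.1 i + s - 1 ≠ ((d : ℤ) + 1) * corner x s i + d := by
    intro hi h2
    refine hs ((cast_eq_neg_iff (coe_idx x r)).2 ⟨corner x s i + 1, ?_⟩)
    rw [← hi]
    linarith
  have h2 : i = idx x (r + 1) → x.1 i + s - 1 ≠ ((d : ℤ) + 1) * corner x s i := by
    intro hi h2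
    refine hs ((cast_eq_neg_iff (m := x.1 (idx x (r + 1)) - 1) ?_).2 ⟨corner x s i, ?_⟩)
    · push_cast
      rw [coe_idx]
      ring
    · rw [← hi]
      linarith
  have hne := idx_ne x r
  split_ifs with g1 g2
  · exact absurd (g1.symm.trans g2) hne
  · have := h1 g1
    omega
  · have := h2 ‹_›
    omega
  · omega

/-- The floors near their jumps bound `y_i` by `x_i` on both sides. Ignoring the vertex number `-r`
frees only the coordinate of residue `r`, upwards by at most 1, and that of residue `r + 1`,
downwards; the coordinate sum couples them. -/
theorem nbr_of_corner {x y : TilingVertex d} {r : ZMod (d + 1)}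
    (h : ∀ s : ℤ, (s : ZMod (d + 1)) ≠ -r → corner y s = corner x s) : y = x ∨ y = nbr x r := by
  have hd : (2 : ℤ) ≤ d := by exact_mod_cast Fact.out (p := 2 ≤ d)
  have key : ∀ (i : Fin (d + 1)) (m q : ℤ), ((m - x.1 i : ℤ) : ZMod (d + 1)) ≠ -r →
      ((d : ℤ) + 1) * q ≤ m - 1 → m - 1 < ((d : ℤ) + 1) * q + ((d : ℤ) + 1) →
      ((d : ℤ) + 1) * q ≤ y.1 i + m - x.1 i - 1 ∧
        y.1 i + m - x.1 i - 1 < ((d : ℤ) + 1) * q + ((d : ℤ) + 1) := by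
    intro i m q hm h1 h2
    have h3 : corner x (m - x.1 i) i = q := by
      rw [corner_eq_iff]
      constructor <;> linarith
    rw [← h _ hm, corner_eq_iff] at h3
    constructor <;> linarith [h3.1, h3.2]
  have cast_ne : ∀ (i : Fin (d + 1)) (m : ℤ), (x.1 i : ZMod (d + 1)) ≠ r + m →
      ((m - x.1 i : ℤ) : ZMod (d + 1)) ≠ -r := by
    intro i m hne he
    push_cast at he
    exact hne (by linear_combination -he)
  have hlow : ∀ i, (x.1 i : ZMod (d + 1)) ≠ r + 1 → x.1 i ≤ y.1 i := by
    intro i hi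
    have := key i 1 0 (cast_ne i 1 (by simpa using hi)) (by linarith) (by linarith)
    linarith [this.1]
  have hup : ∀ i, (x.1 i : ZMod (d + 1)) ≠ r → y.1 i ≤ x.1 i := by
    intro i hi
    have := key i 0 (-1) (cast_ne i 0 (by simpa using hi)) (by linarith) (by linarith)
    linarith [this.2]
  have hup' : ∀ i, (x.1 i : ZMod (d + 1)) = r → y.1 i ≤ x.1 i + 1 := by
    intro i hi
    have := key i (-1) (-1) (cast_ne i (-1) (by rw [hi]; simp)) (by linarith)
      (by linarith)
    linarith [this.2]
  have hdiff : ∀ i, y.1 i - x.1 i =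
      (if i = idx x r then y.1 (idx x r) - x.1 (idx x r) else 0) +
      (if i = idx x (r + 1) then y.1 (idx x (r + 1)) - x.1 (idx x (r + 1)) else 0) := by
    intro i
    have hne := idx_ne x r
    split_ifs with g1 g2 g2
    · exact absurd (g1.symm.trans g2) hne
    · rw [← g1]; ring
    · rw [← g2]; ring
    · rw [eq_idx_iff] at g1 g2
      linarith [hlow i g2, hup i g1]
  have hsum : ∑ i, (y.1 i - x.1 i) = 0 := by
    rw [Finset.sum_sub_distrib, x.2.1, y.2.1, sub_self]
  rw [Finset.sum_congr rfl fun i _ => hdiff i, Finset.sum_add_distrib] at hsum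
  simp only [Finset.sum_ite_eq', Finset.mem_univ, if_true] at hsum
  have b1 := hlow (idx x r) (by rw [coe_idx]; exact ne_add_one r)
  have b2 := hup' (idx x r) (coe_idx x r)
  by_cases hcase : y.1 (idx x r) = x.1 (idx x r)
  · left
    refine tilingVertex_ext fun i => ?_
    have h1 := hdiff i
    have h2 : y.1 (idx x (r + 1)) - x.1 (idx x (r + 1)) = 0 := by linarith
    rw [h2, hcase] at h1
    simp only [sub_self, ite_self, add_zero] at h1
    linarith
  · right
    have e1 : y.1 (idx x r) - x.1 (idx x r) = 1 := by omega
    have e2 : y.1 (idx x (r + 1)) - x.1 (idx x (r + 1)) = -1 := by linarith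
    refine tilingVertex_ext fun i => ?_
    have h1 := hdiff i
    rw [e1, e2] at h1
    rw [nbr_apply]
    split_ifs at h1 ⊢ <;> linarith

omit [Fact (2 ≤ d)] in
theorem exists_int_cast (r : ZMod (d + 1)) : ∃ s : ℤ, (s : ZMod (d + 1)) = r :=
  ZMod.intCast_surjective r

omit [Fact (2 ≤ d)] in
theorem vert_eq_of_cast_eq (x : TilingVertex d) {s t : ℤ}
    (h : (s : ZMod (d + 1)) = (t : ZMod (d + 1))) : vert x s = vert x t := by
  obtain ⟨c, hc⟩ := (ZMod.intCast_eq_intCast_iff_dvd_sub _ _ (d + 1)).1 h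
  have : t = s + ((d : ℤ) + 1) * c := by
    push_cast at hc
    linarith
  rw [this, vert_add_mul]

/-- All vertices but one of a facet belong to the adjacent facet. -/
theorem erase_subset_facet_nbr (x : TilingVertex d) {s : ℤ} {r : ZMod (d + 1)}
    (hs : (s : ZMod (d + 1)) = -r) : (facet x).erase (vert x s) ⊆ facet (nbr x r) := by
  intro v hv
  obtain ⟨hne, hv⟩ := Finset.mem_erase.1 hv
  obtain ⟨t, rfl⟩ := mem_facet_iff.1 hv
  have ht : (t : ZMod (d + 1)) ≠ -r := by
    intro h
    exact hne (vert_eq_of_cast_eq x (h.trans hs.symm))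
  rw [vert, ← corner_nbr ht]
  exact vert_mem_facet _ _

theorem vert_not_mem_facet_nbr (x : TilingVertex d) {s : ℤ} {r : ZMod (d + 1)}
    (hs : (s : ZMod (d + 1)) = -r) : vert x s ∉ facet (nbr x r) := by
  intro h
  refine nbr_ne x r (eq_of_facet_subset fun v hv => ?_).symm
  by_cases hvs : v = vert x s
  · rwa [hvs]
  · exact erase_subset_facet_nbr x hs (Finset.mem_erase.2 ⟨hvs, hv⟩)

/-- A ridge is a face with `d` vertices, so it misses one vertex of the facet, and `nbr_of_corner`
leaves a single other facet containing it. -/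
theorem adj_iff_ridge (hk : ∀ i, 1 ≤ k i) {a b : HeawoodVertex k} :
    (heawoodGraph k).Adj a b ↔
      a ≠ b ∧ ∃ c, IsRidge c ∧ TorusLE k c (dualFacet a) ∧ TorusLE k c (dualFacet b) := by
  constructor
  · intro hab
    refine ⟨hab.ne, ?_⟩
    obtain ⟨x, rfl⟩ := cls_surjective a
    obtain ⟨r, rfl⟩ := (heawoodGraph_adj_iff hk _ _).1 hab
    obtain ⟨s, hs⟩ := exists_int_cast (-r)
    have hcard : ((facet x).erase (vert x s)).card = d := by
      rw [Finset.card_erase_of_mem (vert_mem_facet x s), card_facet, Nat.add_sub_cancel]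
    have hd := Fact.out (p := 2 ≤ d)
    let F : AffineFace d := mkFace ((facet x).erase (vert x s))
      (Finset.card_pos.1 (by omega)) x (Finset.erase_subset _ _)
    have hF : F.1.card = d := hcard
    refine ⟨faceCls k F, ⟨not_isMaxFace_of_card_ne (by omega), fun c' hc' => ?_⟩,
      torusLE_of_subset (G := facetFace x) (Finset.erase_subset _ _),
      torusLE_of_subset (G := facetFace (nbr x r)) (erase_subset_facet_nbr x hs)⟩
    obtain ⟨G, rfl, hG⟩ := exists_rep_of_torusLE' hc'
    obtain ⟨z, hz⟩ := exists_facet_superset G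
    by_cases hGc : G.1.card ≤ d
    · left
      rw [affineFace_ext (Finset.eq_of_subset_of_card_le hG (by omega))]
    · right
      have : G = facetFace z := affineFace_ext
        (Finset.eq_of_subset_of_card_le hz ((card_facet z).trans_le (by omega)))
      rw [this]
      exact isMaxFace_dualFacet (cls k z)
  · rintro ⟨hab, c, hc, ha, hb⟩
    obtain ⟨x, rfl⟩ := cls_surjective a
    obtain ⟨F, rfl, hF⟩ := exists_rep_of_torusLE (G := facetFace x) ha
    obtain ⟨G, hG, hFG⟩ := exists_rep_of_torusLE' hb
    obtain ⟨y, hy⟩ := exists_facet_superset G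
    have hGy : G.1 = facet y := by
      refine Finset.eq_of_subset_of_card_le hy ?_
      obtain ⟨z, rfl⟩ := cls_surjective b
      rw [card_facet, card_eq_of_faceCls_eq hG]
      exact (card_facet z).ge
    have hby : b = cls k y := by
      refine dualFacet_injective (hG.symm.trans ?_)
      rw [dualFacet_cls]
      exact congrArg _ (affineFace_ext hGy)
    subst hby
    rw [hGy] at hFG
    obtain ⟨v, hv, hvF⟩ : ∃ v ∈ facet x, v ∉ F.1 := by
      by_contra hcon
      push Not at hcon
      have : F = facetFace x := affineFace_ext (Finset.Subset.antisymm hF hcon)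
      rw [this] at hc
      exact hc.1 (isMaxFace_dualFacet (cls k x))
    obtain ⟨s, rfl⟩ := mem_facet_iff.1 hv
    have hFE : F.1 ⊆ (facet x).erase (vert x s) := fun u hu =>
      Finset.mem_erase.2 ⟨fun h => hvF (h ▸ hu), hF hu⟩
    have hcard : ((facet x).erase (vert x s)).card = d := by
      rw [Finset.card_erase_of_mem (vert_mem_facet x s), card_facet, Nat.add_sub_cancel]
    let E : AffineFace d := mkFace ((facet x).erase (vert x s)) (F.2.1.mono hFE) x
      (Finset.erase_subset _ _)
    have hE : E.1.card = d := hcard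
    have hEF : faceCls k E = faceCls k F :=
      (hc.2 _ (torusLE_of_subset (G := E) hFE)).resolve_right
        (not_isMaxFace_of_card_ne (by omega))
    have hFE' : F.1 = E.1 :=
      Finset.eq_of_subset_of_card_le hFE (card_eq_of_faceCls_eq hEF).le
    have hyx : y = x ∨ y = nbr x (-(s : ZMod (d + 1))) := by
      refine nbr_of_corner fun t ht => ?_
      rw [neg_neg] at ht
      have hmem : vert x t ∈ F.1 := by
        rw [hFE']
        refine Finset.mem_erase.2 ⟨fun h => ht ?_, vert_mem_facet x t⟩
        obtain ⟨⟨q, hq⟩, -⟩ := vert_eq_vert h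
        rw [hq]
        have h0 : ((d : ZMod (d + 1)) + 1) = 0 := by exact_mod_cast ZMod.natCast_self (d + 1)
        push_cast
        rw [h0]
        ring
      obtain ⟨u, hu⟩ := mem_facet_iff.1 (hFG hmem)
      exact (vert_eq_vert hu).2
    rcases hyx with rfl | rfl
    · exact absurd rfl hab
    · exact adj_cls_nbr hk x _

/-- Faces of `T_k` are determined by the facets above them. -/
theorem subset_of_facets_above (hk : ∀ i, 1 ≤ k i) {F G : AffineFace d} {x : TilingVertex d}
    (hF : F.1 ⊆ facet x) (hG : G.1 ⊆ facet x)
    (h : ∀ a, TorusLE k (faceCls k G) (dualFacet a) → TorusLE k (faceCls k F) (dualFacet a)) :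
    F.1 ⊆ G.1 := by
  intro v hv
  by_contra hvG
  obtain ⟨s, rfl⟩ := mem_facet_iff.1 (hF hv)
  have hs : (s : ZMod (d + 1)) = -(-(s : ZMod (d + 1))) := (neg_neg _).symm
  have hGn : G.1 ⊆ facet (nbr x (-(s : ZMod (d + 1)))) := fun u hu =>
    erase_subset_facet_nbr x hs (Finset.mem_erase.2 ⟨fun e => hvG (e ▸ hu), hG hu⟩)
  -- The facet across the ridge opposite `vert x s` contains `G`, hence a translate of `F`, but not
  -- `vert x s`.
  set y := nbr x (-(s : ZMod (d + 1))) with hy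
  obtain ⟨F', hF', hF'y⟩ := exists_rep_of_torusLE (G := facetFace y)
    (h (cls k y) (torusLE_of_subset (G := facetFace y) hGn))
  obtain ⟨t, ht, hFt⟩ := faceCls_eq_iff.1 hF'.symm
  obtain ⟨a, ha, rfl⟩ := mem_affSublattice_iff.1 ht
  have hmem : vert x s + weightVec a ∈ facet y := hF'y (by
    rw [hFt]
    exact Finset.mem_map.2 ⟨_, hv, rfl⟩)
  obtain ⟨u, hu⟩ := mem_facet_iff.1 hmem
  rw [vert, vert, ← weightVec_add] at hu
  obtain ⟨c, hc⟩ := weightVec_eq_iff.1 hu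
  have hd : (0 : ℤ) < (d : ℤ) + 1 := by positivity
  -- `vert x s` and its translate lie in facets dual to adjacent tiling vertices, so the translation
  -- is too short to be nonzero.
  have hzero := mem_sublattice_eq_zero hk ha (fun i j => by
    rw [linComb_w_apply, linComb_w_apply]
    have i1 := corner_spec y u i
    have i2 := corner_spec x s i
    have j1 := corner_spec y u j
    have j2 := corner_spec x s j
    have i3 := nbr_apply_le x (-(s : ZMod (d + 1))) i
    have j3 := le_nbr_apply x (-(s : ZMod (d + 1))) j
    rw [← hy] at i3 j3
    have ci := hc i
    have cj := hc j
    have e : a i - a j = (corner y u i - corner x s i) - (corner y u j - corner x s j) := by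
      linarith
    have e' : ((d : ℤ) + 1) * (a i - a j) =
        (((d : ℤ) + 1) * corner y u i - ((d : ℤ) + 1) * corner x s i) -
        (((d : ℤ) + 1) * corner y u j - ((d : ℤ) + 1) * corner x s j) := by rw [e]; ring
    linarith)
  have ha0 : weightVec a = 0 := by
    have hconst : ∀ i, (0 : ℤ) = a i + -(a 0) := by
      intro i
      have h1 := congrFun hzero i
      have h2 := congrFun hzero 0
      rw [linComb_w_apply] at h1 h2
      have h3 : ((d : ℤ) + 1) * (a i - a 0) = 0 := by
        simp only [Pi.zero_apply] at h1 h2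
        linarith
      have := (mul_eq_zero.1 h3).resolve_left hd.ne'
      linarith
    rw [weightVec_eq_iff.2 ⟨_, hconst⟩]
    funext i
    simp [weightVec]
  rw [ha0, add_zero] at hmem
  exact vert_not_mem_facet_nbr x hs hmem

theorem eq_of_facets_above (hk : ∀ i, 1 ≤ k i) {c c' : TorusFace k}
    (h : ∀ a, TorusLE k c (dualFacet a) ↔ TorusLE k c' (dualFacet a)) : c = c' := by
  obtain ⟨F, rfl⟩ := faceCls_surjective c
  obtain ⟨x, hx⟩ := exists_facet_superset F
  obtain ⟨G, rfl, hG⟩ := exists_rep_of_torusLE (G := facetFace x)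
    ((h (cls k x)).1 (torusLE_of_subset (G := facetFace x) hx))
  have : F = G := affineFace_ext (Finset.Subset.antisymm
    (subset_of_facets_above hk hx hG fun a => (h a).2)
    (subset_of_facets_above hk hG hx fun a => (h a).1))
  rw [this]

end Poset

end Heawood

namespace Heawood

/-! ### The isomorphism of the automorphism groups -/

section TorusAut

variable {d : ℕ} {k : Fin (d + 1) → ℕ}

theorem torusAut_le_iff (σ : TorusAut k) {c c' : TorusFace k} :
    TorusLE k (σ c) (σ c') ↔ TorusLE k c c' := σ.map_rel_iff

theorem isMaxFace_map_iff (σ : TorusAut k) (c : TorusFace k) :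
    IsMaxFace (σ c) ↔ IsMaxFace c := by
  constructor
  · intro h c' hc'
    exact σ.injective (h _ ((torusAut_le_iff σ).2 hc'))
  · intro h c' hc'
    obtain ⟨c', rfl⟩ := σ.surjective c'
    rw [h c' ((torusAut_le_iff σ).1 hc')]

theorem isRidge_map_iff (σ : TorusAut k) (c : TorusFace k) : IsRidge (σ c) ↔ IsRidge c := by
  constructor
  · rintro ⟨h1, h2⟩
    refine ⟨fun h => h1 ((isMaxFace_map_iff σ c).2 h), fun c' hc' => ?_⟩
    rcases h2 (σ c') ((torusAut_le_iff σ).2 hc') with h | h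
    · exact Or.inl (σ.injective h)
    · exact Or.inr ((isMaxFace_map_iff σ c').1 h)
  · rintro ⟨h1, h2⟩
    refine ⟨fun h => h1 ((isMaxFace_map_iff σ c).1 h), fun c' hc' => ?_⟩
    obtain ⟨c', rfl⟩ := σ.surjective c'
    rcases h2 c' ((torusAut_le_iff σ).1 hc') with h | h
    · exact Or.inl (by rw [h])
    · exact Or.inr ((isMaxFace_map_iff σ c').2 h)

/-- The vertices of `H_k` correspond to the maximal faces of `T_k`. -/
noncomputable def maxFaceEquiv : HeawoodVertex k ≃ {c : TorusFace k // IsMaxFace c} :=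
  Equiv.ofBijective (fun a => ⟨dualFacet a, isMaxFace_dualFacet a⟩)
    ⟨fun _ _ h => dualFacet_injective (congrArg Subtype.val h), fun c =>
      (exists_dualFacet_of_isMaxFace c.2).imp fun _ h => Subtype.ext h⟩

/-- The action of an automorphism of `T_k` on the vertices of `H_k`. -/
noncomputable def dualPerm (σ : TorusAut k) : HeawoodVertex k ≃ HeawoodVertex k :=
  (maxFaceEquiv.trans (σ.toEquiv.subtypeEquiv fun c => (isMaxFace_map_iff σ c).symm)).trans
    maxFaceEquiv.symm

theorem dualFacet_dualPerm (σ : TorusAut k) (a : HeawoodVertex k) :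
    dualFacet (dualPerm σ a) = σ (dualFacet a) :=
  congrArg Subtype.val (maxFaceEquiv.apply_symm_apply _)

variable [Fact (2 ≤ d)]

/-- The automorphism of `H_k` dual to an automorphism of `T_k`. -/
noncomputable def dualAut (hk : ∀ i, 1 ≤ k i) (σ : TorusAut k) : HeawoodAut k where
  toEquiv := dualPerm σ
  map_rel_iff' := by
    intro a b
    rw [adj_iff_ridge hk, adj_iff_ridge hk, dualFacet_dualPerm, dualFacet_dualPerm,
      (dualPerm σ).injective.ne_iff]
    refine and_congr_right fun _ => ⟨?_, ?_⟩
    · rintro ⟨c, h1, h2, h3⟩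
      obtain ⟨c, rfl⟩ := σ.surjective c
      exact ⟨c, (isRidge_map_iff σ c).1 h1, (torusAut_le_iff σ).1 h2, (torusAut_le_iff σ).1 h3⟩
    · rintro ⟨c, h1, h2, h3⟩
      exact ⟨σ c, (isRidge_map_iff σ c).2 h1, (torusAut_le_iff σ).2 h2, (torusAut_le_iff σ).2 h3⟩

theorem dualFacet_dualAut (hk : ∀ i, 1 ≤ k i) (σ : TorusAut k) (a : HeawoodVertex k) :
    dualFacet (dualAut hk σ a) = σ (dualFacet a) := dualFacet_dualPerm σ a

/-- Duality as a homomorphism. -/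
noncomputable def dualHom (hk : ∀ i, 1 ≤ k i) : TorusAut k →* HeawoodAut k where
  toFun := dualAut hk
  map_one' := RelIso.ext fun a => dualFacet_injective (dualFacet_dualAut hk 1 a)
  map_mul' σ σ' := RelIso.ext fun a => dualFacet_injective (by
    rw [dualFacet_dualAut, RelIso.mul_apply, RelIso.mul_apply, dualFacet_dualAut,
      dualFacet_dualAut])

/-- An automorphism fixing all facets preserves the set of facets above each face, which determines
the face. -/
theorem dualHom_injective (hk : ∀ i, 1 ≤ k i) : Function.Injective (dualHom hk) := by
  rw [injective_iff_map_eq_one]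
  intro σ hσ
  have hfix : ∀ a, σ (dualFacet a) = dualFacet a := by
    intro a
    rw [← dualFacet_dualAut hk]
    exact congrArg dualFacet (congrArg (fun φ : HeawoodAut k => φ a) hσ)
  refine RelIso.ext fun c => eq_of_facets_above hk fun a => ?_
  conv_lhs => rw [← hfix a]
  exact torusAut_le_iff σ

omit [Fact (2 ≤ d)] in
theorem map_subset_facet {f : (Fin (d + 1) → ℝ) ≃ (Fin (d + 1) → ℝ)}
    {g : TilingVertex d → TilingVertex d}
    (hfg : ∀ x, (facet x).map f.toEmbedding = facet (g x)) (F : AffineFace d) :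
    ∃ y, F.1.map f.toEmbedding ⊆ facet y := by
  obtain ⟨x, hx⟩ := exists_facet_superset F
  exact ⟨g x, hfg x ▸ Finset.map_subset_map.2 hx⟩

omit [Fact (2 ≤ d)] in
theorem map_symm_facet {f : (Fin (d + 1) → ℝ) ≃ (Fin (d + 1) → ℝ)}
    {g : tilingGraph d ≃g tilingGraph d}
    (hfg : ∀ x, (facet x).map f.toEmbedding = facet (g x)) (x : TilingVertex d) :
    (facet x).map f.symm.toEmbedding = facet (g.symm x) := by
  have h := hfg (g.symm x)
  rw [RelIso.apply_symm_apply] at h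
  rw [← h, Finset.map_map]
  ext v
  simp

/-- The action on faces of a map of the ambient space that maps facets to facets. -/
noncomputable def faceEquiv (f : (Fin (d + 1) → ℝ) ≃ (Fin (d + 1) → ℝ))
    (g : tilingGraph d ≃g tilingGraph d)
    (hfg : ∀ x, (facet x).map f.toEmbedding = facet (g x)) : AffineFace d ≃ AffineFace d where
  toFun F := ⟨F.1.map f.toEmbedding,
    (mkFace _ F.2.1.map _ (map_subset_facet hfg F).choose_spec).2⟩
  invFun F := ⟨F.1.map f.symm.toEmbedding,
    (mkFace _ F.2.1.map _ (map_subset_facet (map_symm_facet hfg) F).choose_spec).2⟩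
  left_inv F := affineFace_ext (by ext v; simp)
  right_inv F := affineFace_ext (by ext v; simp)

omit [Fact (2 ≤ d)] in
/-- A map of the ambient space compatible with facets and translations acts on `T_k`. -/
theorem exists_torusAut (f : (Fin (d + 1) → ℝ) ≃ (Fin (d + 1) → ℝ))
    (g : tilingGraph d ≃g tilingGraph d)
    (hfg : ∀ x, (facet x).map f.toEmbedding = facet (g x))
    (l : (Fin (d + 1) → ℝ) ≃ (Fin (d + 1) → ℝ)) (hfl : ∀ v t, f (v + t) = f v + l t)
    (hl : ∀ t, l t ∈ affSublattice k ↔ t ∈ affSublattice k) :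
    ∃ σ : TorusAut k, ∀ x, σ (faceCls k (facetFace x)) = faceCls k (facetFace (g x)) := by
  have hmap : ∀ (F : Finset (Fin (d + 1) → ℝ)) t,
      (F.map (addRightEmbedding t)).map f.toEmbedding =
        (F.map f.toEmbedding).map (addRightEmbedding (l t)) := by
    intro F t
    rw [Finset.map_map, Finset.map_map]
    congr 1
    ext v
    simp [hfl]
  let e := faceEquiv f g hfg
  have he : ∀ F, (e F).1 = F.1.map f.toEmbedding := fun F => rfl
  have hequiv : ∀ F F', faceSetoid k F F' ↔ faceSetoid k (e F) (e F') := by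
    intro F F'
    constructor
    · rintro ⟨t, ht, h⟩
      exact ⟨l t, (hl t).2 ht, by rw [he, he, h, hmap]⟩
    · rintro ⟨t, ht, h⟩
      obtain ⟨t, rfl⟩ := l.surjective t
      refine ⟨t, (hl t).1 ht, ?_⟩
      rw [he, he, ← hmap] at h
      exact Finset.map_injective _ h
  have key : ∀ F, Quotient.congr e hequiv (faceCls k F) = faceCls k (e F) := fun F => rfl
  refine ⟨⟨Quotient.congr e hequiv, ?_⟩, fun x => ?_⟩
  · intro a b
    constructor
    · intro h
      obtain ⟨F, rfl⟩ := faceCls_surjective a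
      obtain ⟨G, rfl⟩ := faceCls_surjective b
      rw [key, key] at h
      obtain ⟨F', hF', hs⟩ := exists_rep_of_torusLE h
      obtain ⟨F', rfl⟩ := e.surjective F'
      rw [← key, ← key] at hF'
      rw [← (Quotient.congr e hequiv).injective hF']
      rw [he, he] at hs
      exact torusLE_of_subset (Finset.map_subset_map.1 hs)
    · rintro ⟨F, G, rfl, rfl, hs⟩
      rw [key, key]
      refine torusLE_of_subset ?_
      rw [he, he]
      exact Finset.map_subset_map.2 hs
  · exact (key (facetFace x)).trans (congrArg (faceCls k) (affineFace_ext (hfg x)))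

theorem mem_range_dualHom (hk : ∀ i, 1 ≤ k i) {φ : HeawoodAut k} {g : tilingGraph d ≃g tilingGraph d}
    (hφ : ∀ x, φ (cls k x) = cls k (g x)) (f : (Fin (d + 1) → ℝ) ≃ (Fin (d + 1) → ℝ))
    (hfg : ∀ x, (facet x).map f.toEmbedding = facet (g x))
    (l : (Fin (d + 1) → ℝ) ≃ (Fin (d + 1) → ℝ)) (hfl : ∀ v t, f (v + t) = f v + l t)
    (hl : ∀ t, l t ∈ affSublattice k ↔ t ∈ affSublattice k) : φ ∈ (dualHom hk).range := by
  obtain ⟨σ, hσ⟩ := exists_torusAut f g hfg l hfl hl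
  refine ⟨σ, heawoodAut_ext fun x => dualFacet_injective ?_⟩
  change dualFacet (dualAut hk σ _) = _
  rw [dualFacet_dualAut, dualFacet_cls, hσ, hφ, dualFacet_cls]

theorem translationAut_mem_range (hk : ∀ i, 1 ≤ k i) (v : lattice d) :
    translationAut k v ∈ (dualHom hk).range := by
  obtain ⟨a, ha⟩ := v.2
  refine mem_range_dualHom hk (translationAut_cls v) (Equiv.addRight (weightVec a)) (fun x => ?_)
    (Equiv.refl _) (fun u t => ?_) fun t => Iff.rfl
  · rw [facet_translate (x := x) (y := tilingTranslation v x) (a := a)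
      (by rw [ha, tilingTranslation_val])]
    rfl
  · simp only [Equiv.coe_addRight, Equiv.refl_apply]
    abel

omit [Fact (2 ≤ d)] in
theorem corner_tilingRotation (x : TilingVertex d) (s : ℤ) (i : Fin (d + 1)) :
    corner (tilingRotation d x) s i = -corner x (-s) i := by
  have := corner_spec x (-s) i
  rw [corner_eq_iff, tilingRotation_val]
  constructor <;> linarith

omit [Fact (2 ≤ d)] in
theorem vert_tilingRotation (x : TilingVertex d) (s : ℤ) :
    vert (tilingRotation d x) s = -vert x (-s) := by
  funext i
  simp only [vert, weightVec, Pi.neg_apply, corner_tilingRotation, Finset.sum_neg_distrib]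
  push_cast
  ring

theorem rotationAut_mem_range (hk : ∀ i, 1 ≤ k i) : rotationAut k ∈ (dualHom hk).range := by
  refine mem_range_dualHom hk rotationAut_cls (Equiv.neg _) (fun x => ?_)
    (Equiv.neg _) (fun u t => ?_) fun t => ?_
  · ext v
    simp only [Finset.mem_map_equiv, mem_facet_iff, Equiv.neg_symm, Equiv.neg_apply,
      vert_tilingRotation]
    constructor
    · rintro ⟨s, hs⟩
      exact ⟨-s, by rw [neg_neg, ← hs, neg_neg]⟩
    · rintro ⟨s, rfl⟩
      exact ⟨-s, neg_neg _⟩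
  · simp only [Equiv.neg_apply]
    abel
  · rw [Equiv.neg_apply]
    exact neg_mem_iff

omit [Fact (2 ≤ d)] in
theorem weightVec_comp_perm (a : Fin (d + 1) → ℤ) (c : Equiv.Perm (Fin (d + 1)))
    (i : Fin (d + 1)) : weightVec (fun j => a (c j)) i = weightVec a (c i) := by
  simp only [weightVec, Equiv.sum_comp c a]

omit [Fact (2 ≤ d)] in
theorem perm_mem_affSublattice {c : Equiv.Perm (Fin (d + 1))} (hc : c ∈ cyclicStabilizer k)
    {t : Fin (d + 1) → ℝ} (ht : t ∈ affSublattice k) :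
    (fun i => t (c i)) ∈ affSublattice k := by
  obtain ⟨a, ha, rfl⟩ := mem_affSublattice_iff.1 ht
  refine mem_affSublattice_iff.2 ⟨fun j => a (c j), ?_, funext fun i =>
    (weightVec_comp_perm a c i).symm⟩
  convert perm_mem_sublattice hc ha using 1
  funext i
  rw [linComb_w_apply, linComb_w_apply, Equiv.sum_comp c a]

theorem cyclicAut_mem_range (hk : ∀ i, 1 ≤ k i) (c : cyclicStabilizer k) :
    cyclicAut k c ∈ (dualHom hk).range := by
  let f : (Fin (d + 1) → ℝ) ≃ (Fin (d + 1) → ℝ) := Equiv.arrowCongr c.1 (Equiv.refl ℝ)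
  have hf : ∀ u i, f u i = u (c.1.symm i) := fun u i => rfl
  have hf' : ∀ u i, f.symm u i = u (c.1 i) := fun u i => rfl
  refine mem_range_dualHom hk (cyclicAut_cls c) f (fun x => ?_) f (fun u t => rfl) fun t => ?_
  · have hv : ∀ s, vert (tilingPerm c.1 x) s = f (vert x s) := fun s =>
      funext fun i => weightVec_comp_perm (corner x s) c.1.symm i
    ext v
    simp only [Finset.mem_map_equiv, mem_facet_iff, hv]
    exact exists_congr fun s => Equiv.symm_apply_eq f
  · constructor
    · intro h
      have := perm_mem_affSublattice c.2 h
      convert this using 1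
      funext i
      rw [hf, Equiv.symm_apply_apply]
    · intro h
      exact perm_mem_affSublattice (inv_mem c.2) h

/-- Only the generators need to be realized, and each comes from an affine map of the ambient space
that respects facets and the sublattice. -/
theorem dualHom_surjective (hk : ∀ i, 1 ≤ k i) (hne : ∃ i j, k i ≠ k j) :
    Function.Surjective (dualHom hk) := by
  rw [← MonoidHom.range_eq_top, eq_top_iff, ← heawoodAut_closure hk hne, Subgroup.closure_le]
  rintro φ ((⟨v, rfl⟩ | rfl) | ⟨c, rfl⟩)
  · exact translationAut_mem_range hk v
  · exact rotationAut_mem_range hk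
  · exact cyclicAut_mem_range hk c

end TorusAut

end Heawood

theorem mainTheorem12 (d : ℕ) (hd : 2 ≤ d) (k : Fin (d + 1) → ℕ) (hk : ∀ i, 1 ≤ k i)
    (hne : ∃ i j, k i ≠ k j) :
    (∃ Φ : Heawood.TorusAut k ≃* Heawood.HeawoodAut k,
      ∀ (σ : Heawood.TorusAut k) (F F' : Heawood.AffineFace d) (x x' : Heawood.TilingVertex d),
        Heawood.IsDual F x → Heawood.IsDual F' x' →
        σ (Heawood.faceCls k F) = Heawood.faceCls k F' →
        Φ σ (Heawood.cls k x) = Heawood.cls k x') ∧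
    Subgroup.closure (Set.range (Heawood.translationAut k) ∪ {Heawood.rotationAut k} ∪
      Set.range (Heawood.cyclicAut k)) = (⊤ : Subgroup (Heawood.HeawoodAut k)) ∧
    (Nat.card (Heawood.HeawoodAut k) : ℤ) =
      2 * (Nat.card (Heawood.cyclicStabilizer k) : ℤ) * (Heawood.M k).det := by
  have : Fact (2 ≤ d) := ⟨hd⟩
  refine ⟨⟨MulEquiv.ofBijective (Heawood.dualHom hk)
    ⟨Heawood.dualHom_injective hk, Heawood.dualHom_surjective hk hne⟩, ?_⟩,
    Heawood.heawoodAut_closure hk hne, Heawood.card_heawoodAut hk hne⟩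
  intro σ F F' x x' hF hF' h
  refine Heawood.dualFacet_injective ?_
  change Heawood.dualFacet (Heawood.dualAut hk σ _) = _
  rw [Heawood.dualFacet_dualAut, Heawood.dualFacet_cls, Heawood.dualFacet_cls,
    ← Heawood.eq_facetFace_of_isDual hF, ← Heawood.eq_facetFace_of_isDual hF', h]
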